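/- For an integrable $I:[-1,1]\to\mathbb{R}$ and $k\in\mathbb{N}$ put $\langle I\rangle_k=\int_{-1}^1\mu^kI(\mu)\,d\mu$, and let \[ \Omega_R=\{(E_0,E_1,E_2)\in\mathbb{R}^3:\ \exists\, I>0 \text{ integrable on } [-1,1] \text{ with } \langle I\rangle_k=E_k,\ k=0,1,2\}. \] For $U=(E_0,E_1,E_2)\in\Omega_R$ let \[ \alpha=-\frac{3E_1/E_0}{2+\sqrt{4-3(E_1/E_0)^2}}\in(-1,1),\qquad \omega(\mu)=\frac{\varepsilon}{(1+\alpha\mu)^4},\qquad \varepsilon=\frac{3(1-\alpha^2)^3}{2(3+\alpha^2)}, \] so that $\int_{-1}^1\omega\,d\mu=1$, and let $\phi_0,\phi_1,\phi_2$ be the monic orthogonal polynomials of degrees $0,1,2$ on $[-1,1]$ with respect to the weight $\omega$. Let $\hat I=\omega\,(f_0\phi_0+f_1\phi_1+f_2\phi_2)$, where the real numbers $f_0,f_1,f_2$ are determined by $\langle\hat I\rangle_k=E_k$, $k=0,1,2$, and define $E_3(U)=\langle\hat I\rangle_3$. The $M_1$-$P_2$ system is the system $\frac1c\partial_tU+\partial_zF(U)=S$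 with flux $F(U)=(E_1,E_2,E_3(U))$. **Theorem.** The flux $F$ is differentiable at every point of $\Omega_R$, and for every $U\in\Omega_R$ the Jacobian $DF(U)$ has three distinct real eigenvalues $\lambda_1(U)<\lambda_2(U)<\lambda_3(U)$, which are differentiable functions on $\Omega_R$. Moreover: 1. the $1$- and the $3$-characteristic field are genuinely nonlinear on $\Omega_R$: for $k=1,3$, every $U\in\Omega_R$ and every eigenvector $r$ of $DF(U)$ for the eigenvalue $\lambda_k(U)$, one has $\nabla\lambda_k(U)\cdot r\neq0$; 2. the $2$-characteristic field is neither genuinely nonlinear nor linearly degenerate on $\Omega_R$: there are $U\in\Omega_R$ and an eigenvector $r$ of $DF(U)$ for $\lambda_2(U)$ with $\nabla\lambda_2(U)\cdot r=0$, and there are $U\in\Omega_R$ and such an eigenvector $r$ with $\nabla\lambda_2(U)\cdot r\neq0$. -/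

import Mathlib

open MeasureTheory

noncomputable section

namespace M1P

/-- The `k`-th moment `∫_{-1}^1 μ^k I(μ) dμ` of a specific intensity. -/
def moment (I : ℝ → ℝ) (k : ℕ) : ℝ := ∫ μ in (-1 : ℝ)..1, μ ^ k * I μ

/-- The realizable domain: all triples `(E₀, E₁, E₂)` of moments of positive intensities. -/
def realizableDomain : Set (Fin 3 → ℝ) :=
  {E | ∃ I : ℝ → ℝ, IntervalIntegrable I volume (-1) 1 ∧
    (∀ μ ∈ Set.Icc (-1 : ℝ) 1, 0 < I μ) ∧ ∀ k : Fin 3, moment I k = E k}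

/-- The weight `ε / (1 + α μ)^4`; for `|α| < 1` the constant `ε` is the one that makes its integral
over `[-1, 1]` equal to one. -/
def weight (α μ : ℝ) : ℝ :=
  (3 * (1 - α ^ 2) ^ 3 / (2 * (3 + α ^ 2))) / (1 + α * μ) ^ 4

/-- The monic orthogonal polynomials of the weight, by Gram-Schmidt:
`φ_j(μ) = μ^j - ∑_{k < j} (⟨μ^j, φ_k⟩ / ⟨μ^k, φ_k⟩) φ_k(μ)`. -/
def orthPoly (α : ℝ) (j : ℕ) : ℝ → ℝ := fun μ =>
  μ ^ j - ∑ k : Fin j,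
    ((∫ ν in (-1 : ℝ)..1, ν ^ j * orthPoly α k ν * weight α ν) /
      (∫ ν in (-1 : ℝ)..1, ν ^ (k : ℕ) * orthPoly α k ν * weight α ν)) * orthPoly α k μ
termination_by j
decreasing_by all_goals exact k.isLt

/-- `A_{i,j} = ⟨μ^i, φ_j⟩`, the inner product being weighted by `weight α`. -/
def coeffA (α : ℝ) (i j : ℕ) : ℝ :=
  ∫ μ in (-1 : ℝ)..1, μ ^ i * orthPoly α j μ * weight α μ

/-- The expansion coefficients `f_i = (E_i - ∑_{j < i} A_{i,j} f_j) / A_{i,i}`. -/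
def coeffF (α : ℝ) (E : ℕ → ℝ) (i : ℕ) : ℝ :=
  (E i - ∑ j : Fin i, coeffA α i j * coeffF α E j) / coeffA α i i
termination_by i
decreasing_by all_goals exact j.isLt

/-- The parameter `α` for which the weight is the normalized `M₁` ansatz. -/
def alphaM1 (E₀ E₁ : ℝ) : ℝ :=
  -(3 * (E₁ / E₀)) / (2 + Real.sqrt (4 - 3 * (E₁ / E₀) ^ 2))

/-- The ansatz `∑_{i ≤ N} f_i φ_i ω` of the `M₁`-`P_N` model; only `E 0, …, E N` (and, through
`α`, `E 1`) enter. -/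
def ansatz (N : ℕ) (E : ℕ → ℝ) (μ : ℝ) : ℝ :=
  ∑ i ∈ Finset.range (N + 1), coeffF (alphaM1 (E 0) (E 1)) E i *
    (orthPoly (alphaM1 (E 0) (E 1)) i μ * weight (alphaM1 (E 0) (E 1)) μ)

/-- The `M₁`-`P_N` moment closure: the `(N+1)`-st moment of the ansatz. -/
def closure (N : ℕ) (E : ℕ → ℝ) : ℝ := moment (ansatz N E) (N + 1)

/-- The closing moment `E₃ = E₃(E₀, E₁, E₂)` of the `M₁`-`P₂` model. -/
def closureE3 (U : Fin 3 → ℝ) : ℝ :=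
  closure 2 (fun i => if h : i < 3 then U ⟨i, h⟩ else 0)

/-- The flux `F(U) = (E₁, E₂, E₃(U))` of the `M₁`-`P₂` system `c⁻¹ ∂ₜU + ∂_z F(U) = S`,
where `U = (E₀, E₁, E₂)`. -/
def flux (U : Fin 3 → ℝ) : Fin 3 → ℝ := ![U 1, U 2, closureE3 U]

/-- The characteristic field of the speed `lam` (a differentiable eigenvalue of the Jacobian `DF`)
is genuinely nonlinear on `Ω`: the derivative of `lam` at `U` along any eigenvector of `DF(U)` for
`lam U` is non-zero, for every `U ∈ Ω`. -/
def GenuinelyNonlinearOn (F : (Fin 3 → ℝ) → (Fin 3 → ℝ)) (Ω : Set (Fin 3 → ℝ))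
    (lam : (Fin 3 → ℝ) → ℝ) : Prop :=
  ∀ U ∈ Ω, ∀ r : Fin 3 → ℝ,
    Module.End.HasEigenvector (fderiv ℝ F U : (Fin 3 → ℝ) →ₗ[ℝ] (Fin 3 → ℝ)) (lam U) r →
      fderiv ℝ lam U r ≠ 0

/-- The characteristic field of the speed `lam` is linearly degenerate on `Ω`: the derivative of
`lam` at `U` along any eigenvector of `DF(U)` for `lam U` vanishes, for every `U ∈ Ω`. -/
def LinearlyDegenerateOn (F : (Fin 3 → ℝ) → (Fin 3 → ℝ)) (Ω : Set (Fin 3 → ℝ))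
    (lam : (Fin 3 → ℝ) → ℝ) : Prop :=
  ∀ U ∈ Ω, ∀ r : Fin 3 → ℝ,
    Module.End.HasEigenvector (fderiv ℝ F U : (Fin 3 → ℝ) →ₗ[ℝ] (Fin 3 → ℝ)) (lam U) r →
      fderiv ℝ lam U r = 0

end M1P

end

/-!
Write `e = E₁ / E₀`. Since the first moment of the weight is `e`, the expansion coefficient
`f₁` vanishes, and the closure has the form `E₃ = E₀ g(e) + E₂ b(e)` (`closureE3_eq`). The
Jacobian of the flux is therefore a companion matrix: its eigenvectors are the multiples of `(1,
λ, λ ^ 2)`, and its characteristic polynomial, at `λ = e + s` and with `v = E₂ / E₀ - e ^ 2 ∈ (0,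
1 - e ^ 2)`, is the cubic `charS a c b' c' v s = s ^ 3 + a s ^ 2 + (c' - v b') s + c`, where `a =
3 e - b` and `c = e ^ 3 - e ^ 2 b - g`. Differentiating `χ(λ(U), U) = 0` along an eigenvector `r`
gives `χ'(λ) ∇λ · r = (r₀ / E₀) s gnl(s)`, where `gnl` is quadratic in `s` and affine in `v`
(`deriv_charU_mul_fderiv_speed`). Both steps hold on the set `momentDomain`, which contains the
realizable set (`realizableDomain_subset`).

**Outer fields.** Eliminating `v` from `gnl` by means of the characteristic equation leaves a
quartic in `s` whose coefficients depend on `e` alone (`mul_gnl`). For `e > 0` one has `b' > 0`,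
`c < 0`, and `charS` at `v = 0` is positive at some `m < 0`; hence the roots satisfy `s₁ < m < s₂
< 0 < s₃`, and it remains to see that `gnl` is positive at all roots outside `[m, 0]`
(`outerGNL_of`). The closure coefficients are rational functions of `β = -α`, `y = 1 - β ^ 2` and
one transcendental quantity `p`, which is a Möbius function of `ℓ = artanh β / β`. As `p` solves a
Riccati equation, the derivatives in `e` are again rational (`Flow`, `derivs_of_pos`), and the
claim becomes a set of polynomial inequalities.

- For `β ≤ 1003 / 1024`, `p` is expressed by a tail `ω` of the continued fraction of `β / artanh
  β`, which removes the cancellation at `β = 0` and confines `ω` to a narrow band between two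
  convergents (`exists_omega`). The inequalities (`Claims`) follow from polynomial enclosures with
  integer coefficients on boxes in `(β, ω)`, which the kernel evaluates (`chainCheck_sound`).
- For `β ≥ 95 / 97`, the variables are `n = y / p` and `g = p ^ 3 / y ^ 2`. Both are decreasing in
  `β`, so that their values at finitely many points confine the curve to a few boxes
  (`near_bounds`, `NearClaims`).

The case `e < 0` follows by reflection and the case `e = 0` is explicit (`outerGNL_closure`).
Since the roots are distinct, they are differentiable functions of `U` by the implicit function
theorem (`differentiableAt_speed`).

**Middle field.** At the moments of `I = 1` the middle root is `s₂ = 0`, so the derivative of `λ₂`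
along the eigenvector vanishes. Were it zero on the whole realizable set, then, for a fixed small
`e ≠ 0`, the middle roots for infinitely many `v` would all be zeros of one nonzero quartic.
-/


/-! ### Certified enclosures of bivariate polynomials

All functions that the certificates run are written with recursors and with `Nat.add`, `Nat.mul` and
the like, so that `decide +kernel` can evaluate them by the kernel arithmetic on numerals. -/

namespace Encl

/-- A signed integer, stored as a difference `p - n` of two natural numbers; the kernel of Lean
computes with natural numbers much faster than with `Int`. -/
structure Z2 where
  /-- the positive part -/
  p : ℕ
  /-- the negative part -/
  n : ℕ

namespace Z2

/-- The real number `p - n`. -/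
def val (z : Z2) : ℝ := (z.p : ℝ) - z.n

/-- The integer `z` as a signed pair. -/
def ofInt (z : ℤ) : Z2 := ⟨z.toNat, (-z).toNat⟩

def zero : Z2 := ⟨0, 0⟩

/-- The sum, computed without cancelling the two parts. -/
noncomputable def add (a b : Z2) : Z2 := ⟨Nat.add a.p b.p, Nat.add a.n b.n⟩

/-- The product, computed without cancelling the two parts. -/
noncomputable def mul (a b : Z2) : Z2 :=
  ⟨Nat.add (Nat.mul a.p b.p) (Nat.mul a.n b.n), Nat.add (Nat.mul a.p b.n) (Nat.mul a.n b.p)⟩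

/-- The absolute value. -/
noncomputable def abs (a : Z2) : ℕ := Nat.add (Nat.sub a.p a.n) (Nat.sub a.n a.p)

/-- The negative part `max 0 (n - p)` of the value. -/
noncomputable def negPart (a : Z2) : ℕ := Nat.sub a.n a.p

@[simp] theorem val_zero : zero.val = 0 := by simp [val, zero]

@[simp] theorem val_add (a b : Z2) : (a.add b).val = a.val + b.val := by
  simp only [val, add, Nat.add_eq]; push_cast; ring

@[simp] theorem val_mul (a b : Z2) : (a.mul b).val = a.val * b.val := by
  simp only [val, mul, Nat.add_eq, Nat.mul_eq]; push_cast; ring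

@[simp] theorem val_ofInt (z : ℤ) : (ofInt z).val = z := by
  have h := Int.toNat_sub_toNat_neg z
  simp only [val, ofInt]
  exact_mod_cast congrArg (fun t : ℤ => (t : ℝ)) h

theorem abs_val (a : Z2) : |a.val| ≤ a.abs := by
  simp only [val, abs, Nat.add_eq, Nat.sub_eq]
  rcases le_total a.p a.n with h | h
  · rw [Nat.sub_eq_zero_of_le h, zero_add, Nat.cast_sub h, abs_sub_comm]
    exact le_of_eq (abs_of_nonneg (by simpa using h))
  · rw [Nat.sub_eq_zero_of_le h, add_zero, Nat.cast_sub h]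
    exact le_of_eq (abs_of_nonneg (by simpa using h))

theorem neg_negPart_le (a : Z2) : -(a.negPart : ℝ) ≤ a.val := by
  simp only [val, negPart, Nat.sub_eq]
  rcases le_total a.p a.n with h | h
  · rw [Nat.cast_sub h]; linarith
  · rw [Nat.sub_eq_zero_of_le h]; simpa using h

end Z2

/-- A polynomial in one variable, by its list of coefficients. -/
abbrev Row := List Z2

/-- The value of the polynomial at `t`. -/
def Row.ev (a : Row) (t : ℝ) : ℝ := a.foldr (fun z r => z.val + t * r) 0

@[simp] theorem Row.ev_nil (t : ℝ) : Row.ev [] t = 0 := rfl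
@[simp] theorem Row.ev_cons (z : Z2) (a : Row) (t : ℝ) :
    Row.ev (z :: a) t = z.val + t * Row.ev a t := rfl

/-- The sum of two polynomials. -/
noncomputable def Row.add (a : Row) : Row → Row :=
  List.rec (motive := fun _ => Row → Row) (fun b => b)
    (fun x xs ih b => List.rec (motive := fun _ => Row) (x :: xs)
      (fun y ys _ => Z2.add x y :: ih ys) b) a

/-- The multiple of a polynomial by a constant. -/
noncomputable def Row.smul (c : Z2) (a : Row) : Row :=
  List.rec (motive := fun _ => Row) [] (fun x _ ih => Z2.mul c x :: ih) a

/-- The product of two polynomials. -/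
noncomputable def Row.mul (a b : Row) : Row :=
  List.rec (motive := fun _ => Row) [] (fun x _ ih => Row.add (Row.smul x b) (Z2.zero :: ih)) a

/-- The sum of the absolute values of the coefficients. -/
noncomputable def Row.norm (a : Row) : ℕ :=
  List.rec (motive := fun _ => ℕ) 0 (fun x _ ih => Nat.add (Z2.abs x) ih) a

/-- The sum of the negative parts of the coefficients. -/
noncomputable def Row.negPart (a : Row) : ℕ :=
  List.rec (motive := fun _ => ℕ) 0 (fun x _ ih => Nat.add (Z2.negPart x) ih) a

/-- The first `k` coefficients. -/
noncomputable def Row.head (k : ℕ) : Row → Row :=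
  Nat.rec (motive := fun _ => Row → Row) (fun _ => [])
    (fun _ ih a => List.rec (motive := fun _ => Row) [] (fun x xs _ => x :: ih xs) a) k

/-- The sum of the absolute values of all but the first `k` coefficients. -/
noncomputable def Row.tail (k : ℕ) : Row → ℕ :=
  Nat.rec (motive := fun _ => Row → ℕ) Row.norm
    (fun _ ih a => List.rec (motive := fun _ => ℕ) 0 (fun _ xs _ => ih xs) a) k

@[simp] theorem Row.ev_add (a b : Row) (t : ℝ) : (Row.add a b).ev t = a.ev t + b.ev t := by
  induction a generalizing b with
  | nil => simp [Row.add]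
  | cons x xs ih =>
    cases b with
    | nil => simp [Row.add]
    | cons y ys =>
      change Row.ev (Z2.add x y :: Row.add xs ys) t = _
      simp only [Row.ev_cons, Z2.val_add, ih]; ring

@[simp] theorem Row.ev_smul (c : Z2) (a : Row) (t : ℝ) :
    (Row.smul c a).ev t = c.val * a.ev t := by
  induction a with
  | nil => simp [Row.smul]
  | cons x xs ih =>
    change Row.ev (Z2.mul c x :: Row.smul c xs) t = _
    simp only [Row.ev_cons, Z2.val_mul, ih]; ring

@[simp] theorem Row.ev_mul (a b : Row) (t : ℝ) : (Row.mul a b).ev t = a.ev t * b.ev t := by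
  induction a with
  | nil => simp [Row.mul]
  | cons x xs ih =>
    change Row.ev (Row.add (Row.smul x b) (Z2.zero :: Row.mul xs b)) t = _
    simp only [Row.ev_add, Row.ev_smul, Row.ev_cons, Z2.val_zero, ih]; ring

theorem Row.abs_ev_le (a : Row) {t : ℝ} (h0 : 0 ≤ t) (h1 : t ≤ 1) : |a.ev t| ≤ a.norm := by
  induction a with
  | nil => simp [Row.norm]
  | cons x xs ih =>
    change |x.val + t * Row.ev xs t| ≤ ((Nat.add x.abs (Row.norm xs) : ℕ) : ℝ)
    have h2 : |t * Row.ev xs t| ≤ Row.norm xs := by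
      rw [abs_mul, abs_of_nonneg h0]
      exact (mul_le_of_le_one_left (abs_nonneg _) h1).trans ih
    rw [Nat.add_eq, Nat.cast_add]
    exact (abs_add_le _ _).trans (add_le_add x.abs_val h2)

theorem Row.neg_negPart_le (a : Row) {t : ℝ} (h0 : 0 ≤ t) (h1 : t ≤ 1) :
    -(a.negPart : ℝ) ≤ a.ev t := by
  induction a with
  | nil => simp [Row.negPart]
  | cons x xs ih =>
    change -((Nat.add x.negPart (Row.negPart xs) : ℕ) : ℝ) ≤ x.val + t * Row.ev xs t
    have h2 : -(Row.negPart xs : ℝ) ≤ t * Row.ev xs t := by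
      have : (0 : ℝ) ≤ Row.negPart xs := Nat.cast_nonneg _
      nlinarith
    rw [Nat.add_eq, Nat.cast_add]
    have := x.neg_negPart_le
    linarith

theorem Row.abs_ev_sub_head_le (k : ℕ) (a : Row) {t : ℝ} (h0 : 0 ≤ t) (h1 : t ≤ 1) :
    |a.ev t - (Row.head k a).ev t| ≤ Row.tail k a := by
  induction k generalizing a with
  | zero =>
    change |a.ev t - Row.ev [] t| ≤ (Row.norm a : ℝ)
    simpa using a.abs_ev_le h0 h1
  | succ k ih =>
    cases a with
    | nil => change |Row.ev [] t - Row.ev [] t| ≤ ((0 : ℕ) : ℝ); simp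
    | cons x xs =>
      change |Row.ev (x :: xs) t - Row.ev (x :: Row.head k xs) t| ≤ (Row.tail k xs : ℝ)
      have : Row.ev (x :: xs) t - Row.ev (x :: Row.head k xs) t
          = t * (Row.ev xs t - (Row.head k xs).ev t) := by simp only [Row.ev_cons]; ring
      rw [this, abs_mul, abs_of_nonneg h0]
      exact (mul_le_of_le_one_left (abs_nonneg _) h1).trans (ih xs)

/-- A polynomial in two variables `τ` and `t`: the list, over the powers of `τ`, of its
coefficients, which are polynomials in `t`. -/
abbrev Grid := List Row

/-- The value of the polynomial at `(t, τ)`. -/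
def Grid.ev (a : Grid) (t τ : ℝ) : ℝ := a.foldr (fun z r => z.ev t + τ * r) 0

@[simp] theorem Grid.ev_nil (t τ : ℝ) : Grid.ev [] t τ = 0 := rfl
@[simp] theorem Grid.ev_cons (z : Row) (a : Grid) (t τ : ℝ) :
    Grid.ev (z :: a) t τ = z.ev t + τ * Grid.ev a t τ := rfl

/-- The sum of two polynomials. -/
noncomputable def Grid.add (a : Grid) : Grid → Grid :=
  List.rec (motive := fun _ => Grid → Grid) (fun b => b)
    (fun x xs ih b => List.rec (motive := fun _ => Grid) (x :: xs)
      (fun y ys _ => Row.add x y :: ih ys) b) a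

/-- The product with a polynomial in `t` alone. -/
noncomputable def Grid.rmul (c : Row) (a : Grid) : Grid :=
  List.rec (motive := fun _ => Grid) [] (fun x _ ih => Row.mul c x :: ih) a

/-- The multiple of a polynomial by a constant. -/
noncomputable def Grid.smul (c : Z2) (a : Grid) : Grid :=
  List.rec (motive := fun _ => Grid) [] (fun x _ ih => Row.smul c x :: ih) a

/-- The product of two polynomials. -/
noncomputable def Grid.mul (a b : Grid) : Grid :=
  List.rec (motive := fun _ => Grid) [] (fun x _ ih => Grid.add (Grid.rmul x b) ([] :: ih)) a

/-- The sum of the absolute values of the coefficients. -/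
noncomputable def Grid.norm (a : Grid) : ℕ :=
  List.rec (motive := fun _ => ℕ) 0 (fun x _ ih => Nat.add (Row.norm x) ih) a

/-- The sum of the negative parts of the coefficients. -/
noncomputable def Grid.negPart (a : Grid) : ℕ :=
  List.rec (motive := fun _ => ℕ) 0 (fun x _ ih => Nat.add (Row.negPart x) ih) a

/-- The coefficients of `t^i τ^j` with `i < k`, `j < l`. -/
noncomputable def Grid.head (k l : ℕ) : Grid → Grid :=
  Nat.rec (motive := fun _ => Grid → Grid) (fun _ => [])
    (fun _ ih a => List.rec (motive := fun _ => Grid) [] (fun x xs _ => Row.head k x :: ih xs) a) l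

/-- The sum of the absolute values of the coefficients that `Grid.head k l` omits. -/
noncomputable def Grid.tail (k l : ℕ) : Grid → ℕ :=
  Nat.rec (motive := fun _ => Grid → ℕ) Grid.norm
    (fun _ ih a => List.rec (motive := fun _ => ℕ) 0
      (fun x xs _ => Nat.add (Row.tail k x) (ih xs)) a) l

@[simp] theorem Grid.ev_add (a b : Grid) (t τ : ℝ) :
    (Grid.add a b).ev t τ = a.ev t τ + b.ev t τ := by
  induction a generalizing b with
  | nil => simp [Grid.add]
  | cons x xs ih =>
    cases b with
    | nil => simp [Grid.add]
    | cons y ys =>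
      change Grid.ev (Row.add x y :: Grid.add xs ys) t τ = _
      simp only [Grid.ev_cons, Row.ev_add, ih]; ring

@[simp] theorem Grid.ev_rmul (c : Row) (a : Grid) (t τ : ℝ) :
    (Grid.rmul c a).ev t τ = c.ev t * a.ev t τ := by
  induction a with
  | nil => simp [Grid.rmul]
  | cons x xs ih =>
    change Grid.ev (Row.mul c x :: Grid.rmul c xs) t τ = _
    simp only [Grid.ev_cons, Row.ev_mul, ih]; ring

@[simp] theorem Grid.ev_smul (c : Z2) (a : Grid) (t τ : ℝ) :
    (Grid.smul c a).ev t τ = c.val * a.ev t τ := by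
  induction a with
  | nil => simp [Grid.smul]
  | cons x xs ih =>
    change Grid.ev (Row.smul c x :: Grid.smul c xs) t τ = _
    simp only [Grid.ev_cons, Row.ev_smul, ih]; ring

@[simp] theorem Grid.ev_mul (a b : Grid) (t τ : ℝ) :
    (Grid.mul a b).ev t τ = a.ev t τ * b.ev t τ := by
  induction a with
  | nil => simp [Grid.mul]
  | cons x xs ih =>
    change Grid.ev (Grid.add (Grid.rmul x b) ([] :: Grid.mul xs b)) t τ = _
    simp only [Grid.ev_add, Grid.ev_rmul, Grid.ev_cons, Row.ev_nil, ih]; ring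

theorem Grid.abs_ev_le (a : Grid) {t τ : ℝ} (ht0 : 0 ≤ t) (ht1 : t ≤ 1)
    (hs0 : 0 ≤ τ) (hs1 : τ ≤ 1) : |a.ev t τ| ≤ a.norm := by
  induction a with
  | nil => simp [Grid.norm]
  | cons x xs ih =>
    change |x.ev t + τ * Grid.ev xs t τ| ≤ ((Nat.add (Row.norm x) (Grid.norm xs) : ℕ) : ℝ)
    have h2 : |τ * Grid.ev xs t τ| ≤ Grid.norm xs := by
      rw [abs_mul, abs_of_nonneg hs0]
      exact (mul_le_of_le_one_left (abs_nonneg _) hs1).trans ih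
    rw [Nat.add_eq, Nat.cast_add]
    exact (abs_add_le _ _).trans (add_le_add (x.abs_ev_le ht0 ht1) h2)

theorem Grid.neg_negPart_le (a : Grid) {t τ : ℝ} (ht0 : 0 ≤ t) (ht1 : t ≤ 1)
    (hs0 : 0 ≤ τ) (hs1 : τ ≤ 1) : -(a.negPart : ℝ) ≤ a.ev t τ := by
  induction a with
  | nil => simp [Grid.negPart]
  | cons x xs ih =>
    change -((Nat.add x.negPart (Grid.negPart xs) : ℕ) : ℝ) ≤ x.ev t + τ * Grid.ev xs t τ
    have h2 : -(Grid.negPart xs : ℝ) ≤ τ * Grid.ev xs t τ := by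
      have : (0 : ℝ) ≤ Grid.negPart xs := Nat.cast_nonneg _
      nlinarith
    rw [Nat.add_eq, Nat.cast_add]
    have := x.neg_negPart_le ht0 ht1
    linarith

theorem Grid.abs_ev_sub_head_le (k l : ℕ) (a : Grid) {t τ : ℝ} (ht0 : 0 ≤ t) (ht1 : t ≤ 1)
    (hs0 : 0 ≤ τ) (hs1 : τ ≤ 1) :
    |a.ev t τ - (Grid.head k l a).ev t τ| ≤ Grid.tail k l a := by
  induction l generalizing a with
  | zero =>
    change |a.ev t τ - Grid.ev [] t τ| ≤ (Grid.norm a : ℝ)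
    simpa using a.abs_ev_le ht0 ht1 hs0 hs1
  | succ l ih =>
    cases a with
    | nil => change |Grid.ev [] t τ - Grid.ev [] t τ| ≤ ((0 : ℕ) : ℝ); simp
    | cons x xs =>
      change |Grid.ev (x :: xs) t τ - Grid.ev (Row.head k x :: Grid.head k l xs) t τ|
        ≤ ((Nat.add (Row.tail k x) (Grid.tail k l xs) : ℕ) : ℝ)
      have h3 : Grid.ev (x :: xs) t τ - Grid.ev (Row.head k x :: Grid.head k l xs) t τ
          = (x.ev t - (Row.head k x).ev t) + τ * (Grid.ev xs t τ - (Grid.head k l xs).ev t τ) := by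
        simp only [Grid.ev_cons]; ring
      have h2 : |τ * (Grid.ev xs t τ - (Grid.head k l xs).ev t τ)| ≤ Grid.tail k l xs := by
        rw [abs_mul, abs_of_nonneg hs0]
        exact (mul_le_of_le_one_left (abs_nonneg _) hs1).trans (ih xs)
      rw [h3, Nat.add_eq, Nat.cast_add]
      exact (abs_add_le _ _).trans (add_le_add (Row.abs_ev_sub_head_le k x ht0 ht1) h2)

end Encl

/-! ### Enclosures of polynomial expressions -/

namespace Encl

/-- An enclosure of a real number depending on `t, τ ∈ [0, 1]`: a polynomial `grid`, an error bound
`rad` and a binary exponent `ex`, standing for `2 ^ (-ex) * (grid ± rad)`. -/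
structure TM where
  /-- the polynomial part -/
  grid : Grid
  /-- the bound for the error -/
  rad : ℕ
  /-- the binary exponent of the scale -/
  ex : ℕ

namespace TM

/-- The number `f` lies in the enclosure `T`, at the parameters `t, τ`. -/
def Encloses (t τ : ℝ) (T : TM) (f : ℝ) : Prop := |f * 2 ^ T.ex - T.grid.ev t τ| ≤ T.rad

/-- The exact enclosure of an integer. -/
def const (z : ℤ) : TM := ⟨[[Z2.ofInt z]], 0, 0⟩

/-- The enclosure of `-f`. -/
noncomputable def neg (a : TM) : TM := ⟨Grid.smul ⟨0, 1⟩ a.grid, a.rad, a.ex⟩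

/-- The same enclosure, scaled by `2 ^ d`. -/
noncomputable def scale (d : ℕ) (a : TM) : TM :=
  Bool.rec (motive := fun _ => TM)
    ⟨Grid.smul ⟨Nat.pow 2 d, 0⟩ a.grid, Nat.mul (Nat.pow 2 d) a.rad, Nat.add a.ex d⟩ a
    (Nat.beq d 0)

/-- The sum, after both summands have been brought to the larger of the two exponents. -/
noncomputable def add (a b : TM) : TM :=
  (fun a b : TM => (⟨Grid.add a.grid b.grid, Nat.add a.rad b.rad, a.ex⟩ : TM))
    (scale (Nat.sub b.ex a.ex) a) (scale (Nat.sub a.ex b.ex) b)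

/-- The product, truncated to degree `< 4` in `t` and `< 2` in `τ`. -/
noncomputable def mul (a b : TM) : TM :=
  (fun g : Grid => (⟨Grid.head 4 2 g,
    Nat.add (Grid.tail 4 2 g)
      (Nat.add (Nat.mul a.rad (Nat.add (Grid.norm b.grid) b.rad))
        (Nat.mul b.rad (Grid.norm a.grid))), Nat.add a.ex b.ex⟩ : TM))
    (Grid.mul a.grid b.grid)

theorem encloses_const (t τ : ℝ) (z : ℤ) : Encloses t τ (const z) z := by
  simp [Encloses, const]

theorem Encloses.neg {t τ : ℝ} {a : TM} {f : ℝ} (h : Encloses t τ a f) :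
    Encloses t τ a.neg (-f) := by
  have e : (-f) * 2 ^ a.ex - -(a.grid.ev t τ) = -(f * 2 ^ a.ex - a.grid.ev t τ) := by ring
  have e2 : (Z2.val ⟨0, 1⟩) = -1 := by simp [Z2.val]
  simp only [Encloses, TM.neg, Grid.ev_smul, e2, neg_one_mul]
  rw [e, abs_neg]; exact h

theorem scale_ex (d : ℕ) (a : TM) : (scale d a).ex = a.ex + d := by
  cases d <;> rfl

theorem Encloses.scale {t τ : ℝ} {a : TM} {f : ℝ} (h : Encloses t τ a f) (d : ℕ) :
    Encloses t τ (a.scale d) f := by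
  cases d with
  | zero => exact h
  | succ d =>
    change |f * 2 ^ (a.ex + (d + 1)) - (Grid.smul ⟨2 ^ (d + 1), 0⟩ a.grid).ev t τ|
      ≤ ((2 ^ (d + 1) * a.rad : ℕ) : ℝ)
    have e2 : (Z2.val ⟨2 ^ (d + 1), 0⟩) = 2 ^ (d + 1) := by simp [Z2.val]
    have e : f * 2 ^ (a.ex + (d + 1)) - 2 ^ (d + 1) * a.grid.ev t τ
        = 2 ^ (d + 1) * (f * 2 ^ a.ex - a.grid.ev t τ) := by ring
    rw [Grid.ev_smul, e2, e, abs_mul, abs_of_nonneg (by positivity)]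
    push_cast
    exact mul_le_mul_of_nonneg_left h (by positivity)

theorem Encloses.add {t τ : ℝ} {a b : TM} {f g : ℝ} (ha : Encloses t τ a f)
    (hb : Encloses t τ b g) : Encloses t τ (a.add b) (f + g) := by
  have h1 := ha.scale (b.ex - a.ex)
  have h2 := hb.scale (a.ex - b.ex)
  have he : (TM.scale (a.ex - b.ex) b).ex = (TM.scale (b.ex - a.ex) a).ex := by
    rw [scale_ex, scale_ex]; omega
  change |(f + g) * 2 ^ (TM.scale (b.ex - a.ex) a).ex
    - (Grid.add (TM.scale (b.ex - a.ex) a).grid (TM.scale (a.ex - b.ex) b).grid).ev t τ|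
    ≤ (((TM.scale (b.ex - a.ex) a).rad + (TM.scale (a.ex - b.ex) b).rad : ℕ) : ℝ)
  unfold Encloses at h1 h2
  rw [he] at h2
  rw [Grid.ev_add, Nat.cast_add]
  refine le_trans (le_of_eq ?_) ((abs_add_le _ _).trans (add_le_add h1 h2))
  congr 1; ring

theorem Encloses.mul {t τ : ℝ} (ht0 : 0 ≤ t) (ht1 : t ≤ 1) (hs0 : 0 ≤ τ) (hs1 : τ ≤ 1)
    {a b : TM} {f g : ℝ} (ha : Encloses t τ a f)
    (hb : Encloses t τ b g) : Encloses t τ (a.mul b) (f * g) := by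
  unfold Encloses at ha hb
  set A := a.grid.ev t τ with hA
  set B := b.grid.ev t τ with hB
  have nA := a.grid.abs_ev_le ht0 ht1 hs0 hs1
  have nB := b.grid.abs_ev_le ht0 ht1 hs0 hs1
  have hT := Grid.abs_ev_sub_head_le 4 2 (Grid.mul a.grid b.grid) ht0 ht1 hs0 hs1
  rw [Grid.ev_mul, ← hA, ← hB] at hT
  rw [← hA] at nA
  rw [← hB] at nB
  change |f * g * 2 ^ (a.ex + b.ex) - (Grid.head 4 2 (Grid.mul a.grid b.grid)).ev t τ|
    ≤ ((Grid.tail 4 2 (Grid.mul a.grid b.grid) + (a.rad * (Grid.norm b.grid + b.rad)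
      + b.rad * Grid.norm a.grid) : ℕ) : ℝ)
  set C := (Grid.head 4 2 (Grid.mul a.grid b.grid)).ev t τ
  set u := f * 2 ^ a.ex with hu
  set v := g * 2 ^ b.ex with hv
  have e : f * g * 2 ^ (a.ex + b.ex) - C = (A * B - C) + ((u - A) * v + (v - B) * A) := by
    rw [pow_add, hu, hv]; ring
  have hvb : |v| ≤ Grid.norm b.grid + b.rad := by
    have : v = B + (v - B) := by ring
    rw [this]; exact (abs_add_le _ _).trans (add_le_add nB hb)
  have m1 : |(u - A) * v| ≤ a.rad * (Grid.norm b.grid + b.rad) := by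
    rw [abs_mul]; exact mul_le_mul ha hvb (abs_nonneg _) (Nat.cast_nonneg _)
  have m2 : |(v - B) * A| ≤ b.rad * Grid.norm a.grid := by
    rw [abs_mul]; exact mul_le_mul hb nA (abs_nonneg _) (Nat.cast_nonneg _)
  rw [e]; push_cast
  exact (abs_add_le _ _).trans (add_le_add hT ((abs_add_le _ _).trans (add_le_add m1 m2)))

end TM

/-- Polynomial expressions in two variables. -/
inductive Ex where
  | con (z : ℤ)
  | v0
  | v1
  | add (a b : Ex)
  | mul (a b : Ex)
  | neg (a : Ex)
  /-- the polynomial in `a` and `b` whose coefficients are listed first by the powers of `b`, then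
  by the powers of `a` -/
  | poly (rows : List (List ℤ)) (a b : Ex)

namespace Ex

/-- The value of a polynomial in one variable. -/
def polyEval1 (c : List ℤ) (x : ℝ) : ℝ := c.foldr (fun (z : ℤ) r => (z : ℝ) + x * r) 0

/-- The value of a polynomial in two variables, by its rows of coefficients. -/
def polyEval (c : List (List ℤ)) (x w : ℝ) : ℝ := c.foldr (fun z r => polyEval1 z x + w * r) 0

/-- The value of an expression at `(v0, v1) = (x, w)`. -/
def den (x w : ℝ) : Ex → ℝ
  | con z => z
  | v0 => x
  | v1 => w
  | add a b => den x w a + den x w b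
  | mul a b => den x w a * den x w b
  | neg a => -den x w a
  | poly c a b => polyEval c (den x w a) (den x w b)

/-- The enclosure of a polynomial in one variable, by Horner's scheme. -/
noncomputable def rowTM (A : TM) (c : List ℤ) : TM :=
  List.rec (motive := fun _ => TM) (TM.const 0)
    (fun z _ ih => TM.add (TM.const z) (TM.mul A ih)) c

/-- The enclosure of a polynomial in two variables, by Horner's scheme. -/
noncomputable def polyTM (A B : TM) (c : List (List ℤ)) : TM :=
  List.rec (motive := fun _ => TM) (TM.const 0)
    (fun z _ ih => TM.add (rowTM A z) (TM.mul B ih)) c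

/-- The enclosure of an expression, from enclosures of the two variables. -/
noncomputable def tm (A B : TM) (e : Ex) : TM :=
  Ex.rec (motive := fun _ => TM) (fun z => TM.const z) A B (fun _ _ x y => TM.add x y)
    (fun _ _ x y => TM.mul x y) (fun _ x => TM.neg x) (fun c _ _ x y => polyTM x y c) e

theorem encloses_tm {t τ : ℝ} (ht0 : 0 ≤ t) (ht1 : t ≤ 1) (hs0 : 0 ≤ τ) (hs1 : τ ≤ 1)
    {A B : TM} {x w : ℝ} (hA : A.Encloses t τ x) (hB : B.Encloses t τ w) (e : Ex) :
    (e.tm A B).Encloses t τ (e.den x w) := by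
  have hrow : ∀ {A : TM} {x : ℝ}, A.Encloses t τ x → ∀ c : List ℤ,
      (rowTM A c).Encloses t τ (polyEval1 c x) := by
    intro A x hA c
    induction c with
    | nil => simpa [rowTM, polyEval1] using TM.encloses_const t τ 0
    | cons z c ih => exact (TM.encloses_const t τ z).add (hA.mul ht0 ht1 hs0 hs1 ih)
  induction e with
  | con z => exact TM.encloses_const t τ z
  | v0 => exact hA
  | v1 => exact hB
  | add a b iha ihb => exact iha.add ihb
  | mul a b iha ihb => exact iha.mul ht0 ht1 hs0 hs1 ihb
  | neg a iha => exact iha.neg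
  | poly c a b iha ihb =>
    change (polyTM (a.tm A B) (b.tm A B) c).Encloses t τ (polyEval c (a.den x w) (b.den x w))
    induction c with
    | nil => simpa [polyTM, polyEval] using TM.encloses_const t τ 0
    | cons z c ih => exact (hrow iha z).add (ihb.mul ht0 ht1 hs0 hs1 ih)

end Ex

/-! ### Positivity of polynomials with enclosed coefficients -/

namespace TM

/-- A lower bound, affine in `t` and `τ`, for the enclosed number, taken at the corner `(i, j)` of
the unit square. -/
noncomputable def corner (i j : Bool) (T : TM) : Z2 :=
  List.rec (motive := fun _ => Z2) ⟨0, T.rad⟩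
    (fun row0 rows _ => List.rec (motive := fun _ => Z2) ⟨0, Nat.add T.rad (Grid.negPart rows)⟩
      (fun c00 row0' _ => List.rec (motive := fun _ => Z2)
        (Z2.add c00 ⟨0, Nat.add T.rad (Grid.negPart rows)⟩)
        (fun c10 rest0 _ => List.rec (motive := fun _ => Z2)
          (Z2.add c00 (Z2.add (Bool.rec (motive := fun _ => Z2) Z2.zero c10 i)
            ⟨0, Nat.add T.rad (Row.negPart rest0)⟩))
          (fun row1 rows2 _ => List.rec (motive := fun _ => Z2)
            (Z2.add c00 (Z2.add (Bool.rec (motive := fun _ => Z2) Z2.zero c10 i)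
              ⟨0, Nat.add T.rad (Nat.add (Row.negPart rest0) (Grid.negPart rows2))⟩))
            (fun c01 rest1 _ =>
              Z2.add c00 (Z2.add (Bool.rec (motive := fun _ => Z2) Z2.zero c10 i)
                (Z2.add (Bool.rec (motive := fun _ => Z2) Z2.zero c01 j)
                  ⟨0, Nat.add T.rad (Nat.add (Row.negPart rest0)
                    (Nat.add (Row.negPart rest1) (Grid.negPart rows2)))⟩)))
            row1)
          rows)
        row0')
      row0)
    T.grid

/-- An affine lower bound of an enclosed number, whose values at the four corners of the square
are those of `corner`. -/
theorem exists_corner_bound {t τ : ℝ} (ht0 : 0 ≤ t) (ht1 : t ≤ 1) (hs0 : 0 ≤ τ) (hs1 : τ ≤ 1)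
    (T : TM) : ∃ a b c : ℝ, (∀ i j : Bool, (T.corner i j).val = a + cond i b 0 + cond j c 0) ∧
      ∀ f, T.Encloses t τ f → a + b * t + c * τ ≤ f * 2 ^ T.ex := by
  obtain ⟨g, r, e⟩ := T
  have key : ∀ f : ℝ, TM.Encloses t τ ⟨g, r, e⟩ f → Grid.ev g t τ - r ≤ f * 2 ^ e := by
    intro f hf
    have := (abs_le.1 hf).1
    simp only at this
    linarith
  have hg := fun a : Grid => a.neg_negPart_le ht0 ht1 hs0 hs1
  have hr := fun a : Row => a.neg_negPart_le ht0 ht1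
  have hm : ∀ (n : ℕ) (z : ℝ), -(n : ℝ) ≤ z → -(n : ℝ) ≤ τ * z := by
    intro n z hz
    have : (0 : ℝ) ≤ n := Nat.cast_nonneg _
    nlinarith
  have hmt : ∀ (n : ℕ) (z : ℝ), -(n : ℝ) ≤ z → -(n : ℝ) ≤ t * z := by
    intro n z hz
    have : (0 : ℝ) ≤ n := Nat.cast_nonneg _
    nlinarith
  have hv : ∀ n : ℕ, Z2.val ⟨0, n⟩ = -(n : ℝ) := by intro n; simp [Z2.val]
  rcases g with _ | ⟨_ | ⟨c00, _ | ⟨c10, rest0⟩⟩, rows⟩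
  · refine ⟨-(r : ℝ), 0, 0, fun i j => ?_, fun f hf => ?_⟩
    · change Z2.val ⟨0, r⟩ = _
      cases i <;> cases j <;> simp [hv]
    · have := key f hf
      simp only [Grid.ev_nil] at this
      linarith
  · refine ⟨-((r + Grid.negPart rows : ℕ) : ℝ), 0, 0, fun i j => ?_, fun f hf => ?_⟩
    · change Z2.val ⟨0, r + Grid.negPart rows⟩ = _
      cases i <;> cases j <;> simp [hv]
    · have h1 := key f hf
      have h2 := hm _ _ (hg rows)
      simp only [Grid.ev_cons, Row.ev_nil] at h1
      push_cast
      linarith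
  · refine ⟨c00.val - ((r + Grid.negPart rows : ℕ) : ℝ), 0, 0, fun i j => ?_, fun f hf => ?_⟩
    · change Z2.val (Z2.add c00 ⟨0, r + Grid.negPart rows⟩) = _
      cases i <;> cases j <;> simp [hv] <;> ring
    · have h1 := key f hf
      have h2 := hm _ _ (hg rows)
      simp only [Grid.ev_cons, Row.ev_cons, Row.ev_nil] at h1
      push_cast
      linarith
  · rcases rows with _ | ⟨_ | ⟨c01, rest1⟩, rows2⟩
    · refine ⟨c00.val - ((r + Row.negPart rest0 : ℕ) : ℝ), c10.val, 0, fun i j => ?_,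
        fun f hf => ?_⟩
      · change Z2.val (Z2.add c00 (Z2.add (Bool.rec (motive := fun _ => Z2) Z2.zero c10 i)
            ⟨0, r + Row.negPart rest0⟩)) = _
        cases i <;> cases j <;> simp [hv] <;> ring
      · have h1 := key f hf
        have h2 := hmt _ _ (hmt _ _ (hr rest0))
        simp only [Grid.ev_cons, Row.ev_cons, Grid.ev_nil] at h1
        push_cast
        linarith
    · refine ⟨c00.val - ((r + (Row.negPart rest0 + Grid.negPart rows2) : ℕ) : ℝ), c10.val, 0,
        fun i j => ?_, fun f hf => ?_⟩
      · change Z2.val (Z2.add c00 (Z2.add (Bool.rec (motive := fun _ => Z2) Z2.zero c10 i)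
            ⟨0, r + (Row.negPart rest0 + Grid.negPart rows2)⟩)) = _
        cases i <;> cases j <;> simp [hv] <;> ring
      · have h1 := key f hf
        have h2 := hmt _ _ (hmt _ _ (hr rest0))
        have h3 := hm _ _ (hm _ _ (hg rows2))
        simp only [Grid.ev_cons, Row.ev_cons, Row.ev_nil] at h1
        push_cast
        linarith
    · refine ⟨c00.val - ((r + (Row.negPart rest0 + (Row.negPart rest1 + Grid.negPart rows2)) : ℕ)
        : ℝ), c10.val, c01.val, fun i j => ?_, fun f hf => ?_⟩
      · change Z2.val (Z2.add c00 (Z2.add (Bool.rec (motive := fun _ => Z2) Z2.zero c10 i)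
            (Z2.add (Bool.rec (motive := fun _ => Z2) Z2.zero c01 j)
              ⟨0, r + (Row.negPart rest0 + (Row.negPart rest1 + Grid.negPart rows2))⟩))) = _
        cases i <;> cases j <;> simp [hv] <;> ring
      · have h1 := key f hf
        have h2 := hmt _ _ (hmt _ _ (hr rest0))
        have h3 := hm _ _ (hm _ _ (hg rows2))
        have h4 := hm _ _ (hmt _ _ (hr rest1))
        simp only [Grid.ev_cons, Row.ev_cons] at h1
        push_cast
        linarith

end TM
end Encl

/-! ### Positivity checks on intervals -/

namespace Encl

/-- The value at `s` of the polynomial with the given real coefficients. -/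
def horner (f : List ℝ) (s : ℝ) : ℝ := f.foldr (fun z r => z + s * r) 0

@[simp] theorem horner_nil (s : ℝ) : horner [] s = 0 := rfl
@[simp] theorem horner_cons (z : ℝ) (f : List ℝ) (s : ℝ) :
    horner (z :: f) s = z + s * horner f s := rfl

/-- The largest exponent in a list of enclosures. -/
noncomputable def maxEx (l : List TM) : ℕ :=
  List.rec (motive := fun _ => ℕ) 0 (fun T _ ih => Nat.add ih (Nat.sub T.ex ih)) l

/-- The corner bounds of the coefficients, at the common scale `2 ^ E`. -/
noncomputable def cornerRow (E : ℕ) (i j : Bool) (l : List TM) : Row :=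
  List.rec (motive := fun _ => Row) []
    (fun T _ ih => TM.corner i j (TM.scale (Nat.sub E T.ex) T) :: ih) l

/-- The coefficients of `2 ^ (k * length) * q ((m + l σ) / 2 ^ k)` as a polynomial in `σ`, and the
factor `2 ^ (k * length)`. -/
noncomputable def shiftRow (m l k : ℕ) (q : Row) : Row × ℕ :=
  List.rec (motive := fun _ => Row × ℕ) ([], 1)
    (fun x _ ih => (fun S => (Row.add [Z2.mul x ⟨S, 0⟩] (Row.mul [⟨m, 0⟩, ⟨l, 0⟩] ih.1), S))
      (Nat.mul ih.2 (Nat.pow 2 k))) q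

/-- A test for positivity on the unit interval: the constant term exceeds the sum of the negative
parts of the others. -/
noncomputable def unitPos (q : Row) : Bool :=
  List.rec (motive := fun _ => Bool) false
    (fun c r _ => Nat.blt (Nat.add c.n (Row.negPart r)) c.p) q

/-- A test for positivity on `[0, ∞)`: positive constant term, the others nonnegative. -/
noncomputable def rayPos (q : Row) : Bool :=
  List.rec (motive := fun _ => Bool) false
    (fun c r _ => Bool.and (Nat.blt c.n c.p) (Nat.beq (Row.negPart r) 0)) q

/-- A test `P` at the four corners. -/
noncomputable def allCorners (P : Row → Bool) (l : List TM) : Bool :=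
  (fun E => Bool.and (Bool.and (P (cornerRow E false false l)) (P (cornerRow E false true l)))
    (Bool.and (P (cornerRow E true false l)) (P (cornerRow E true true l)))) (maxEx l)

/-- Positivity of the polynomial on the interval `[m / 2 ^ k, (m + l) / 2 ^ k]`. -/
noncomputable def intervalCheck (k m l : ℕ) (T : List TM) : Bool :=
  allCorners (fun q => unitPos (shiftRow m l k q).1) T

/-- Positivity of the polynomial on the ray `[m / 2 ^ k, ∞)`. -/
noncomputable def rayCheck (k m : ℕ) (T : List TM) : Bool :=
  allCorners (fun q => rayPos (shiftRow m 1 k q).1) T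

/-- The entry of index `n`, or the empty list. -/
noncomputable def pick {α : Type} (n : ℕ) : List (List α) → List α :=
  Nat.rec (motive := fun _ => List (List α) → List α)
    (fun l => List.rec (motive := fun _ => List α) [] (fun x _ _ => x) l)
    (fun _ ih l => List.rec (motive := fun _ => List α) [] (fun _ xs _ => ih xs) l) n

/-- Positivity of one of several polynomials at each point of an interval, which begins at
`m / 2 ^ k` and is cut into pieces; each entry of `cert` names a polynomial and the length of the
piece on which that polynomial is positive. -/
noncomputable def coverCheck (k : ℕ) (T : List (List TM)) (cert : List (ℕ × ℕ)) : ℕ → Bool :=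
  List.rec (motive := fun _ => ℕ → Bool) (fun _ => true)
    (fun c _ ih m => Bool.and (intervalCheck k m c.2 (pick c.1 T)) (ih (Nat.add m c.2))) cert

theorem shiftRow_ev (m l k : ℕ) (q : Row) (σ : ℝ) :
    (shiftRow m l k q).1.ev σ = (shiftRow m l k q).2 * q.ev ((m + l * σ) / 2 ^ k) ∧
      0 < (shiftRow m l k q).2 := by
  induction q with
  | nil => simp [shiftRow]
  | cons x q ih =>
    obtain ⟨h1, h2⟩ := ih
    set R := shiftRow m l k q with hR
    change (Row.add [Z2.mul x ⟨R.2 * 2 ^ k, 0⟩] (Row.mul [⟨m, 0⟩, ⟨l, 0⟩] R.1)).ev σ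
      = ((R.2 * 2 ^ k : ℕ) : ℝ) * Row.ev (x :: q) ((m + l * σ) / 2 ^ k) ∧ 0 < R.2 * 2 ^ k
    refine ⟨?_, by positivity⟩
    have h3 : Z2.val ⟨R.2 * 2 ^ k, 0⟩ = (R.2 : ℝ) * 2 ^ k := by simp [Z2.val]
    have h4 : ∀ n : ℕ, Z2.val ⟨n, 0⟩ = (n : ℝ) := by simp [Z2.val]
    simp only [Row.ev_add, Row.ev_cons, Row.ev_nil, Row.ev_mul, Z2.val_mul, h3, h4, h1]
    push_cast
    field_simp
    ring

theorem unitPos_sound {q : Row} (h : unitPos q = true) {σ : ℝ} (h0 : 0 ≤ σ) (h1 : σ ≤ 1) :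
    0 < q.ev σ := by
  cases q with
  | nil => exact absurd h (by simp [unitPos])
  | cons c r =>
    change Nat.blt (c.n + Row.negPart r) c.p = true at h
    have h := Nat.le_of_ble_eq_true h
    have h' : ((c.n + Row.negPart r : ℕ) : ℝ) < c.p := by exact_mod_cast h
    have h2 := Row.neg_negPart_le r h0 h1
    have h3 : (0 : ℝ) ≤ Row.negPart r := Nat.cast_nonneg _
    push_cast at h'
    simp only [Row.ev_cons, Z2.val]
    nlinarith

theorem rayPos_sound {q : Row} (h : rayPos q = true) {σ : ℝ} (h0 : 0 ≤ σ) : 0 < q.ev σ := by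
  cases q with
  | nil => exact absurd h (by simp [rayPos])
  | cons c r =>
    change (Nat.blt c.n c.p && Nat.beq (Row.negPart r) 0) = true at h
    rw [Bool.and_eq_true] at h
    have h1 : (c.n : ℝ) < c.p := by exact_mod_cast Nat.le_of_ble_eq_true h.1
    have h2 : Row.negPart r = 0 := Nat.eq_of_beq_eq_true h.2
    have h3 : 0 ≤ Row.ev r σ := by
      clear h h1
      induction r with
      | nil => simp
      | cons x xs ih =>
        change x.negPart + Row.negPart xs = 0 at h2
        have h4 : x.negPart = 0 := by omega
        have h5 : Row.negPart xs = 0 := by omega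
        have h6 := x.neg_negPart_le
        rw [h4] at h6
        have := ih h5
        simp only [Row.ev_cons]
        have : 0 ≤ σ * Row.ev xs σ := by positivity
        simp at h6
        linarith
    simp only [Row.ev_cons, Z2.val]
    have : 0 ≤ σ * Row.ev r σ := by positivity
    linarith

theorem affine_pos {a b t : ℝ} (h0 : 0 < a) (h1 : 0 < a + b) (ht0 : 0 ≤ t) (ht1 : t ≤ 1) :
    0 < a + b * t := by
  rcases ht0.eq_or_lt with rfl | h
  · simpa using h0
  · nlinarith [mul_pos h1 h, mul_nonneg h0.le (sub_nonneg.2 ht1)]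

theorem le_maxEx {l : List TM} {T : TM} (h : T ∈ l) : T.ex ≤ maxEx l := by
  induction l with
  | nil => simp at h
  | cons S l ih =>
    change T.ex ≤ maxEx l + (S.ex - maxEx l)
    rcases List.mem_cons.1 h with rfl | h
    · omega
    · have := ih h; omega

section
variable {t τ : ℝ}

theorem exists_cornerRow_bound (ht0 : 0 ≤ t) (ht1 : t ≤ 1) (hs0 : 0 ≤ τ) (hs1 : τ ≤ 1)
    {l : List TM} {f : List ℝ} (h : List.Forall₂ (TM.Encloses t τ) l f) {E : ℕ}
    (hE : ∀ T ∈ l, T.ex ≤ E) {s : ℝ} (hs : 0 ≤ s) :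
    ∃ a b c : ℝ, (∀ i j, (cornerRow E i j l).ev s = a + cond i b 0 + cond j c 0) ∧
      a + b * t + c * τ ≤ horner f s * 2 ^ E := by
  induction h with
  | nil => exact ⟨0, 0, 0, fun i j => by cases i <;> cases j <;> simp [cornerRow], by simp⟩
  | @cons T z l f h1 _ ih =>
    obtain ⟨a, b, c, h3, h4⟩ := ih fun T hT => hE T (List.mem_cons_of_mem _ hT)
    obtain ⟨a', b', c', h5, h6⟩ := TM.exists_corner_bound ht0 ht1 hs0 hs1 (TM.scale (E - T.ex) T)
    have h7 := h6 z (h1.scale _)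
    rw [TM.scale_ex, Nat.add_sub_cancel' (hE T List.mem_cons_self)] at h7
    refine ⟨a' + s * a, b' + s * b, c' + s * c, fun i j => ?_, ?_⟩
    · change Row.ev (TM.corner i j (TM.scale (E - T.ex) T) :: cornerRow E i j l) s = _
      rw [Row.ev_cons, h5, h3]
      cases i <;> cases j <;> simp <;> ring
    · have := mul_le_mul_of_nonneg_left h4 hs
      rw [horner_cons]
      linarith

theorem allCorners_sound (ht0 : 0 ≤ t) (ht1 : t ≤ 1) (hs0 : 0 ≤ τ) (hs1 : τ ≤ 1)
    {l : List TM} {f : List ℝ} (h : List.Forall₂ (TM.Encloses t τ) l f) {P : Row → Bool} {s : ℝ}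
    (hs : 0 ≤ s) (hP : ∀ q, P q = true → 0 < Row.ev q s) (hc : allCorners P l = true) :
    0 < horner f s := by
  obtain ⟨a, b, c, h1, h2⟩ := exists_cornerRow_bound ht0 ht1 hs0 hs1 h
    (fun T hT => le_maxEx hT) hs
  change (P _ && P _ && (P _ && P _)) = true at hc
  simp only [Bool.and_eq_true] at hc
  obtain ⟨⟨c1, c2⟩, c3, c4⟩ := hc
  have k1 := hP _ c1; have k2 := hP _ c2; have k3 := hP _ c3; have k4 := hP _ c4
  rw [h1] at k1 k2 k3 k4
  simp only [cond_true, cond_false, add_zero] at k1 k2 k3 k4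
  -- an affine function positive at the corners of a square is positive on the square
  have k5 := affine_pos k1 k3 ht0 ht1
  have k6 : 0 < a + b * t + c := by linarith [affine_pos (b := b) k2 (by linarith) ht0 ht1]
  have k7 := affine_pos k5 k6 hs0 hs1
  have : (0 : ℝ) < 2 ^ maxEx l := by positivity
  by_contra hn
  push Not at hn
  nlinarith

theorem intervalCheck_sound (ht0 : 0 ≤ t) (ht1 : t ≤ 1) (hs0 : 0 ≤ τ) (hs1 : τ ≤ 1)
    {T : List TM} {f : List ℝ} (h : List.Forall₂ (TM.Encloses t τ) T f) {k m l : ℕ}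
    (hc : intervalCheck k m l T = true) {s : ℝ} (h1 : (m : ℝ) ≤ 2 ^ k * s)
    (h2 : 2 ^ k * s ≤ m + l) : 0 < horner f s := by
  have hk : (0 : ℝ) < 2 ^ k := by positivity
  have hs : 0 ≤ s := by
    have : (0 : ℝ) ≤ 2 ^ k * s := le_trans (Nat.cast_nonneg _) h1
    exact nonneg_of_mul_nonneg_right this hk
  refine allCorners_sound ht0 ht1 hs0 hs1 h hs (fun q hq => ?_) hc
  have hσ : ∃ σ : ℝ, 0 ≤ σ ∧ σ ≤ 1 ∧ s = (m + l * σ) / 2 ^ k := by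
    rcases Nat.eq_zero_or_pos l with rfl | hl
    · refine ⟨0, le_rfl, zero_le_one, ?_⟩
      rw [eq_div_iff hk.ne']; simp at h2 ⊢; linarith
    · have hl' : (0 : ℝ) < l := by exact_mod_cast hl
      refine ⟨(2 ^ k * s - m) / l, div_nonneg (by linarith) hl'.le, ?_, ?_⟩
      · rw [div_le_one hl']; linarith
      · field_simp; ring
  obtain ⟨σ, h3, h4, h5⟩ := hσ
  have h6 := unitPos_sound hq h3 h4
  obtain ⟨h7, h8⟩ := shiftRow_ev m l k q σ
  rw [h7, ← h5] at h6
  exact pos_of_mul_pos_right h6 (Nat.cast_nonneg _)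

theorem rayCheck_sound (ht0 : 0 ≤ t) (ht1 : t ≤ 1) (hs0 : 0 ≤ τ) (hs1 : τ ≤ 1)
    {T : List TM} {f : List ℝ} (h : List.Forall₂ (TM.Encloses t τ) T f) {k m : ℕ}
    (hc : rayCheck k m T = true) {s : ℝ} (h1 : (m : ℝ) ≤ 2 ^ k * s) : 0 < horner f s := by
  have hk : (0 : ℝ) < 2 ^ k := by positivity
  have hs : 0 ≤ s := by
    have : (0 : ℝ) ≤ 2 ^ k * s := le_trans (Nat.cast_nonneg _) h1
    exact nonneg_of_mul_nonneg_right this hk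
  refine allCorners_sound ht0 ht1 hs0 hs1 h hs (fun q hq => ?_) hc
  have h5 : s = (m + (1 : ℕ) * (2 ^ k * s - m)) / 2 ^ k := by field_simp; push_cast; ring
  have h6 := rayPos_sound hq (σ := 2 ^ k * s - m) (by linarith)
  obtain ⟨h7, h8⟩ := shiftRow_ev m 1 k q (2 ^ k * s - m)
  rw [h7, ← h5] at h6
  exact pos_of_mul_pos_right h6 (Nat.cast_nonneg _)

theorem forall₂_pick {α : Type} {R : α → ℝ → Prop} {T : List (List α)} {f : List (List ℝ)}
    (h : List.Forall₂ (List.Forall₂ R) T f) (n : ℕ) :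
    List.Forall₂ R (pick n T) (pick n f) ∧ (pick n f ∈ f ∨ pick n f = []) := by
  induction n generalizing T f with
  | zero =>
    cases h with
    | nil => exact ⟨List.Forall₂.nil, Or.inr rfl⟩
    | cons h1 h2 => exact ⟨h1, Or.inl List.mem_cons_self⟩
  | succ n ih =>
    cases h with
    | nil => exact ⟨List.Forall₂.nil, Or.inr rfl⟩
    | cons h1 h2 =>
      obtain ⟨h3, h4⟩ := ih h2
      exact ⟨h3, h4.imp (List.mem_cons_of_mem _) id⟩

theorem coverCheck_sound (ht0 : 0 ≤ t) (ht1 : t ≤ 1) (hs0 : 0 ≤ τ) (hs1 : τ ≤ 1)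
    {T : List (List TM)} {f : List (List ℝ)}
    (h : List.Forall₂ (List.Forall₂ (TM.Encloses t τ)) T f) {k : ℕ} {cert : List (ℕ × ℕ)} {m : ℕ}
    (hc : coverCheck k T cert m = true) (hne : cert ≠ []) {s : ℝ} (h1 : (m : ℝ) ≤ 2 ^ k * s)
    (h2 : 2 ^ k * s ≤ (m + (cert.map Prod.snd).sum : ℕ)) : ∃ g ∈ f, 0 < horner g s := by
  induction cert generalizing m with
  | nil => exact absurd rfl hne
  | cons c cert ih =>
    change (intervalCheck k m c.2 (pick c.1 T) && coverCheck k T cert (m + c.2)) = true at hc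
    rw [Bool.and_eq_true] at hc
    by_cases h3 : 2 ^ k * s ≤ m + c.2
    · obtain ⟨h4, h5⟩ := forall₂_pick h c.1
      have h6 := intervalCheck_sound ht0 ht1 hs0 hs1 h4 hc.1 h1 h3
      rcases h5 with h5 | h5
      · exact ⟨_, h5, h6⟩
      · rw [h5] at h6; simp at h6
    · push Not at h3
      have hne' : cert ≠ [] := by
        rintro rfl
        simp at h2
        linarith
      refine ih hc.2 hne' (by push_cast; exact h3.le) ?_
      simp only [List.map_cons, List.sum_cons] at h2
      rw [add_assoc]; exact h2

end

end Encl

/-! ### Coefficient polynomials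

A list of rows stands for a polynomial in `x = β ^ 2` and `ω`: the rows belong to the powers of `ω`,
the entries of a row to the powers of `x`. With `y = 1 - x`, the variable `p` is `y * cp / pDen`, where
`pDen` is defined further below, and the other polynomials come from substituting this value of `p`
and cancelling powers of `x` and `y`. -/

namespace M1P
open Encl

/-- `y - p ^ 2 = x * y * cH / pDen ^ 2`. -/
def cH : List (List ℤ) :=
   [[19845, -24822, 7553, 1024],
    [0, -4410, 4396, -1426],
    [0, 0, 245, -182, 81]]

/-- `1 - p = x * c1p / pDen`. -/
def c1p : List (List ℤ) :=
   [[189, -129],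
    [0, -21, 9]]

/-- `p = y * cp / pDen`. -/
def cp : List (List ℤ) :=
   [[315, -161],
    [0, -35, 9]]

/-- `2 + p = c2p / pDen`. -/
def c2p : List (List ℤ) :=
   [[945, -1050, 225],
    [0, -105, 90, -9]]

/-- `nB1 = x ^ 2 * y * cb1 / pDen ^ 2`. -/
def cb1 : List (List ℤ) :=
   [[1701, -945, -1536],
    [0, -378, 834],
    [0, 0, 21, -81]]

/-- `nA = x ^ 2 * ca / pDen ^ 2`. -/
def ca : List (List ℤ) :=
   [[176904, -257040, 89448, 5088],
    [0, -39312, 51456, -18192, 288],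
    [0, 0, 2184, -2544, 936]]

/-- `nC = x ^ 2 * y * cc / pDen ^ 3`. -/
def cc : List (List ℤ) :=
   [[-231472080, 536672304, -419915664, 112647024, -5530080, 2611104, -196608],
    [0, 77157360, -171542448, 132532848, -36666576, 1830240, -201024],
    [0, 0, -8573040, 18243792, -13761072, 3467088, 8928, -7776],
    [0, 0, 0, 317520, -645456, 468816, -91632, -7776]]

/-- `nC1 = x ^ 3 * y ^ 2 * cc1 / pDen ^ 5`. -/
def cc1 : List (List ℤ) :=
   [[-3445172570700, 34965767328660, -102691419357996, 140440603727844, -99293326065108,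
     34208641519164, -3793551569892, -264067919028, -62008854480, 9287170560, -103809024],
    [0, 1913984761500, -17845629347700, 50245740852300, -67395878472132, 47952598271508,
     -17585776376028, 2670495408324, -39605286636, 10792478016, -1400200704, 28311552],
    [0, 0, -425329947000, 3614629422600, -9804372875640, 13036676951592, -9378702820872,
     3570484793112, -603991288872, 21251867832, -851359968, 65097216],
    [0, 0, 0, 47258883000, -362618159400, 954879007320, -1273754977992, 925228769256,
     -355366067832, 60416802504, -2014633368, -2711232, 1119744],
    [0, 0, 0, 0, -2625493500, 17978379300, -46508239260, 62989005492, -45801296100, 17268681708,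
     -2750331060, 43935804, 2554416],
    [0, 0, 0, 0, 0, 58344300, -351362340, 908867484, -1262544948, 904425156, -327512556,
     45168948, 726084]]

/-- `nQ0 = x ^ 4 * y ^ 2 * cq0 / pDen ^ 5`. -/
def cq0 : List (List ℤ) :=
   [[787468016160, -2263241409408, 1731781513728, 471791537280, -1058264712288, 326716830720,
     -11384558784, 7649722368, -603979776],
    [0, -437482231200, 1521234509760, -1750690210752, 633828851712, 139538627424, -97298516160,
     738604800, -289603584],
    [0, 0, 97218273600, -396691706880, 545864562432, -303300764928, 45273001536, 6483868416,
     779294592, -55738368],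
    [0, 0, 0, -10802030400, 50592366720, -76029674112, 47799857664, -10499736384, -12018816,
     -43483392],
    [0, 0, 0, 0, 600112800, -3172659840, 4964504832, -3226170240, 708256800, 14743296, -1259712],
    [0, 0, 0, 0, 0, -13335840, 78547392, -124254144, 79796736, -14517792, -1259712]]

/-- `nQ1 = x ^ 5 * y ^ 3 * cq1 / pDen ^ 7`. -/
def cq1 : List (List ℤ) :=
   [[105484293769692600, -1343166674000752440, 4478427781455114144, -6378055303589460288,
     3375781440343592112, 1615316665968181008, -3342173747068291968, 1974770361623759616,
     -551860709794714152, 69754264368262632, -4846978208068704, 964813528858752, -86859059429376,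
     1790196056064],
    [0, -82043339598649800, 1191284174117900520, -4378442809949675712, 7434844730977664448,
     -6603387078586244688, 2749806413587436112, 40916798759132352, -532013801783998464,
     207576730706099544, -30580997986521720, 1642326553333440, -162213835351680, 10351896035328,
     -108716359680],
    [0, 0, 27347779866216600, -445961052448775640, 1725397073686881504, -3138961572781078464,
     3172992419610293616, -1830237459014132784, 543900961715392512, -38798294397133824,
     -19147729463125704, 3946075917752520, -84010704673824, -278589549312, -121828147200],
    [0, 0, 0, -5064403678929000, 91634700035478600, -362744866736501760, 676011347719202880,
     -712967303118606480, 447449203905192720, -163091664167617728, 30463636024320768,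
     -1714527920863944, -119093196715416, -9564534262656, 929951933184, -10606215168],
    [0, 0, 0, 0, 562711519881000, -11187113331983400, 44439435323468640, -82873088240644800,
     88181561650548240, -56604532341485520, 21672123773355648, -4579554648851712,
     429827220479880, -7856289576648, 676848159072, -27048816000],
    [0, 0, 0, 0, 0, -37514101325400, 812839555112760, -3193689852835776, 5878361319630912,
     -6210379661795568, 3971635063465968, -1515292536689856, 318684561753600, -29517371512056,
     332607422232, 7512502464, -249422976],
    [0, 0, 0, 0, 0, 0, 1389411160200, -32587835361480, 125191907654688, -225493705991232,
     234567708257232, -147161431523088, 54272087112960, -10694393860608, 836393338728,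
     9883577880, -753937632],
    [0, 0, 0, 0, 0, 0, 0, -22054145400, 556674635160, -2070607867776, 3630306326976,
     -3701871062064, 2250498864816, -782973815616, 138161127168, -7872797592, -389723400]]

/-- `nQ2 = x ^ 6 * y ^ 3 * cq2 / pDen ^ 7`. -/
def cq2 : List (List ℤ) :=
   [[-253748328901538310, 1562806554190235298, -3467686261595313996, 3126049674086396232,
     222133228554938652, -2945823869597998788, 2642292021126315600, -1065699587428368984,
     185177616051395034, -3828152317634766, -1406117188904436, 3853998931968, 3780951146496],
    [0, 265729261033404630, -1748750372824375494, 4434486514925774832, -5727060853370670744,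
     3864003578293189716, -956982796426424628, -391833986446299096, 335613302568307656,
     -81457194717286074, 5895327034448586, 62876060793720, -686606450688, -283342012416],
    [0, 0, -111366236899648710, 749085732440489178, -1962038590680790692, 2723928438051351720,
     -2190277443011426244, 993795692654575692, -201722571031233024, -11240307063916920,
     11117551673426490, -1170722445855318, 13541308808436, 502433611776, 3057647616],
    [0, 0, 0, 24843713602746150, -167347943352216270, 436123861024408200, -609682701436152120,
     508390950980020500, -255133819095023268, 71338384191589560, -8434749897480024,
     -196910967795210, 75061260556290, -1050261073776, -33586348032],
    [0, 0, 0, 0, -3229338889094850, 21536960409997830, -54766723643733780, 75096836727295320,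
     -62477876497026060, 32106373882872948, -9664070525953776, 1475894496256632, -75480789532770,
     -775905270858, 37389059892, 322486272],
    [0, 0, 0, 0, 0, 246551010377490, -1616101341443442, 3959163470826144, -5254191671222088,
     4299952072258332, -2205721497923676, 669723490913688, -105595145600040, 6445242907938,
     -73441316034, -1122875784],
    [0, 0, 0, 0, 0, 0, -10289361536370, 65945419908606, -154101553313148, 196449218304696,
     -157459569744204, 79629608143620, -23526909797472, 3509742593880, -192732391602, 2210676462,
     6377292],
    [0, 0, 0, 0, 0, 0, 0, 181701653490, -1134081333882, 2505525839208, -3056421007080,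
     2401699273596, -1185233866956, 330517283976, -43937920584, 1876774050, -22320522]]

/-- `nQ3 = x ^ 5 * y ^ 2 * cq3 / pDen ^ 6`. -/
def cq3 : List (List ℤ) :=
   [[-8268414169680, 228759458694480, -549696423502800, 293798113377552, 439990015146192,
     -734762411654544, 429852371976720, -101164392087120, -732316231872, 3131922791808,
     -111661940736],
    [0, 5512276113120, -262226849381280, 805575891800736, -994498835781024, 560033098759008,
     -71397824893920, -74937608361504, 35083625052960, -3711026093760, -336943867392, 8401453056],
    [0, 0, -1531187809200, 103318720268400, -328083665278320, 437034349871280, -304599075821712,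
     109230948907344, -12421565619408, -3372134584176, 842247545472, -504168192, -95551488],
    [0, 0, 0, 226842638400, -19821725784000, 61441983207360, -80636436619200, 57338708922432,
     -22965841772352, 4512924235584, -143547220800, -57032726400, 611006976],
    [0, 0, 0, 0, -18903553200, 2028081207600, -5971854878640, 7476164665200, -5203295863632,
     2145655506960, -485090966160, 42584931792, 995872320, -4199040],
    [0, 0, 0, 0, 0, 840157920, -106860085920, 293577086880, -344795276448, 232460548704,
     -97040655072, 23117243616, -2360583648, 10497600],
    [0, 0, 0, 0, 0, 0, -15558480, 2288578320, -5778645264, 6302809296, -4131070704, 1739125296,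
     -413593776, 40205808]]

/-- `nB2 = x ^ 5 * y ^ 3 * cq4 / pDen ^ 6`. -/
def cq4 : List (List ℤ) :=
   [[15847793825220, -27716686757676, -8479620869076, 56391386302188, -58224803777028,
     28075456615500, -5466794305644, -511817937804, 293476442112, -9323937792],
    [0, -23963089213980, 65661465035124, -68715067861692, 31623457949748, -1712220891444,
     -4984239588804, 2079110515212, -180808007652, -33122967552, 566231040],
    [0, 0, 10378050706800, -29455516596240, 33809364965880, -20267945643960, 6427734173280,
     -595107096768, -252594971208, 60339655944, 184246272],
    [0, 0, 0, -2088842628600, 5745389930280, -6417092377080, 3843934836840, -1342599054120,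
     239155792056, -1218916584, -4647914568, 41803776],
    [0, 0, 0, 0, 220016355300, -570578915340, 596613332700, -339688101060, 121303721340,
     -26535144564, 2359667268, 92265156],
    [0, 0, 0, 0, 0, -11820555180, 28401671844, -27193645836, 14498335908, -5320642788,
     1324582092, -153221220, 708588],
    [0, 0, 0, 0, 0, 0, 256714920, -563093496, 485085888, -242634672, 94174056, -25118424,
     2834352]]

/-- The numerator, in powers of `y = 1 - β ^ 2`, of the lower bound of `ω`: the convergent of the
continued fraction that `cfNum (289 / 35)` computes. -/
def cLoN : List (List ℤ) :=
    [[12669401600, 286728844800, 1306915430400, 1755510131200, 735024517500, 80461010700,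
      1034208175]]

/-- The denominator that goes with `cLoN`. -/
def cLoD : List (List ℤ) :=
    [[2952090112, 79646128128, 445553114880, 771422840960, 452960230380, 82743104808, 3193650257]]

/-- The numerator, in powers of `y`, of the upper bound of `ω`, from `cfNum (1407 / 100)`. -/
def cHiN : List (List ℤ) :=
    [[388876921600, 13662978588800, 84259910750400, 142624661463200, 72026096301250,
      9230888626575, 135946485675]]

/-- The denominator that goes with `cHiN`. -/
def cHiD : List (List ℤ) :=
    [[88587337472, 3647698254208, 27376358086080, 59425879512160, 41943085657130, 8948307104373,
      395002069077]]

end M1P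

/-! ### The polynomial inequalities and their checks

The variable `v0` stands for `β`, and `v1` for `ω`. Up to positive factors, `eP0`, `cc1`, `eP2` and
`eP3` are the coefficients of `charS` at `v = 0`, and `ePLin` is its linear coefficient
at the largest value `v = 1 - e ^ 2`. A positive root is written `s = y σ / (4 - y)`, a negative one
`s = -X`. -/

namespace M1P
open Encl Ex

/-- `x = β ^ 2`. -/
def eX : Ex := mul v0 v0
/-- `y = 1 - β ^ 2`. -/
def eY : Ex := add (con 1) (neg eX)
/-- `4 - y`. -/
def eY4 : Ex := add (con 3) eX
/-- `2 + y`. -/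
def eY2 : Ex := add (con 3) (neg eX)
/-- `8 + y`. -/
def eY8 : Ex := add (con 9) (neg eX)
/-- A polynomial in `x` and `ω`. -/
def eP (c : List (List ℤ)) : Ex := poly c eX v1
/-- The common factor of `b₁` and of the constant coefficient of the quartic. -/
def eB : Ex := mul (eP c1p) (eP cp)
/-- `y ^ 2`. -/
def eYY : Ex := mul eY eY
/-- `(4 - y) ^ 2`. -/
def eZZ : Ex := mul eY4 eY4
/-- The linear coefficient of `charS` at `v = 1 - e ^ 2`. -/
def ePLin : Ex :=
  add (eP cc1) (neg (mul (mul eY8 eB) (mul (eP cb1) (mul eZZ (eP c2p)))))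
/-- `cH * (2 + y)`. -/
def eHY2 : Ex := mul (eP cH) eY2
/-- The constant coefficient of `charS`. -/
def eP0 : Ex := mul v0 (mul (eP cc) eHY2)
/-- The quadratic coefficient of `charS`. -/
def eP2 : Ex := mul v0 (mul (eP ca) (mul (eP c2p) eHY2))
/-- The cubic coefficient of `charS`. -/
def eP3 : Ex := mul (mul (eP c2p) (eP cH)) eHY2
/-- The constant coefficient of the quartic, without a factor `β`. -/
def eT0 : Ex := mul (mul eB (mul eY2 eY2)) (eP cq0)
/-- The cubic coefficient of the quartic. -/
def eT3 : Ex := mul (eP c2p) (eP cq3)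
/-- The leading coefficient of the quartic, without a factor `β`. -/
def eT4 : Ex := mul (eP c2p) (eP cq4)

/-- The quartic, as a polynomial in `σ`. -/
def tS : List Ex :=
  [mul v0 eT0, eP cq1, mul v0 (eP cq2), eT3, mul v0 (mul eY eT4)]
/-- `charS` at `v = 1 - e ^ 2`, as a polynomial in `σ`. Where it is positive, so is `charS` at all
smaller `v`. -/
def pwS : List Ex := [eP0, ePLin, eP2, mul eY eP3]
/-- `(c - charS) / σ` at `v = 0`, as a polynomial in `σ`. Where it is positive, `charS` is
negative at all positive `v`. -/
def mp0S : List Ex := [neg (eP cc1), neg eP2, neg (mul eY eP3)]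

/-- The negative of the quartic at `s = -X`, as a polynomial in `X`. -/
def mtX : List Ex :=
  [neg (mul v0 (mul (mul eY eYY) eT0)), mul (mul eYY eY4) (eP cq1),
   neg (mul v0 (mul (mul eY eZZ) (eP cq2))), mul (mul eY4 eZZ) eT3,
   neg (mul v0 (mul (mul eZZ eZZ) eT4))]
/-- `charS` at `v = 0` and `s = -X`. Where it is positive, so is `charS` at all positive `v`. -/
def p0X : List Ex :=
  [mul eYY eP0, neg (mul (mul eY eY4) (eP cc1)), mul eZZ eP2, neg (mul (mul eY4 eZZ) eP3)]
/-- `-charS` at `v = 1 - e ^ 2` and `s = -X`. Where it is positive, `charS` is negative at all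
smaller `v`. -/
def mpwX : List Ex :=
  [neg (mul eYY eP0), mul (mul eY eY4) ePLin, neg (mul eZZ eP2), mul (mul eY4 eZZ) eP3]

/-- The enclosures of a list of expressions. -/
noncomputable def tms (A B : TM) (f : List Ex) : List TM :=
  List.rec (motive := fun _ => List TM) [] (fun e _ ih => Ex.tm A B e :: ih) f

/-- The values of a list of expressions. -/
def dens (x w : ℝ) (f : List Ex) : List ℝ := f.map (Ex.den x w)

theorem forall₂_tms {t τ : ℝ} (ht0 : 0 ≤ t) (ht1 : t ≤ 1) (hs0 : 0 ≤ τ) (hs1 : τ ≤ 1)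
    {A B : TM} {x w : ℝ} (hA : A.Encloses t τ x) (hB : B.Encloses t τ w) (f : List Ex) :
    List.Forall₂ (TM.Encloses t τ) (tms A B f) (dens x w f) := by
  induction f with
  | nil => exact List.Forall₂.nil
  | cons e f ih => exact List.Forall₂.cons (encloses_tm ht0 ht1 hs0 hs1 hA hB e) ih

/-- The enclosure `2 ^ (-k) * (b + c t + h τ)`. -/
def varTM (b c h k : ℕ) : TM := ⟨[[⟨b, 0⟩, ⟨c, 0⟩], [⟨h, 0⟩]], 0, k⟩

theorem encloses_varTM (t τ : ℝ) (b c h k : ℕ) :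
    (varTM b c h k).Encloses t τ ((b + c * t + h * τ) / 2 ^ k) := by
  have h2 : ∀ n : ℕ, Z2.val ⟨n, 0⟩ = (n : ℝ) := by simp [Z2.val]
  simp only [TM.Encloses, varTM, Grid.ev_cons, Grid.ev_nil, Row.ev_cons, Row.ev_nil, h2]
  rw [div_mul_cancel₀ _ (by positivity)]
  have : (b + c * t + h * τ : ℝ) - (b + t * (c + t * 0) + τ * (h + t * 0 + τ * 0)) = 0 := by ring
  rw [this]; simp

/-- The data certifying the inequalities for `β` in an interval and `ω` in the band between `(w0 +
w1 t) / 2 ^ 12` and `(w0 + w1 t + h) / 2 ^ 12`, where `t ∈ [0, 1]` parametrizes the interval. The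
partitions are those of `coverCheck`, in units of `1 / 64`. -/
structure Box where
  /-- the length of the interval, in units of `1 / 1024` -/
  len : ℕ
  /-- the value of the lower edge of the band at the left end -/
  w0 : ℕ
  /-- the increment of the lower edge over the interval -/
  w1 : ℕ
  /-- the height of the band -/
  h : ℕ
  /-- the partition of the range of `X` -/
  cert4 : List (ℕ × ℕ)
  /-- the partition of the range of `σ` -/
  cert3 : List (ℕ × ℕ)

/-- The total length of a partition. -/
noncomputable def lenSum (c : List (ℕ × ℕ)) : ℕ :=
  List.rec (motive := fun _ => ℕ) 0 (fun x _ ih => Nat.add x.2 ih) c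

theorem lenSum_eq (c : List (ℕ × ℕ)) : lenSum c = (c.map Prod.snd).sum := by
  induction c with
  | nil => rfl
  | cons x c ih => change x.2 + lenSum c = _; rw [ih]; rfl

/-- The list has an entry. -/
noncomputable def nonempty (c : List (ℕ × ℕ)) : Bool :=
  List.rec (motive := fun _ => Bool) false (fun _ _ _ => true) c

theorem ne_nil_of_nonempty {c : List (ℕ × ℕ)} (h : nonempty c = true) : c ≠ [] := by
  rintro rfl; exact absurd h (by simp [nonempty])

/-- Positivity of a single expression. -/
noncomputable def posCheck (A B : TM) (e : Ex) : Bool := rayCheck 0 0 (tms A B [e])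

/-- Positivity of each of a list of expressions. -/
noncomputable def posChecks (A B : TM) (f : List Ex) : Bool :=
  List.rec (motive := fun _ => Bool) true (fun e _ ih => Bool.and (posCheck A B e) ih) f

theorem posCheck_sound {t τ : ℝ} (ht0 : 0 ≤ t) (ht1 : t ≤ 1) (hs0 : 0 ≤ τ) (hs1 : τ ≤ 1)
    {A B : TM} {x w : ℝ} (hA : A.Encloses t τ x) (hB : B.Encloses t τ w) {e : Ex}
    (h : posCheck A B e = true) : 0 < e.den x w := by
  have := rayCheck_sound ht0 ht1 hs0 hs1 (forall₂_tms ht0 ht1 hs0 hs1 hA hB [e]) h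
    (s := 0) (by simp)
  simpa [dens] using this

theorem posChecks_sound {t τ : ℝ} (ht0 : 0 ≤ t) (ht1 : t ≤ 1) (hs0 : 0 ≤ τ) (hs1 : τ ≤ 1)
    {A B : TM} {x w : ℝ} (hA : A.Encloses t τ x) (hB : B.Encloses t τ w) {f : List Ex}
    (h : posChecks A B f = true) : ∀ e ∈ f, 0 < e.den x w := by
  induction f with
  | nil => simp
  | cons e f ih =>
    change (posCheck A B e && posChecks A B f) = true at h
    rw [Bool.and_eq_true] at h
    intro e' he'
    rcases List.mem_cons.1 he' with rfl | he'
    · exact posCheck_sound ht0 ht1 hs0 hs1 hA hB h.1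
    · exact ih h.2 e' he'

/-- A polynomial in `y` alone, given by a single row. -/
def eY0 (c : List (List ℤ)) : Ex := poly c eY v1

/-- The band of the box contains the interval `[loN / loD, hiN / hiD]`. -/
noncomputable def bandCheck (b : ℕ) (B : Box) : Bool :=
  (fun A : TM => Bool.and
    (posChecks A (varTM B.w0 B.w1 0 12)
      [eY0 cLoD, add (eY0 cLoN) (neg (mul v1 (eY0 cLoD)))])
    (posChecks A (varTM (Nat.add B.w0 B.h) B.w1 0 12)
      [eY0 cHiD, add (mul v1 (eY0 cHiD)) (neg (eY0 cHiN))]))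
    (varTM b B.len 0 10)

/-- The expressions that fix the signs of `y - p ^ 2`, `1 - p`, `p`, `2 + p`, `b₁` and `-c`. -/
def simpleEx : List Ex := [eP cH, eP c1p, eP cp, eP c2p, eP cb1, neg (eP cc)]

/-- The inequalities `Claims` on a box. The negative roots are separated from `0` by the point
`-34 / 64`. -/
noncomputable def boxCheck (b : ℕ) (B : Box) : Bool :=
  (fun A W : TM => Bool.and (posChecks A W simpleEx)
    (Bool.and (intervalCheck 6 34 0 (tms A W p0X))
    (Bool.and (Bool.and (nonempty B.cert4) (nonempty B.cert3))
    (Bool.and (rayCheck 6 (Nat.add 34 (lenSum B.cert4)) (tms A W mpwX))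
    (Bool.and (rayCheck 6 (lenSum B.cert3) (tms A W pwS))
    (Bool.and (coverCheck 6 [tms A W mtX, tms A W p0X, tms A W mpwX] B.cert4 34)
      (coverCheck 6 [tms A W tS, tms A W pwS, tms A W mp0S] B.cert3 0)))))))
    (varTM b B.len 0 10) (varTM B.w0 B.w1 B.h 12)

/-- The check of a chain of adjacent boxes, the first of which begins at `β = b / 1024`. -/
noncomputable def chainCheck (l : List Box) : ℕ → Bool :=
  List.rec (motive := fun _ => ℕ → Bool) (fun _ => true)
    (fun B _ ih b => Bool.and (bandCheck b B) (Bool.and (boxCheck b B) (ih (Nat.add b B.len)))) l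

/-- The polynomial inequalities behind the theorem, at the parameter `β` and the value `ω` of the
continued fraction tail. -/
structure Claims (β ω : ℝ) : Prop where
  simple : ∀ e ∈ simpleEx, 0 < e.den β ω
  sep : 0 < horner (dens β ω p0X) (34 / 64)
  neg_root : ∀ X : ℝ, 34 / 64 ≤ X →
    ∃ g ∈ [dens β ω mtX, dens β ω p0X, dens β ω mpwX], 0 < horner g X
  pos_root : ∀ σ : ℝ, 0 ≤ σ →
    ∃ g ∈ [dens β ω tS, dens β ω pwS, dens β ω mp0S], 0 < horner g σ

theorem boxCheck_sound {b : ℕ} {B : Box} (h : boxCheck b B = true) {t τ : ℝ} (ht0 : 0 ≤ t)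
    (ht1 : t ≤ 1) (hs0 : 0 ≤ τ) (hs1 : τ ≤ 1) :
    Claims ((b + B.len * t + (0 : ℕ) * τ) / 2 ^ 10) ((B.w0 + B.w1 * t + B.h * τ) / 2 ^ 12) := by
  have hA := encloses_varTM t τ b B.len 0 10
  have hB := encloses_varTM t τ B.w0 B.w1 B.h 12
  set β := ((b + B.len * t + (0 : ℕ) * τ) / 2 ^ 10 : ℝ)
  set ω := ((B.w0 + B.w1 * t + B.h * τ) / 2 ^ 12 : ℝ)
  set A := varTM b B.len 0 10
  set W := varTM B.w0 B.w1 B.h 12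
  have F := fun f => forall₂_tms ht0 ht1 hs0 hs1 hA hB f
  have F3 : ∀ f1 f2 f3, List.Forall₂ (List.Forall₂ (TM.Encloses t τ))
      [tms A W f1, tms A W f2, tms A W f3] [dens β ω f1, dens β ω f2, dens β ω f3] :=
    fun f1 f2 f3 => .cons (F f1) (.cons (F f2) (.cons (F f3) .nil))
  change (posChecks A W simpleEx && (intervalCheck 6 34 0 (tms A W p0X)
    && ((nonempty B.cert4 && nonempty B.cert3)
    && (rayCheck 6 (34 + lenSum B.cert4) (tms A W mpwX)
    && (rayCheck 6 (lenSum B.cert3) (tms A W pwS)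
    && (coverCheck 6 [tms A W mtX, tms A W p0X, tms A W mpwX] B.cert4 34
    && coverCheck 6 [tms A W tS, tms A W pwS, tms A W mp0S] B.cert3 0)))))) = true at h
  simp only [Bool.and_eq_true] at h
  obtain ⟨h1, h2, ⟨hn4, hn3⟩, h4, h5, h6, h7⟩ := h
  refine ⟨posChecks_sound ht0 ht1 hs0 hs1 hA hB h1,
    intervalCheck_sound ht0 ht1 hs0 hs1 (F _) h2 (by norm_num) (by norm_num), ?_, ?_⟩
  · intro X hX
    by_cases hX2 : 2 ^ 6 * X ≤ (34 + (B.cert4.map Prod.snd).sum : ℕ)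
    · exact coverCheck_sound ht0 ht1 hs0 hs1 (F3 _ _ _) h6 (ne_nil_of_nonempty hn4)
        (by norm_num; linarith) hX2
    · push Not at hX2
      refine ⟨_, List.mem_cons_of_mem _ (List.mem_cons_of_mem _ List.mem_cons_self), ?_⟩
      rw [lenSum_eq] at h4
      exact rayCheck_sound ht0 ht1 hs0 hs1 (F _) h4 hX2.le
  · intro σ hσ
    by_cases hX2 : 2 ^ 6 * σ ≤ (0 + (B.cert3.map Prod.snd).sum : ℕ)
    · exact coverCheck_sound ht0 ht1 hs0 hs1 (F3 _ _ _) h7 (ne_nil_of_nonempty hn3)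
        (by norm_num; linarith) hX2
    · push Not at hX2
      refine ⟨_, List.mem_cons_of_mem _ List.mem_cons_self, ?_⟩
      rw [lenSum_eq] at h5
      rw [zero_add] at hX2
      exact rayCheck_sound ht0 ht1 hs0 hs1 (F _) h5 hX2.le

theorem and_true_of_bandCheck {b : ℕ} {B : Box} (h : bandCheck b B = true) :
    posChecks (varTM b B.len 0 10) (varTM B.w0 B.w1 0 12)
      [eY0 cLoD, add (eY0 cLoN) (neg (mul v1 (eY0 cLoD)))] = true ∧
    posChecks (varTM b B.len 0 10) (varTM (Nat.add B.w0 B.h) B.w1 0 12)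
      [eY0 cHiD, add (mul v1 (eY0 cHiD)) (neg (eY0 cHiN))] = true := by
  simpa only [bandCheck, Bool.and_eq_true] using h

/-- On a box that passes `bandCheck`, every `ω` between the two convergents is a point of the
band. -/
theorem bandCheck_sound {b : ℕ} {B : Box} (h : bandCheck b B = true) {t : ℝ} (ht0 : 0 ≤ t)
    (ht1 : t ≤ 1) {y ω : ℝ} (hy : y = 1 - ((b + B.len * t) / 2 ^ 10) ^ 2)
    (h1 : polyEval cLoN y 0 ≤ ω * polyEval cLoD y 0)
    (h2 : ω * polyEval cHiD y 0 ≤ polyEval cHiN y 0) :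
    ∃ τ : ℝ, 0 ≤ τ ∧ τ ≤ 1 ∧ ω = (B.w0 + B.w1 * t + B.h * τ) / 2 ^ 12 := by
  have hA := encloses_varTM t 0 b B.len 0 10
  have hW := encloses_varTM t 0 B.w0 B.w1 0 12
  have hW' := encloses_varTM t 0 (Nat.add B.w0 B.h) B.w1 0 12
  set ω₀ := ((B.w0 + B.w1 * t + (0 : ℕ) * 0) / 2 ^ 12 : ℝ) with e0
  set ω₁ := ((((Nat.add B.w0 B.h : ℕ) : ℝ) + B.w1 * t + (0 : ℕ) * 0) / 2 ^ 12 : ℝ) with e1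
  obtain ⟨hl, hr⟩ := and_true_of_bandCheck h
  have k1 := posChecks_sound ht0 ht1 le_rfl zero_le_one hA hW hl
  have k2 := posChecks_sound ht0 ht1 le_rfl zero_le_one hA hW' hr
  have hy0 : ∀ w : ℝ, eY.den ((b + B.len * t + (0 : ℕ) * 0) / 2 ^ 10) w = y := by
    intro w; simp only [eY, eX, den]; rw [hy]; push_cast; ring
  have hp : ∀ (l : List (List ℤ)) (r : List ℤ), l = [r] → ∀ w : ℝ,
      (eY0 l).den ((b + B.len * t + (0 : ℕ) * 0) / 2 ^ 10) w = polyEval l y 0 := by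
    intro l r hl w
    subst hl
    simp only [eY0, den, hy0]
    simp [polyEval]
  have k11 := k1 _ List.mem_cons_self
  have k12 : 0 < den _ ω₀ (eY0 cLoN) + -(ω₀ * den _ ω₀ (eY0 cLoD)) :=
    k1 _ (List.mem_cons_of_mem _ List.mem_cons_self)
  have k21 := k2 _ List.mem_cons_self
  have k22 : 0 < ω₁ * den _ ω₁ (eY0 cHiD) + -den _ ω₁ (eY0 cHiN) :=
    k2 _ (List.mem_cons_of_mem _ List.mem_cons_self)
  rw [hp cLoD _ rfl] at k11 k12
  rw [hp cHiD _ rfl] at k21 k22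
  rw [hp cLoN _ rfl] at k12
  rw [hp cHiN _ rfl] at k22
  have g3 : ω₁ = ω₀ + B.h / 2 ^ 12 := by rw [e0, e1, Nat.add_eq]; push_cast; ring
  clear_value ω₀ ω₁
  generalize polyEval cLoD y 0 = loD at *
  generalize polyEval cHiD y 0 = hiD at *
  generalize polyEval cLoN y 0 = loN at *
  generalize polyEval cHiN y 0 = hiN at *
  have g1 : ω₀ < ω := lt_of_mul_lt_mul_right (by linarith) k11.le
  have g2 : ω < ω₁ := lt_of_mul_lt_mul_right (by linarith) k21.le
  have g4 : (0 : ℝ) < B.h := by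
    have : (0 : ℝ) < B.h / 2 ^ 12 := by linarith
    rwa [lt_div_iff₀ (by positivity), zero_mul] at this
  refine ⟨(ω - ω₀) * 2 ^ 12 / B.h, by
    have : 0 ≤ ω - ω₀ := by linarith
    positivity, ?_, ?_⟩
  · rw [div_le_one g4]
    have : ω - ω₀ ≤ B.h / 2 ^ 12 := by linarith
    rwa [le_div_iff₀ (by positivity)] at this
  · have : (B.h : ℝ) * ((ω - ω₀) * 2 ^ 12 / B.h) = (ω - ω₀) * 2 ^ 12 := by field_simp
    rw [this, e0]; push_cast; ring

/-- A chain that passes `chainCheck` covers all `β` between its ends and all `ω` between the two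
convergents. -/
theorem chainCheck_sound {l : List Box} {b : ℕ} (h : chainCheck l b = true) {β ω : ℝ}
    (hb : (b : ℝ) < 2 ^ 10 * β) (hb' : 2 ^ 10 * β ≤ (b + (l.map Box.len).sum : ℕ))
    (h1 : polyEval cLoN (1 - β ^ 2) 0 ≤ ω * polyEval cLoD (1 - β ^ 2) 0)
    (h2 : ω * polyEval cHiD (1 - β ^ 2) 0 ≤ polyEval cHiN (1 - β ^ 2) 0) : Claims β ω := by
  induction l generalizing b with
  | nil => simp at hb'; linarith
  | cons B l ih =>
    change (bandCheck b B && (boxCheck b B && chainCheck l (b + B.len))) = true at h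
    simp only [Bool.and_eq_true] at h
    obtain ⟨k1, k2, k3⟩ := h
    by_cases hβ : 2 ^ 10 * β ≤ b + B.len
    · have hl : (0 : ℝ) < B.len := by linarith
      have ht0 : 0 ≤ (2 ^ 10 * β - b) / B.len := div_nonneg (by linarith) hl.le
      have ht1 : (2 ^ 10 * β - b) / B.len ≤ 1 := by rw [div_le_one hl]; linarith
      have e : β = (b + B.len * ((2 ^ 10 * β - b) / B.len)) / 2 ^ 10 := by field_simp; ring
      obtain ⟨τ, hs0, hs1, hω⟩ := bandCheck_sound k1 ht0 ht1
        (y := 1 - β ^ 2) (by rw [← e]) h1 h2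
      have := boxCheck_sound k2 ht0 ht1 hs0 hs1
      rw [Nat.cast_zero, zero_mul, add_zero, ← e, ← hω] at this
      exact this
    · push Not at hβ
      refine ih k3 (by push_cast; linarith) ?_
      rw [List.map_cons, List.sum_cons] at hb'
      rw [add_assoc]; exact hb'

end M1P

/-! ### Certificates for `β ≤ 1003 / 1024`

Each chain is named by `1024 β` at its left end. -/

namespace M1P
open Encl

theorem chainCheck_0 : chainCheck [
    ⟨40, 9308, 0, 6, [(0, 31), (0, 7), (2, 24)], [(2, 56), (0, 56), (0, 56), (0, 56)]⟩,
    ⟨54, 9312, 9, 9, [(0, 31), (0, 11), (2, 20)], [(0, 56), (0, 56), (0, 84), (1, 28)]⟩,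
    ⟨50, 9328, 21, 8, [(0, 31), (0, 15), (2, 16)], [(0, 48), (0, 48), (0, 96)]⟩,
    ⟨42, 9355, 27, 7, [(0, 31), (0, 19), (2, 12)], [(0, 48), (0, 48), (0, 96)]⟩,
    ⟨42, 9387, 36, 7, [(0, 31), (0, 22), (2, 9)], [(0, 48), (0, 48), (0, 96)]⟩,
    ⟨38, 9427, 40, 7, [(0, 31), (0, 25), (2, 6)], [(0, 48), (0, 48), (0, 96)]⟩,
    ⟨40, 9472, 51, 7, [(0, 15), (0, 31), (0, 12), (2, 4)], [(0, 80), (0, 80)]⟩,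
    ⟨36, 9527, 54, 7, [(0, 15), (0, 31), (0, 15), (2, 1)], [(0, 80), (0, 80)]⟩,
    ⟨36, 9585, 61, 8, [(0, 19), (0, 20), (0, 24), (2, 15)], [(0, 80), (0, 40), (0, 40)]⟩] 0 = true := by
  decide +kernel

theorem chainCheck_378 : chainCheck [
    ⟨34, 9651, 66, 7, [(0, 19), (0, 20), (0, 26), (0, 1), (2, 12)], [(0, 80), (0, 40), (0, 40)]⟩,
    ⟨36, 9722, 79, 7, [(0, 19), (0, 20), (0, 19), (0, 10), (2, 10)], [(0, 80), (0, 40), (0, 40)]⟩,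
    ⟨36, 9806, 89, 8, [(0, 19), (0, 20), (0, 19), (0, 12), (2, 8)], [(0, 40), (0, 40), (0, 40),
      (0, 40)]⟩,
    ⟨34, 9900, 94, 9, [(0, 19), (0, 20), (0, 19), (0, 14), (2, 6)], [(0, 40), (0, 40), (0, 40),
      (0, 40)]⟩,
    ⟨34, 10000, 105, 9, [(0, 9), (0, 30), (0, 29), (0, 6), (2, 4)], [(0, 40), (0, 40), (0, 80)]⟩,
    ⟨36, 10111, 124, 12, [(0, 9), (0, 10), (0, 20), (0, 29), (0, 8), (2, 2)], [(0, 40), (0, 40),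
      (0, 80)]⟩,
    ⟨34, 10243, 132, 12, [(0, 9), (0, 30), (0, 19), (0, 20)], [(0, 60), (0, 20), (0, 80)]⟩,
    ⟨32, 10383, 139, 12, [(0, 11), (0, 12), (0, 24), (0, 29), (0, 4), (2, 14)], [(0, 60), (0,
      20), (0, 80)]⟩,
    ⟨28, 10531, 136, 11, [(0, 11), (0, 12), (0, 24), (0, 29), (0, 5), (2, 13)], [(0, 40), (0,
      20), (0, 20), (0, 80)]⟩] 378 = true := by
  decide +kernel

theorem chainCheck_682 : chainCheck [
    ⟨26, 10674, 140, 11, [(0, 11), (0, 12), (0, 24), (0, 23), (0, 12), (2, 12)], [(0, 40), (0,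
      20), (0, 20), (0, 80)]⟩,
    ⟨24, 10822, 142, 10, [(0, 11), (0, 12), (0, 24), (0, 23), (0, 13), (2, 11)], [(0, 40), (0,
      20), (0, 20), (0, 80)]⟩,
    ⟨20, 10971, 130, 8, [(1, 23), (0, 24), (0, 23), (0, 13), (2, 11)], [(0, 40), (0, 20), (0,
      20), (0, 80)]⟩,
    ⟨20, 11107, 141, 9, [(0, 23), (0, 24), (0, 23), (0, 14), (2, 10)], [(0, 40), (0, 20), (0,
      20), (0, 80)]⟩,
    ⟨18, 11254, 138, 9, [(0, 23), (0, 24), (0, 23), (0, 14), (2, 10)], [(0, 40), (0, 20), (0,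
      100)]⟩,
    ⟨16, 11399, 133, 8, [(0, 23), (0, 24), (0, 23), (0, 15), (2, 9)], [(0, 40), (0, 20), (0,
      100)]⟩,
    ⟨16, 11537, 144, 9, [(0, 23), (0, 24), (0, 23), (0, 14), (2, 10)], [(0, 24), (0, 24), (0,
      24), (0, 120)]⟩,
    ⟨14, 11688, 136, 8, [(0, 23), (0, 24), (0, 23), (0, 15), (2, 9)], [(0, 24), (0, 24), (0, 24),
      (0, 120)]⟩,
    ⟨14, 11829, 147, 8, [(0, 23), (0, 24), (0, 23), (0, 14), (2, 10)], [(0, 24), (0, 24), (0,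
      24), (0, 120)]⟩] 682 = true := by
  decide +kernel

theorem chainCheck_850 : chainCheck [
    ⟨13, 11982, 147, 9, [(0, 23), (0, 24), (0, 23), (0, 14), (2, 10)], [(0, 28), (0, 14), (0,
      14), (0, 168)]⟩,
    ⟨12, 12135, 147, 8, [(0, 23), (0, 24), (0, 23), (0, 14), (2, 10)], [(0, 28), (0, 14), (0,
      14), (0, 168)]⟩,
    ⟨11, 12288, 145, 8, [(0, 23), (0, 24), (0, 23), (0, 13), (2, 11)], [(0, 28), (0, 14), (0,
      14), (0, 168)]⟩,
    ⟨10, 12438, 142, 8, [(0, 23), (0, 24), (0, 23), (0, 13), (2, 11)], [(0, 32), (0, 16), (0,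
      16), (0, 192)]⟩,
    ⟨9, 12585, 137, 8, [(0, 23), (0, 24), (0, 23), (0, 12), (2, 12)], [(0, 32), (0, 16), (0, 16),
      (0, 192)]⟩,
    ⟨9, 12727, 146, 8, [(0, 23), (0, 24), (0, 23), (0, 12), (2, 12)], [(0, 20), (0, 20), (0, 20),
      (0, 260)]⟩,
    ⟨8, 12879, 139, 8, [(0, 23), (0, 24), (0, 23), (0, 12), (2, 12)], [(0, 20), (0, 20), (0, 20),
      (0, 260)]⟩,
    ⟨8, 13023, 149, 9, [(0, 23), (0, 24), (0, 23), (0, 12), (2, 12)], [(0, 20), (0, 20), (0, 10),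
      (0, 110), (0, 160)]⟩,
    ⟨8, 13179, 160, 9, [(0, 23), (0, 24), (0, 29), (0, 4), (2, 14)], [(0, 24), (0, 12), (0, 12),
      (0, 24), (0, 312)]⟩] 850 = true := by
  decide +kernel

theorem chainCheck_938 : chainCheck [
    ⟨7, 13346, 151, 9, [(0, 23), (0, 24), (0, 29), (0, 3), (2, 15)], [(0, 24), (0, 12), (0, 12),
      (0, 48), (0, 288)]⟩,
    ⟨6, 13503, 140, 8, [(0, 19), (0, 20), (0, 19), (0, 20)], [(0, 28), (0, 14), (0, 14), (0,
      392)]⟩,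
    ⟨6, 13648, 149, 9, [(0, 19), (0, 20), (0, 19), (0, 20)], [(0, 28), (0, 14), (0, 14), (0,
      392)]⟩,
    ⟨6, 13803, 160, 10, [(0, 19), (0, 20), (0, 29), (0, 9), (2, 1)], [(0, 16), (0, 16), (0, 8),
      (0, 8), (0, 16), (0, 448)]⟩,
    ⟨5, 13969, 144, 10, [(0, 19), (0, 20), (0, 19), (0, 20)], [(0, 16), (0, 16), (0, 16), (0,
      80), (0, 384)]⟩,
    ⟨5, 14119, 154, 11, [(0, 19), (0, 20), (0, 29), (0, 7), (2, 3)], [(0, 20), (0, 10), (0, 10),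
      (0, 10), (0, 590)]⟩,
    ⟨4, 14279, 133, 10, [(0, 19), (0, 20), (0, 19), (0, 20)], [(0, 20), (0, 20), (0, 20), (0,
      580)]⟩,
    ⟨4, 14416, 141, 13, [(0, 19), (0, 20), (0, 29), (0, 5), (2, 5)], [(0, 24), (0, 12), (0, 12),
      (0, 720)]⟩,
    ⟨4, 14563, 151, 15, [(0, 19), (0, 20), (0, 29), (0, 5), (2, 5)], [(0, 24), (0, 12), (0, 12),
      (0, 144), (0, 576)]⟩] 938 = true := by
  decide +kernel

theorem chainCheck_985 : chainCheck [
    ⟨3, 14720, 122, 14, [(0, 19), (0, 20), (0, 29), (0, 5), (2, 5)], [(0, 24), (0, 12), (0, 12),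
      (0, 720)]⟩,
    ⟨3, 14845, 129, 18, [(0, 19), (0, 20), (0, 29), (0, 5), (2, 5)], [(0, 28), (0, 14), (0, 14),
      (0, 840)]⟩,
    ⟨3, 14979, 137, 22, [(0, 19), (0, 20), (0, 19), (0, 10), (2, 10)], [(0, 14), (0, 14), (0,
      14), (0, 14), (0, 840)]⟩,
    ⟨2, 15121, 98, 22, [(0, 19), (0, 20), (0, 29), (2, 10)], [(0, 16), (0, 16), (0, 16), (0,
      976)]⟩,
    ⟨2, 15222, 102, 25, [(0, 19), (0, 20), (0, 19), (0, 10), (2, 10)], [(0, 16), (0, 16), (0,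
      16), (0, 976)]⟩,
    ⟨2, 15327, 107, 30, [(0, 19), (0, 20), (0, 24), (0, 2), (2, 13)], [(0, 20), (0, 10), (0, 10),
      (0, 10), (0, 1230)]⟩,
    ⟨1, 15438, 56, 30, [(0, 19), (0, 20), (0, 19), (0, 10), (2, 10)], [(0, 20), (0, 20), (0, 20),
      (0, 1220)]⟩,
    ⟨1, 15495, 58, 33, [(0, 19), (0, 20), (0, 24), (2, 15)], [(0, 20), (0, 10), (0, 10), (0, 20),
      (0, 1220)]⟩,
    ⟨1, 15554, 59, 37, [(0, 31), (0, 15), (0, 16)], [(0, 20), (0, 10), (0, 10), (0, 10), (0,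
      1230)]⟩] 985 = true := by
  decide +kernel

end M1P

/-! ### The moments of the weight -/

open MeasureTheory Set Filter Topology

namespace M1P

/-- `∫_{-1}^1 μ ^ k / (1 - β μ) ^ j dμ`, where `β = -α`. -/
noncomputable def mom (k j : ℕ) (β : ℝ) : ℝ := ∫ μ in (-1 : ℝ)..1, μ ^ k / (1 - β * μ) ^ j

theorem one_sub_mul_pos {β μ : ℝ} (hβ : |β| < 1) (hμ : μ ∈ Icc (-1 : ℝ) 1) : 0 < 1 - β * μ := by
  have h1 : |β * μ| < 1 := by
    rw [abs_mul]
    exact mul_lt_one_of_nonneg_of_lt_one_left (abs_nonneg _) hβ (abs_le.2 hμ)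
  linarith [(abs_lt.1 h1).2]

theorem uIcc_neg_one_one : uIcc (-1 : ℝ) 1 = Icc (-1) 1 := uIcc_of_le (by norm_num)

theorem continuousOn_mom_integrand (k j : ℕ) {β : ℝ} (hβ : |β| < 1) :
    ContinuousOn (fun μ : ℝ => μ ^ k / (1 - β * μ) ^ j) (uIcc (-1) 1) := by
  rw [uIcc_neg_one_one]
  exact (by fun_prop : Continuous fun μ : ℝ => μ ^ k).continuousOn.div (by fun_prop)
    fun μ hμ => (pow_pos (one_sub_mul_pos hβ hμ) j).ne'

theorem intervalIntegrable_mom (k j : ℕ) {β : ℝ} (hβ : |β| < 1) :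
    IntervalIntegrable (fun μ : ℝ => μ ^ k / (1 - β * μ) ^ j) volume (-1) 1 :=
  (continuousOn_mom_integrand k j hβ).intervalIntegrable

theorem mul_mom_succ_succ (k j : ℕ) {β : ℝ} (hβ : |β| < 1) :
    β * mom (k + 1) (j + 1) β = mom k (j + 1) β - mom k j β := by
  rw [mom, mom, mom, ← intervalIntegral.integral_sub (intervalIntegrable_mom _ _ hβ)
    (intervalIntegrable_mom _ _ hβ), ← intervalIntegral.integral_const_mul]
  refine intervalIntegral.integral_congr fun μ hμ => ?_
  have := (one_sub_mul_pos hβ (uIcc_neg_one_one ▸ hμ)).ne'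
  field_simp
  ring

theorem mom_neg (k j : ℕ) (β : ℝ) : mom k j (-β) = (-1) ^ k * mom k j β := by
  have := intervalIntegral.integral_comp_neg (fun μ : ℝ => μ ^ k / (1 - β * μ) ^ j)
    (a := -1) (b := 1)
  rw [neg_neg] at this
  rw [mom, mom, ← this, ← intervalIntegral.integral_const_mul]
  congr 1; ext μ
  rw [neg_pow μ k, ← mul_div_assoc, ← mul_assoc, ← mul_pow]
  simp

theorem hasDerivAt_mom (k j : ℕ) {β : ℝ} (hβ : |β| < 1) :
    HasDerivAt (mom k j) (j * mom (k + 1) (j + 1) β) β := by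
  obtain ⟨ρ, h1, h2⟩ := exists_between hβ
  have hs : Metric.ball (0 : ℝ) ρ ∈ 𝓝 β := Metric.isOpen_ball.mem_nhds (by simpa using h1)
  have key : ∀ b ∈ Metric.ball (0 : ℝ) ρ, ∀ μ ∈ Icc (-1 : ℝ) 1, 1 - ρ ≤ 1 - b * μ := by
    intro b hb μ hμ
    rw [mem_ball_zero_iff, Real.norm_eq_abs] at hb
    have : |b * μ| ≤ ρ := by
      rw [abs_mul]
      calc |b| * |μ| ≤ ρ * 1 := mul_le_mul hb.le (abs_le.2 hμ) (abs_nonneg _) (by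
              linarith [abs_nonneg β])
        _ = ρ := mul_one _
    linarith [(abs_le.1 this).2]
  have := intervalIntegral.hasDerivAt_integral_of_dominated_loc_of_deriv_le
    (F := fun b μ : ℝ => μ ^ k / (1 - b * μ) ^ j)
    (F' := fun b μ : ℝ => j * (μ ^ (k + 1) / (1 - b * μ) ^ (j + 1)))
    (μ := volume) (a := -1) (b := 1) (x₀ := β) (s := Metric.ball 0 ρ)
    (bound := fun _ => j * (1 / (1 - ρ) ^ (j + 1))) hs ?_ (intervalIntegrable_mom k j hβ) ?_ ?_
    (by simp) ?_
  · have h3 := this.2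
    rw [intervalIntegral.integral_const_mul] at h3
    exact h3
  · filter_upwards [hs] with b hb
    rw [mem_ball_zero_iff, Real.norm_eq_abs] at hb
    exact (intervalIntegrable_mom k j (hb.trans h2)).def'.aestronglyMeasurable
  · exact ((intervalIntegrable_mom (k + 1) (j + 1) hβ).const_mul _).def'.aestronglyMeasurable
  · refine ae_of_all _ fun μ hμ b hb => ?_
    have hμ' : μ ∈ Icc (-1 : ℝ) 1 := uIcc_neg_one_one ▸ uIoc_subset_uIcc hμ
    have h3 := key b hb μ hμ'
    have h4 : 0 < 1 - ρ := by linarith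
    rw [norm_mul, norm_div, norm_pow, norm_pow, Real.norm_natCast, Real.norm_eq_abs,
      Real.norm_eq_abs, abs_of_pos (h4.trans_le h3)]
    gcongr
    exact pow_le_one₀ (abs_nonneg _) (abs_le.2 hμ')
  · refine ae_of_all _ fun μ hμ b hb => ?_
    have hμ' : μ ∈ Icc (-1 : ℝ) 1 := uIcc_neg_one_one ▸ uIoc_subset_uIcc hμ
    have h5 : (1 - b * μ) ≠ 0 := by have := key b hb μ hμ'; linarith
    have h6 : HasDerivAt (fun b : ℝ => 1 - b * μ) (-μ) b := by
      simpa using ((hasDerivAt_id b).mul_const μ).const_sub 1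
    have h7 := ((h6.pow j).inv (pow_ne_zero j h5)).const_mul (μ ^ k)
    simp only [div_eq_mul_inv]
    refine h7.congr_deriv ?_
    rcases j with _ | j
    · simp
    · simp only [Nat.add_sub_cancel, Pi.pow_apply]; field_simp
      ring

theorem contDiffOn_mom (n : ℕ) : ∀ k j : ℕ, ContDiffOn ℝ n (mom k j) (Ioo (-1) 1) := by
  induction n with
  | zero =>
    intro k j
    exact contDiffOn_zero.2 fun β hβ =>
      (hasDerivAt_mom k j (abs_lt.2 hβ)).continuousAt.continuousWithinAt
  | succ n ih =>
    intro k j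
    have : (((n + 1 : ℕ) : WithTop ℕ∞)) = (n : WithTop ℕ∞) + 1 := by norm_cast
    rw [this, contDiffOn_succ_iff_deriv_of_isOpen isOpen_Ioo]
    refine ⟨fun β hβ => (hasDerivAt_mom k j (abs_lt.2 hβ)).differentiableAt.differentiableWithinAt,
      by simp, ?_⟩
    exact (contDiffOn_const.mul (ih (k + 1) (j + 1))).congr
      fun β hβ => (hasDerivAt_mom k j (abs_lt.2 hβ)).deriv

theorem mom_zero_right (k : ℕ) (β : ℝ) : mom k 0 β = (1 - (-1) ^ (k + 1)) / (k + 1) := by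
  simp [mom]

theorem mom_at_zero (k j : ℕ) : mom k j 0 = (1 - (-1) ^ (k + 1)) / (k + 1) := by
  simp [mom]

theorem mom_zero_left_of_antideriv {j : ℕ} {β : ℝ} (hβ : |β| < 1) (G : ℝ → ℝ)
    (hG : ∀ μ ∈ Icc (-1 : ℝ) 1, HasDerivAt G (1 / (1 - β * μ) ^ j) μ) :
    mom 0 j β = G 1 - G (-1) := by
  rw [← intervalIntegral.integral_eq_sub_of_hasDerivAt (f' := fun μ => μ ^ 0 / (1 - β * μ) ^ j)
    (fun μ hμ => by simpa using hG μ (uIcc_neg_one_one ▸ hμ)) (intervalIntegrable_mom 0 j hβ)]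
  rfl

theorem hasDerivAt_one_sub_mul (β μ : ℝ) : HasDerivAt (fun μ : ℝ => 1 - β * μ) (-β) μ := by
  simpa using ((hasDerivAt_id μ).const_mul β).const_sub 1

theorem one_sub_pos_of_abs {β : ℝ} (hβ : |β| < 1) : 0 < 1 - β ∧ 0 < 1 + β ∧ 0 < 1 - β ^ 2 := by
  obtain ⟨h1, h2⟩ := abs_lt.1 hβ
  exact ⟨by linarith, by linarith, by nlinarith⟩

theorem mom_zero_two {β : ℝ} (hβ : |β| < 1) : mom 0 2 β = 2 / (1 - β ^ 2) := by
  obtain ⟨h1, h2, h3⟩ := one_sub_pos_of_abs hβ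
  rw [mom_zero_left_of_antideriv hβ (fun μ => μ / (1 - β * μ))]
  · rw [show 1 - β ^ 2 = (1 - β) * (1 + β) by ring]
    simp only [mul_one, mul_neg_one, sub_neg_eq_add]
    field_simp; ring
  · intro μ hμ
    have := (one_sub_mul_pos hβ hμ).ne'
    refine ((hasDerivAt_id μ).div (hasDerivAt_one_sub_mul β μ) this).congr_deriv ?_
    simp; field_simp; ring

theorem mom_zero_three {β : ℝ} (hβ : |β| < 1) : mom 0 3 β = 2 / (1 - β ^ 2) ^ 2 := by
  obtain ⟨h1, h2, h3⟩ := one_sub_pos_of_abs hβ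
  rw [mom_zero_left_of_antideriv hβ (fun μ => μ * (1 + (1 - β * μ)) / (2 * (1 - β * μ) ^ 2))]
  · rw [show 1 - β ^ 2 = (1 - β) * (1 + β) by ring]
    simp only [mul_one, mul_neg_one, sub_neg_eq_add]
    field_simp; ring
  · intro μ hμ
    have h := (one_sub_mul_pos hβ hμ).ne'
    have hd := hasDerivAt_one_sub_mul β μ
    refine (((hasDerivAt_id μ).mul (hd.const_add 1)).div ((hd.pow 2).const_mul 2)
      (mul_ne_zero two_ne_zero (pow_ne_zero 2 h))).congr_deriv ?_
    simp; field_simp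
    ring

theorem mom_zero_four {β : ℝ} (hβ : |β| < 1) :
    mom 0 4 β = 2 * (3 + β ^ 2) / (3 * (1 - β ^ 2) ^ 3) := by
  obtain ⟨h1, h2, h3⟩ := one_sub_pos_of_abs hβ
  rw [mom_zero_left_of_antideriv hβ
    (fun μ => μ * (1 + (1 - β * μ) + (1 - β * μ) ^ 2) / (3 * (1 - β * μ) ^ 3))]
  · rw [show 1 - β ^ 2 = (1 - β) * (1 + β) by ring]
    simp only [mul_one, mul_neg_one, sub_neg_eq_add]
    field_simp; ring
  · intro μ hμ
    have h := (one_sub_mul_pos hβ hμ).ne'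
    have hd := hasDerivAt_one_sub_mul β μ
    refine (((hasDerivAt_id μ).mul ((hd.const_add 1).add (hd.pow 2))).div
      ((hd.pow 3).const_mul 3) (mul_ne_zero three_ne_zero (pow_ne_zero 3 h))).congr_deriv ?_
    simp; field_simp
    ring

/-- `ℓ = artanh β / β`, as the integral `∫_{-1}^1 1 / (2 (1 - β μ)) dμ`. -/
noncomputable def ell (β : ℝ) : ℝ := mom 0 1 β / 2

theorem ell_eq_log {β : ℝ} (hβ : |β| < 1) (h0 : β ≠ 0) :
    ell β = Real.log ((1 + β) / (1 - β)) / (2 * β) := by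
  obtain ⟨h1, h2, h3⟩ := one_sub_pos_of_abs hβ
  rw [ell, mom_zero_left_of_antideriv hβ (fun μ => -Real.log (1 - β * μ) / β)]
  · rw [Real.log_div h2.ne' h1.ne', mul_one, mul_neg_one, sub_neg_eq_add]
    field_simp; ring
  · intro μ hμ
    have h := (one_sub_mul_pos hβ hμ).ne'
    refine ((((hasDerivAt_one_sub_mul β μ).log h).neg).div_const β).congr_deriv ?_
    field_simp

theorem hasDerivAt_ell {β : ℝ} (hβ : |β| < 1) (h0 : β ≠ 0) :
    HasDerivAt ell ((1 / (1 - β ^ 2) - ell β) / β) β := by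
  refine ((hasDerivAt_mom 0 1 hβ).div_const 2).congr_deriv ?_
  have := mul_mom_succ_succ 0 1 hβ
  rw [mom_zero_two hβ] at this
  rw [ell]
  rw [eq_div_iff h0]
  simp only [zero_add, Nat.reduceAdd] at this ⊢
  push_cast
  linear_combination (1 / 2 : ℝ) * this

/-- The normalization of the weight. -/
noncomputable def eps (β : ℝ) : ℝ := 3 * (1 - β ^ 2) ^ 3 / (2 * (3 + β ^ 2))

/-- The moments of the normalized weight with parameter `α = -β`. -/
noncomputable def wmom (k : ℕ) (β : ℝ) : ℝ := eps β * mom k 4 β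

theorem eps_pos {β : ℝ} (hβ : |β| < 1) : 0 < eps β := by
  have := (one_sub_pos_of_abs hβ).2.2
  unfold eps; positivity

theorem weight_neg (β μ : ℝ) : weight (-β) μ = eps β / (1 - β * μ) ^ 4 := by
  simp [weight, eps, sub_eq_add_neg]

theorem integral_pow_mul_weight (k : ℕ) (β : ℝ) :
    ∫ μ in (-1 : ℝ)..1, μ ^ k * weight (-β) μ = wmom k β := by
  rw [wmom, mom, ← intervalIntegral.integral_const_mul]
  congr 1; ext μ
  rw [weight_neg]; ring

theorem intervalIntegrable_pow_mul_weight (k : ℕ) {β : ℝ} (hβ : |β| < 1) :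
    IntervalIntegrable (fun μ => μ ^ k * weight (-β) μ) volume (-1) 1 := by
  refine ((intervalIntegrable_mom k 4 hβ).const_mul (eps β)).congr ?_
  intro μ _
  simp only [weight_neg]; ring

theorem integral_poly_mul_weight (c : ℕ → ℝ) (n : ℕ) {β : ℝ} (hβ : |β| < 1) {q : ℝ → ℝ}
    (hq : ∀ μ, q μ = ∑ k ∈ Finset.range n, c k * μ ^ k) :
    IntervalIntegrable (fun μ => q μ * weight (-β) μ) volume (-1) 1 ∧
    ∫ μ in (-1 : ℝ)..1, q μ * weight (-β) μ = ∑ k ∈ Finset.range n, c k * wmom k β := by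
  have e : (fun μ => q μ * weight (-β) μ) =
      fun μ => ∑ k ∈ Finset.range n, c k * (μ ^ k * weight (-β) μ) := by
    ext μ; rw [hq, Finset.sum_mul]; exact Finset.sum_congr rfl fun k _ => mul_assoc _ _ _
  have hi : ∀ k ∈ Finset.range n,
      IntervalIntegrable (fun μ => c k * (μ ^ k * weight (-β) μ)) volume (-1) 1 :=
    fun k _ => (intervalIntegrable_pow_mul_weight k hβ).const_mul _
  rw [e]
  refine ⟨?_, ?_⟩
  · have := IntervalIntegrable.sum _ hi
    refine this.congr ?_
    intro μ _
    simp
  · rw [intervalIntegral.integral_finsetSum hi]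
    refine Finset.sum_congr rfl fun k _ => ?_
    rw [intervalIntegral.integral_const_mul, integral_pow_mul_weight]

theorem wmom_neg (k : ℕ) (β : ℝ) : wmom k (-β) = (-1) ^ k * wmom k β := by
  rw [wmom, wmom, mom_neg, eps, eps, neg_sq]; ring

theorem contDiffOn_wmom (n k : ℕ) : ContDiffOn ℝ n (wmom k) (Ioo (-1) 1) := by
  refine ContDiffOn.mul ?_ (contDiffOn_mom n k 4)
  refine ContDiffOn.div (by fun_prop) (by fun_prop) ?_
  intro β _; positivity

end M1P

/-! ### The closure in terms of the moments of the weight -/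

open MeasureTheory Set Filter Topology

namespace M1P

theorem wmom_zero {β : ℝ} (hβ : |β| < 1) : wmom 0 β = 1 := by
  have := (one_sub_pos_of_abs hβ).2.2
  rw [wmom, eps, mom_zero_four hβ]
  field_simp

/-- The first moment of the normalized weight, which is the ratio `E₁ / E₀`. -/
noncomputable def eRatio (β : ℝ) : ℝ := 4 * β / (3 + β ^ 2)

theorem wmom_one {β : ℝ} (hβ : |β| < 1) : wmom 1 β = eRatio β := by
  rcases eq_or_ne β 0 with rfl | h0
  · simp [wmom, mom_at_zero, eRatio]
  have := (one_sub_pos_of_abs hβ).2.2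
  have h := mul_mom_succ_succ 0 3 hβ
  rw [mom_zero_four hβ, mom_zero_three hβ] at h
  rw [← mul_right_inj' h0, wmom, mul_left_comm, h, eps, eRatio]
  field_simp; ring

/-- `⟨μ, φ₁⟩` for the weight with parameter `-β`. -/
noncomputable def gram1 (β : ℝ) : ℝ := wmom 2 β - wmom 1 β ^ 2
/-- `⟨μ ^ 2, φ₁⟩` for the weight with parameter `-β`. -/
noncomputable def gram21 (β : ℝ) : ℝ := wmom 3 β - wmom 1 β * wmom 2 β
/-- `⟨μ ^ 2, φ₂⟩` for the weight with parameter `-β`. -/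
noncomputable def gram2 (β : ℝ) : ℝ :=
  wmom 4 β - gram21 β / gram1 β * gram21 β - wmom 2 β ^ 2
/-- `⟨μ ^ 3, φ₂⟩` for the weight with parameter `-β`. -/
noncomputable def gram32 (β : ℝ) : ℝ :=
  wmom 5 β - gram21 β / gram1 β * (wmom 4 β - wmom 1 β * wmom 3 β) - wmom 2 β * wmom 3 β

/-- The coefficient of `E₂` in `E₃`. -/
noncomputable def coefB (β : ℝ) : ℝ := gram32 β / gram2 β
/-- The coefficient of `E₀` in `E₃`. -/
noncomputable def coefG (β : ℝ) : ℝ := wmom 3 β - wmom 2 β * coefB β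

theorem orthPoly_zero (α : ℝ) : orthPoly α 0 = fun _ => 1 := by
  ext μ; rw [orthPoly]; simp

theorem coeffA_zero (i : ℕ) (β : ℝ) : coeffA (-β) i 0 = wmom i β := by
  rw [coeffA, orthPoly_zero, ← integral_pow_mul_weight]; simp

theorem orthPoly_one {β : ℝ} (hβ : |β| < 1) : orthPoly (-β) 1 = fun μ => μ - wmom 1 β := by
  ext μ; rw [orthPoly]
  have h0 := wmom_zero hβ
  rw [← integral_pow_mul_weight] at h0
  simp [orthPoly_zero, ← integral_pow_mul_weight] at h0 ⊢
  rw [h0, div_one]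

theorem coeffA_one (i : ℕ) {β : ℝ} (hβ : |β| < 1) :
    coeffA (-β) i 1 = wmom (i + 1) β - wmom 1 β * wmom i β := by
  rw [coeffA, orthPoly_one hβ, ← integral_pow_mul_weight (i + 1), ← integral_pow_mul_weight i,
    ← intervalIntegral.integral_const_mul, ← intervalIntegral.integral_sub
      (intervalIntegrable_pow_mul_weight _ hβ)
      ((intervalIntegrable_pow_mul_weight _ hβ).const_mul _)]
  congr 1; ext μ; ring

theorem orthPoly_two {β : ℝ} (hβ : |β| < 1) : orthPoly (-β) 2 =
    fun μ => μ ^ 2 - gram21 β / gram1 β * (μ - wmom 1 β) - wmom 2 β := by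
  ext μ
  have h := fun i j => (rfl : coeffA (-β) i j = _)
  simp only at h
  rw [orthPoly, Fin.sum_univ_two]
  have e0 : ∀ i : ℕ, (∫ ν in (-1 : ℝ)..1, ν ^ i * orthPoly (-β) ((0 : Fin 2) : ℕ) ν * weight (-β) ν)
      = wmom i β := fun i => coeffA_zero i β
  have e1 : ∀ i : ℕ, (∫ ν in (-1 : ℝ)..1, ν ^ i * orthPoly (-β) ((1 : Fin 2) : ℕ) ν * weight (-β) ν)
      = wmom (i + 1) β - wmom 1 β * wmom i β := fun i => coeffA_one i hβ
  rw [e0, e0, e1, e1]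
  simp only [Fin.val_zero, Fin.val_one, wmom_zero hβ, orthPoly_zero, orthPoly_one hβ, gram21, gram1]
  ring

theorem coeffA_two (i : ℕ) {β : ℝ} (hβ : |β| < 1) :
    coeffA (-β) i 2 = wmom (i + 2) β - gram21 β / gram1 β * (wmom (i + 1) β - wmom 1 β * wmom i β)
      - wmom 2 β * wmom i β := by
  rw [← coeffA_one i hβ, coeffA, coeffA, orthPoly_two hβ, orthPoly_one hβ,
    ← integral_pow_mul_weight (i + 2), ← integral_pow_mul_weight i,
    ← intervalIntegral.integral_const_mul, ← intervalIntegral.integral_const_mul,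
    ← intervalIntegral.integral_sub, ← intervalIntegral.integral_sub]
  · congr 1; ext μ; ring
  · refine (intervalIntegrable_pow_mul_weight _ hβ).sub (IntervalIntegrable.const_mul ?_ _)
    refine ((intervalIntegrable_pow_mul_weight (i + 1) hβ).sub
      ((intervalIntegrable_pow_mul_weight i hβ).const_mul (wmom 1 β))).congr ?_
    intro μ _; simp only; ring
  · exact (intervalIntegrable_pow_mul_weight _ hβ).const_mul _
  · exact intervalIntegrable_pow_mul_weight _ hβ
  · refine IntervalIntegrable.const_mul ?_ _
    refine ((intervalIntegrable_pow_mul_weight (i + 1) hβ).sub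
      ((intervalIntegrable_pow_mul_weight i hβ).const_mul (wmom 1 β))).congr ?_
    intro μ _; simp only; ring

/-- The closure is affine in `(E₀, E₂)` for fixed `β`: as `wmom 1 β = E₁ / E₀`, the expansion
coefficient `f₁` vanishes. -/
theorem closureE3_eq {U : Fin 3 → ℝ} {β : ℝ} (hβ : |β| < 1)
    (hα : alphaM1 (U 0) (U 1) = -β) (hE : U 1 = U 0 * eRatio β) : closureE3 U = U 0 * coefG β + U 2 * coefB β := by
  have k0 := fun i => coeffA_zero i β
  have k1 := fun i => coeffA_one i hβ
  have k2 := fun i => coeffA_two i hβ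
  have m0 := wmom_zero hβ
  have m1 := wmom_one hβ
  have g1 : coeffA (-β) 1 1 = gram1 β := by rw [k1, gram1]; ring
  have g2 : coeffA (-β) 2 2 = gram2 β := by rw [k2, gram2, gram21]; ring
  have g3 : coeffA (-β) 3 2 = gram32 β := by rw [k2, gram32]
  set E : ℕ → ℝ := fun i => if h : i < 3 then U ⟨i, h⟩ else 0 with hEdef
  have E0 : E 0 = U 0 := rfl
  have E1 : E 1 = U 1 := rfl
  have E2 : E 2 = U 2 := rfl
  have f0 : coeffF (-β) E 0 = U 0 := by rw [coeffF]; simp [k0, m0, E0]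
  have f1 : coeffF (-β) E 1 = 0 := by
    rw [coeffF]; simp [k0, E1, f0, hE, m1]; left; ring
  have f2 : coeffF (-β) E 2 = (U 2 - wmom 2 β * U 0) / gram2 β := by
    rw [coeffF, Fin.sum_univ_two, g2]; simp [k0, E2, f0, f1]
  rw [closureE3, closure, moment]
  have hint : ∀ i j, IntervalIntegrable
      (fun μ => μ ^ i * orthPoly (-β) j μ * weight (-β) μ) volume (-1) 1 → IntervalIntegrable
      (fun μ => coeffF (-β) E j * (μ ^ i * orthPoly (-β) j μ * weight (-β) μ)) volume (-1) 1 :=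
    fun i j h => h.const_mul _
  have e : ∀ μ : ℝ, μ ^ (2 + 1) * ansatz 2 E μ =
      U 0 * (μ ^ 3 * weight (-β) μ) +
        coeffF (-β) E 2 * (μ ^ 3 * orthPoly (-β) 2 μ * weight (-β) μ) := by
    intro μ
    simp only [ansatz, E0, E1, hα, Finset.sum_range_succ, Finset.sum_range_zero, f0, f1,
      orthPoly_zero]
    ring
  rw [intervalIntegral.integral_congr fun μ _ => e μ]
  have i3 : IntervalIntegrable (fun μ => μ ^ 3 * orthPoly (-β) 2 μ * weight (-β) μ)
      volume (-1) 1 := by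
    refine (((intervalIntegrable_pow_mul_weight 5 hβ).sub
      ((intervalIntegrable_pow_mul_weight 4 hβ).const_mul (gram21 β / gram1 β))).add
      ((intervalIntegrable_pow_mul_weight 3 hβ).const_mul
        (gram21 β / gram1 β * wmom 1 β - wmom 2 β))).congr ?_
    intro μ _; simp only [orthPoly_two hβ]; ring
  rw [intervalIntegral.integral_add ((intervalIntegrable_pow_mul_weight 3 hβ).const_mul _)
    (i3.const_mul _), intervalIntegral.integral_const_mul, intervalIntegral.integral_const_mul,
    integral_pow_mul_weight]
  change U 0 * wmom 3 β + coeffF (-β) E 2 * coeffA (-β) 3 2 = _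
  rw [g3, f2, coefG, coefB]
  field_simp; ring

theorem weight_pos {β μ : ℝ} (hβ : |β| < 1) (hμ : μ ∈ Icc (-1 : ℝ) 1) : 0 < weight (-β) μ := by
  rw [weight_neg]
  have := one_sub_mul_pos hβ hμ
  have := eps_pos hβ
  positivity

theorem weight_continuousOn {β : ℝ} (hβ : |β| < 1) :
    ContinuousOn (weight (-β)) (Icc (-1) 1) := by
  have : weight (-β) = fun μ => eps β / (1 - β * μ) ^ 4 := by ext; exact weight_neg _ _
  rw [this]
  exact continuousOn_const.div (by fun_prop) fun μ hμ => (pow_pos (one_sub_mul_pos hβ hμ) 4).ne'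

theorem integral_sq_mul_weight_pos {β : ℝ} (hβ : |β| < 1) {q : ℝ → ℝ} (hq : Continuous q)
    {μ₀ : ℝ} (hμ₀ : μ₀ ∈ Icc (-1 : ℝ) 1) (h0 : q μ₀ ≠ 0) :
    0 < ∫ μ in (-1 : ℝ)..1, q μ ^ 2 * weight (-β) μ := by
  refine intervalIntegral.integral_pos (by norm_num)
    ((hq.pow 2).continuousOn.mul (weight_continuousOn hβ)) (fun μ hμ => ?_) ⟨μ₀, hμ₀, ?_⟩
  · exact mul_nonneg (sq_nonneg _) (weight_pos hβ (Ioc_subset_Icc_self hμ)).le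
  · exact mul_pos (by positivity) (weight_pos hβ hμ₀)

theorem gram1_pos {β : ℝ} (hβ : |β| < 1) : 0 < gram1 β := by
  have hc : Continuous fun μ : ℝ => μ - wmom 1 β := by fun_prop
  have hne : ∃ μ ∈ Icc (-1 : ℝ) 1, μ - wmom 1 β ≠ 0 := by
    by_contra! h
    have h1 := h 1 (by simp)
    have h2 := h (-1) (by simp)
    linarith
  obtain ⟨μ₀, hm, h0⟩ := hne
  have h := integral_sq_mul_weight_pos hβ hc hm h0
  rw [(integral_poly_mul_weight
    (fun k => if k = 0 then wmom 1 β ^ 2 else if k = 1 then -2 * wmom 1 β else 1) 3 hβ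
    (q := fun μ => (μ - wmom 1 β) ^ 2) (by
      intro μ; simp [Finset.sum_range_succ]; ring)).2] at h
  simp [Finset.sum_range_succ, wmom_zero hβ] at h
  rw [gram1]; linarith

theorem gram2_pos {β : ℝ} (hβ : |β| < 1) : 0 < gram2 β := by
  obtain ⟨κ, hκ⟩ : ∃ κ, κ = gram21 β / gram1 β := ⟨_, rfl⟩
  have hκ' : κ * gram1 β = gram21 β := by
    rw [hκ, div_mul_cancel₀ _ (gram1_pos hβ).ne']
  obtain ⟨d, hd⟩ : ∃ d, d = κ * wmom 1 β - wmom 2 β := ⟨_, rfl⟩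
  have hc : Continuous fun μ : ℝ => μ ^ 2 - κ * μ + d := by fun_prop
  have hne : ∃ μ ∈ Icc (-1 : ℝ) 1, μ ^ 2 - κ * μ + d ≠ 0 := by
    by_contra! h
    have h1 := h 1 (by simp)
    have h2 := h (-1) (by simp)
    have h3 := h 0 (by simp)
    linarith
  obtain ⟨μ₀, hm, h0⟩ := hne
  have h := integral_sq_mul_weight_pos hβ hc hm h0
  rw [(integral_poly_mul_weight
    (fun k => if k = 0 then d ^ 2 else if k = 1 then -2 * κ * d else
      if k = 2 then κ ^ 2 + 2 * d else if k = 3 then -2 * κ else 1) 5 hβ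
    (q := fun μ => (μ ^ 2 - κ * μ + d) ^ 2) (by
      intro μ; simp [Finset.sum_range_succ]; ring)).2] at h
  simp [Finset.sum_range_succ, wmom_zero hβ] at h
  rw [gram2, ← hκ, ← hκ']
  rw [gram1, gram21] at hκ'
  rw [gram1]
  rw [hd] at h
  have := congrArg (κ * ·) hκ'
  linarith

end M1P

/-! ### Closed forms in the variables `y = 1 - β ^ 2` and `p` -/

open MeasureTheory Set Filter Topology

namespace M1P

/-- The numerator of `a = 3 e - b`. -/
noncomputable def nA (y p : ℝ) : ℝ := 4 - 10 * y + p * (-4 + 1 * y + p * (9))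
/-- A factor of the numerator of `b'`. -/
noncomputable def nB1 (y p : ℝ) : ℝ := -3 / 2 * y + p * (1 / 2 + p * (1))
/-- The numerator of `b''`. -/
noncomputable def nB2 (y p : ℝ) : ℝ := -6 * y ^ 3 - 3 / 2 * y ^ 4 + 3 / 4 * y ^ 5 + p * (4 * y ^ 2
    + 16 * y ^ 3 + 10 * y ^ 4 - 15 / 8 * y ^ 5
    + p * (-17 * y ^ 2 - 13 / 2 * y ^ 3 - 37 / 8 * y ^ 4
    + p * (12 * y - 11 * y ^ 2 - 14 * y ^ 3 + 7 / 4 * y ^ 4 + p * (-4 + 11 * y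
    + 23 / 4 * y ^ 2 + 39 / 4 * y ^ 3 + p * (-4 + 2 * y + 7 / 2 * y ^ 2 - 3 / 8 * y ^ 3
    + p * (-1 - 1 / 4 * y - 35 / 8 * y ^ 2))))))
/-- A factor of the numerator of `c`. -/
noncomputable def nC (y p : ℝ) : ℝ := -24 * y + 48 * y ^ 2 - 6 * y ^ 3 + p * (60 * y - 6 * y ^ 2
    + p * (-30 * y + 3 * y ^ 2 + p * (-48 + 3 * y)))
/-- A factor of the numerator of `c'`. -/
noncomputable def nC1 (y p : ℝ) : ℝ := 96 * y ^ 2 - 204 * y ^ 3 + 174 * y ^ 4 - 12 * y ^ 5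
    + p * (-480 * y ^ 2 + 378 * y ^ 3 - 36 * y ^ 4 + 3 * y ^ 5 + p * (-48 * y
    + 288 * y ^ 2 - 297 * y ^ 3 + 33 / 2 * y ^ 4 + p * (696 * y - 516 * y ^ 2
    + 21 / 2 * y ^ 3 - 3 / 2 * y ^ 4 + p * (-108 * y + 126 * y ^ 2 - 9 / 2 * y ^ 3
    + p * (-288 + 198 * y + 9 * y ^ 2)))))
/-- The numerator of `c''`. -/
noncomputable def nC2 (y p : ℝ) : ℝ := -384 * y ^ 3 - 576 * y ^ 4 - 1200 * y ^ 5
    + 1356 * y ^ 6 - 279 * y ^ 7 + 231 / 2 * y ^ 8 - 9 / 2 * y ^ 9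
    + p * (5184 * y ^ 3 - 4608 * y ^ 4 + 1440 * y ^ 5 - 270 * y ^ 6 + 387 / 2 * y ^ 7
    + 9 / 2 * y ^ 8 + p * (-576 * y ^ 3 + 4848 * y ^ 4 - 3246 * y ^ 5
    + 261 * y ^ 6 - 915 / 4 * y ^ 7 + 39 / 8 * y ^ 8 + p * (-9600 * y ^ 2
    + 9408 * y ^ 3 - 3192 * y ^ 4 + 825 * y ^ 5 - 1239 / 2 * y ^ 6 - 87 / 8 * y ^ 7
    + p * (864 * y ^ 2 - 4608 * y ^ 3 + 2682 * y ^ 4 - 81 / 2 * y ^ 5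
    + 387 / 2 * y ^ 6 - 9 / 4 * y ^ 7 + p * (7680 * y - 7248 * y ^ 2
    + 2016 * y ^ 3 - 561 * y ^ 4 + 2361 / 4 * y ^ 5 + 27 / 2 * y ^ 6 + p * (-192 * y
    + 1368 * y ^ 2 - 762 * y ^ 3 - 39 / 2 * y ^ 4 - 243 / 4 * y ^ 5 + 3 / 8 * y ^ 6
    + p * (-2304 + 2016 * y - 396 * y ^ 2 + 117 * y ^ 3 - 747 / 4 * y ^ 4 - 45 / 8 * y ^ 5)))))))

/-- `β b`, where `b` is the coefficient of `E₂` in the closure. Primes denote derivatives in `e =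
4 β / (3 + β ^ 2)`. -/
noncomputable def fB (y p : ℝ) : ℝ := (2 * y + y * p - 3 * p ^ 2) / (y - p ^ 2)
/-- The derivative `b'`. -/
noncomputable def fB1 (y p : ℝ) : ℝ :=
  (4 - y) ^ 2 * (1 - p) * p * nB1 y p / ((y - p ^ 2) ^ 2 * (2 + y) * (1 - y))
/-- `β b''`. -/
noncomputable def fB2 (y p : ℝ) : ℝ :=
  (4 - y) ^ 3 * nB2 y p / (y * (2 + y) ^ 3 * (y - p ^ 2) ^ 3 * (1 - y))
/-- `β c`, where `c` is the constant coefficient of the characteristic polynomial in `s = λ - e`.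
-/
noncomputable def fC (y p : ℝ) : ℝ := y ^ 2 * nC y p / ((4 - y) ^ 3 * (y - p ^ 2) * (2 + p))
/-- The derivative `c'`. -/
noncomputable def fC1 (y p : ℝ) : ℝ :=
  y * nC1 y p / ((4 - y) ^ 2 * (y - p ^ 2) ^ 2 * (2 + p) * (2 + y) * (1 - y))
/-- `β c''`. -/
noncomputable def fC2 (y p : ℝ) : ℝ :=
  nC2 y p / ((4 - y) * (2 + p) * (y - p ^ 2) ^ 3 * (2 + y) ^ 3 * (1 - y))

/-- `Y` and `P` follow the equations `β y' = - 2 (1 - y)` and `β p' = (2 + p) (y - p) / y` at `β`,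
and no denominator vanishes there. -/
structure Flow (Y P : ℝ → ℝ) (β : ℝ) : Prop where
  hy : HasDerivAt Y (-2 * (1 - Y β) / β) β
  hp : HasDerivAt P ((2 + P β) * (Y β - P β) / (Y β * β)) β
  sq : β ^ 2 = 1 - Y β
  pos : 0 < β
  y_pos : 0 < Y β
  y_lt : Y β < 1
  p_pos : 0 < 2 + P β
  H_pos : 0 < Y β - P β ^ 2

section
variable {Y P : ℝ → ℝ} {β : ℝ}

theorem Flow.ne (h : Flow Y P β) : β ≠ 0 ∧ Y β ≠ 0 ∧ 1 - Y β ≠ 0 ∧ 2 + Y β ≠ 0 ∧ 4 - Y β ≠ 0 ∧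
    2 + P β ≠ 0 ∧ Y β - P β ^ 2 ≠ 0 := by
  obtain ⟨_, _, _, h1, h2, h3, h4, h5⟩ := h
  refine ⟨?_, ?_, ?_, ?_, ?_, ?_, ?_⟩ <;> linarith

theorem Flow.hasDerivAt_fB_aux (h : Flow Y P β) :
    HasDerivAt (fun b => fB (Y b) (P b)) ((fB (Y β) (P β) +
      (1 - Y β) * (4 * (2 + Y β) / (4 - Y β) ^ 2 * fB1 (Y β) (P β))) / β) β := by
  obtain ⟨h0, h1, h2, h3, h4, h5, h6⟩ := h.ne
  have hy := h.hy
  have hp := h.hp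
  have hb := hasDerivAt_id' β
  have hs := h.sq
  unfold fB fB1 nB1
  refine HasDerivAt.congr_deriv (by
    apply HasDerivAt.fun_div
    repeat' first
      | exact hy | exact hb | exact hp | exact hasDerivAt_const _ _ | apply HasDerivAt.fun_pow
      | apply HasDerivAt.fun_sub | apply HasDerivAt.fun_add | apply HasDerivAt.fun_mul
      | apply HasDerivAt.fun_neg
    positivity) ?_
  generalize Y β = y at *
  generalize P β = p at *
  field_simp
  ring

/-- The factor `4 (2 + y) / (4 - y) ^ 2` is `de / dβ`, so that `fB1` is the derivative of `fB / β`
with respect to `e`. The same holds for the lemmas on `fC`, `fB1` and `fC1`. -/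
theorem Flow.hasDerivAt_fB (h : Flow Y P β) :
    HasDerivAt (fun b => fB (Y b) (P b) / b)
      (4 * (2 + Y β) / (4 - Y β) ^ 2 * fB1 (Y β) (P β)) β := by
  obtain ⟨h0, h1, h2, h3, h4, h5, h6⟩ := h.ne
  refine (h.hasDerivAt_fB_aux.fun_div (hasDerivAt_id' β) h0).congr_deriv ?_
  rw [div_mul_cancel₀ _ h0, mul_one, h.sq, add_sub_cancel_left, mul_div_cancel_left₀ _ h2]

theorem Flow.hasDerivAt_fC_aux (h : Flow Y P β) :
    HasDerivAt (fun b => fC (Y b) (P b)) ((fC (Y β) (P β) +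
      (1 - Y β) * (4 * (2 + Y β) / (4 - Y β) ^ 2 * fC1 (Y β) (P β))) / β) β := by
  obtain ⟨h0, h1, h2, h3, h4, h5, h6⟩ := h.ne
  have hy := h.hy
  have hp := h.hp
  have hb := hasDerivAt_id' β
  have hs := h.sq
  unfold fC fC1 nC nC1
  refine HasDerivAt.congr_deriv (by
    apply HasDerivAt.fun_div
    repeat' first
      | exact hy | exact hb | exact hp | exact hasDerivAt_const _ _ | apply HasDerivAt.fun_pow
      | apply HasDerivAt.fun_sub | apply HasDerivAt.fun_add | apply HasDerivAt.fun_mul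
      | apply HasDerivAt.fun_neg
    positivity) ?_
  generalize Y β = y at *
  generalize P β = p at *
  field_simp
  ring

theorem Flow.hasDerivAt_fC (h : Flow Y P β) :
    HasDerivAt (fun b => fC (Y b) (P b) / b)
      (4 * (2 + Y β) / (4 - Y β) ^ 2 * fC1 (Y β) (P β)) β := by
  obtain ⟨h0, h1, h2, h3, h4, h5, h6⟩ := h.ne
  refine (h.hasDerivAt_fC_aux.fun_div (hasDerivAt_id' β) h0).congr_deriv ?_
  rw [div_mul_cancel₀ _ h0, mul_one, h.sq, add_sub_cancel_left, mul_div_cancel_left₀ _ h2]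

theorem Flow.hasDerivAt_fB1 (h : Flow Y P β) :
    HasDerivAt (fun b => fB1 (Y b) (P b)) (4 * (2 + Y β) / (4 - Y β) ^ 2 * (fB2 (Y β) (P β) / β)) β := by
  obtain ⟨h0, h1, h2, h3, h4, h5, h6⟩ := h.ne
  have hy := h.hy
  have hp := h.hp
  have hb := hasDerivAt_id' β
  have hs := h.sq
  unfold fB1 fB2 nB1 nB2
  refine HasDerivAt.congr_deriv (by
    apply HasDerivAt.fun_div
    repeat' first
      | exact hy | exact hb | exact hp | exact hasDerivAt_const _ _ | apply HasDerivAt.fun_pow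
      | apply HasDerivAt.fun_sub | apply HasDerivAt.fun_add | apply HasDerivAt.fun_mul
      | apply HasDerivAt.fun_neg
    positivity) ?_
  generalize Y β = y at *
  generalize P β = p at *
  field_simp
  ring

theorem Flow.hasDerivAt_fC1 (h : Flow Y P β) :
    HasDerivAt (fun b => fC1 (Y b) (P b)) (4 * (2 + Y β) / (4 - Y β) ^ 2 * (fC2 (Y β) (P β) / β)) β := by
  obtain ⟨h0, h1, h2, h3, h4, h5, h6⟩ := h.ne
  have hy := h.hy
  have hp := h.hp
  have hb := hasDerivAt_id' β
  have hs := h.sq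
  unfold fC1 fC2 nC1 nC2
  refine HasDerivAt.congr_deriv (by
    apply HasDerivAt.fun_div
    repeat' first
      | exact hy | exact hb | exact hp | exact hasDerivAt_const _ _ | apply HasDerivAt.fun_pow
      | apply HasDerivAt.fun_sub | apply HasDerivAt.fun_add | apply HasDerivAt.fun_mul
      | apply HasDerivAt.fun_neg
    positivity) ?_
  generalize Y β = y at *
  generalize P β = p at *
  field_simp
  ring

end
end M1P

/-! ### The closure in closed form -/

open MeasureTheory Set Filter Topology

namespace M1P

/-- `y = 1 - β ^ 2`. -/
noncomputable def yF (β : ℝ) : ℝ := 1 - β ^ 2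
/-- The variable `p = 2 y (ℓ - 1) / (1 - y ℓ)`, in which the closure becomes rational. -/
noncomputable def pF (β : ℝ) : ℝ := 2 * yF β * (ell β - 1) / (1 - yF β * ell β)

theorem abs_lt_one_of_Ioo {β : ℝ} (h : β ∈ Ioo (0 : ℝ) 1) : |β| < 1 := by
  rw [abs_of_pos h.1]; exact h.2

theorem hasDerivAt_mul_ell {β : ℝ} (h : β ∈ Ioo (0 : ℝ) 1) :
    HasDerivAt (fun b => b * ell b) (1 / (1 - β ^ 2)) β := by
  refine ((hasDerivAt_id' β).mul (hasDerivAt_ell (abs_lt_one_of_Ioo h) h.1.ne')).congr_deriv ?_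
  have := h.1.ne'
  field_simp; ring

theorem continuousAt_ell {β : ℝ} (h : |β| < 1) : ContinuousAt ell β :=
  (hasDerivAt_mom 0 1 h).continuousAt.div_const 2

/-- A differentiable function on `[0, 1)` that vanishes at `0` and has a positive derivative is
positive. -/
theorem pos_of_deriv_pos {f f' : ℝ → ℝ} (h0 : f 0 = 0) (hc : ContinuousAt f 0) {c : ℝ}
    (hf : ∀ b ∈ Ioc (0 : ℝ) c, HasDerivAt f (f' b) b) (hpos : ∀ b ∈ Ioo (0 : ℝ) c, 0 < f' b)
    (hc0 : 0 < c) : 0 < f c := by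
  have hcont : ContinuousOn f (Icc 0 c) := by
    intro b hb
    rcases eq_or_lt_of_le hb.1 with rfl | h
    · exact hc.continuousWithinAt
    · exact (hf b ⟨h, hb.2⟩).continuousAt.continuousWithinAt
  have := strictMonoOn_of_deriv_pos (convex_Icc 0 c) hcont (by
    intro b hb
    rw [interior_Icc] at hb
    rw [(hf b ⟨hb.1, hb.2.le⟩).deriv]
    exact hpos b hb)
  have h := this (left_mem_Icc.2 hc0.le) (right_mem_Icc.2 hc0.le) hc0
  rwa [h0] at h

theorem one_lt_ell {β : ℝ} (h : β ∈ Ioo (0 : ℝ) 1) : 1 < ell β := by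
  have := pos_of_deriv_pos (f := fun b => b * ell b - b) (f' := fun b => 1 / (1 - b ^ 2) - 1)
    (c := β) (by simp)
    ((continuousAt_id.mul (continuousAt_ell (by simp))).sub continuousAt_id)
    (fun b hb => (hasDerivAt_mul_ell ⟨hb.1, hb.2.trans_lt h.2⟩).sub (hasDerivAt_id' b))
    (fun b hb => by
      have h1 : 0 < 1 - b ^ 2 := by nlinarith [hb.1, hb.2, h.2]
      have : 0 < b := hb.1
      rw [div_sub_one h1.ne']
      have : 0 < 1 - (1 - b ^ 2) := by nlinarith
      positivity) h.1
  nlinarith [h.1]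

theorem mul_ell_lt_one {β : ℝ} (h : β ∈ Ioo (0 : ℝ) 1) : yF β * ell β < 1 := by
  have := pos_of_deriv_pos (f := fun b => b / (1 - b ^ 2) - b * ell b)
    (f' := fun b => (1 * (1 - b ^ 2) - b * (-(2 * b))) / (1 - b ^ 2) ^ 2 - 1 / (1 - b ^ 2))
    (c := β) (by simp)
    ((continuousAt_id.div (by fun_prop) (by simp)).sub
      (continuousAt_id.mul (continuousAt_ell (by simp))))
    (fun b hb => by
      have h1 : 0 < 1 - b ^ 2 := by nlinarith [hb.1, hb.2, h.2]
      refine HasDerivAt.fun_sub (HasDerivAt.fun_div (hasDerivAt_id' b) ?_ h1.ne')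
        (hasDerivAt_mul_ell ⟨hb.1, hb.2.trans_lt h.2⟩)
      simpa using ((hasDerivAt_id' b).fun_pow 2).const_sub 1)
    (fun b hb => by
      have h1 : 0 < 1 - b ^ 2 := by nlinarith [hb.1, hb.2, h.2]
      have : 0 < b := hb.1
      have e : (1 * (1 - b ^ 2) - b * (-(2 * b))) / (1 - b ^ 2) ^ 2 - 1 / (1 - b ^ 2)
          = 2 * b ^ 2 / (1 - b ^ 2) ^ 2 := by field_simp; ring
      rw [e]; positivity) h.1
  have h1 : 0 < 1 - β ^ 2 := by nlinarith [h.1, h.2]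
  have h2 : β * ell β < β / (1 - β ^ 2) := by linarith
  rw [lt_div_iff₀ h1] at h2
  rw [yF]
  nlinarith [h.1]

theorem two_add_pF {β : ℝ} (h : β ∈ Ioo (0 : ℝ) 1) :
    2 + pF β = 2 * (1 - yF β) / (1 - yF β * ell β) := by
  have := mul_ell_lt_one h
  rw [pF]
  have : 1 - yF β * ell β ≠ 0 := by linarith
  field_simp; ring

theorem yF_mem {β : ℝ} (h : β ∈ Ioo (0 : ℝ) 1) : yF β ∈ Ioo (0 : ℝ) 1 := by
  rw [yF]; constructor <;> nlinarith [h.1, h.2]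

theorem pF_pos {β : ℝ} (h : β ∈ Ioo (0 : ℝ) 1) : 0 < pF β := by
  have h1 := one_lt_ell h
  have h2 := mul_ell_lt_one h
  have h3 := (yF_mem h).1
  rw [pF]
  exact div_pos (mul_pos (by linarith) (by linarith)) (by linarith)

/-- The inverse of the definition of `p`. -/
theorem ell_eq {β : ℝ} (h : β ∈ Ioo (0 : ℝ) 1) :
    ell β = (pF β + 2 * yF β) / (yF β * (2 + pF β)) := by
  have h2 := mul_ell_lt_one h
  have h3 := (yF_mem h).1
  have h4 := pF_pos h
  have h5 : 1 - yF β * ell β ≠ 0 := by linarith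
  have h6 : pF β * (1 - yF β * ell β) = 2 * yF β * (ell β - 1) := by
    rw [pF, div_mul_cancel₀ _ h5]
  rw [eq_div_iff (by positivity)]
  linear_combination -h6

theorem mom_closed {β : ℝ} (h : β ∈ Ioo (0 : ℝ) 1) :
    β ^ 2 * wmom 2 β = (1 - yF β) * (4 - 3 * yF β) / (4 - yF β) ∧
    β ^ 3 * wmom 3 β = (1 - yF β) * (8 - 12 * yF β + 6 * yF β ^ 2 + 4 * pF β - 6 * yF β * pF β) /
      ((4 - yF β) * (2 + pF β)) ∧
    β ^ 4 * wmom 4 β = 1 - 12 * yF β / (4 - yF β) + 18 * yF β ^ 2 / (4 - yF β)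
      - 12 * yF β ^ 2 * (pF β + 2 * yF β) / ((4 - yF β) * (2 + pF β))
      + 3 * yF β ^ 3 / (4 - yF β) ∧
    β ^ 5 * wmom 5 β = 1 - 15 * yF β / (4 - yF β) + 30 * yF β ^ 2 / (4 - yF β)
      - 30 * yF β ^ 2 * (pF β + 2 * yF β) / ((4 - yF β) * (2 + pF β))
      + 12 * yF β ^ 3 / (4 - yF β) := by
  have hβ := abs_lt_one_of_Ioo h
  have r := fun k j => mul_mom_succ_succ k j hβ
  obtain ⟨hy0, hy1⟩ := yF_mem h
  have hp := pF_pos h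
  have e4 := mom_zero_four hβ
  have e3 := mom_zero_three hβ
  have e2 := mom_zero_two hβ
  have e1 : mom 0 1 β = 2 * ((pF β + 2 * yF β) / (yF β * (2 + pF β))) := by
    rw [← ell_eq h, ell]; ring
  have e0 : mom 0 0 β = 2 := by norm_num [mom_zero_right]
  have e01 : mom 1 0 β = 0 := by norm_num [mom_zero_right]
  have r14 := r 0 3; have r13 := r 0 2; have r12 := r 0 1; have r11 := r 0 0
  have r24 := r 1 3; have r23 := r 1 2; have r22 := r 1 1; have r21 := r 1 0
  have r34 := r 2 3; have r33 := r 2 2; have r32 := r 2 1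
  have r44 := r 3 3; have r43 := r 3 2; have r54 := r 4 3
  simp only [zero_add, Nat.reduceAdd] at *
  have hx : β ^ 2 = 1 - yF β := by rw [yF]; ring
  rw [hx, sub_sub_cancel, show 3 + (1 - yF β) = 4 - yF β by ring] at e4
  rw [hx, sub_sub_cancel] at e3 e2
  have hε : eps β = 3 * yF β ^ 3 / (2 * (4 - yF β)) := by
    rw [eps, hx]; congr 1 <;> ring
  have i2 : β ^ 2 * mom 2 4 β = mom 0 4 β - 2 * mom 0 3 β + mom 0 2 β := by
    linear_combination β * r24 + r14 - r13
  have i3 : β ^ 3 * mom 3 4 β = mom 0 4 β - 3 * mom 0 3 β + 3 * mom 0 2 β - mom 0 1 β := by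
    linear_combination β ^ 2 * r34 + β * r24 + r14 - β * r23 - 2 * r13 + r12
  have i4 : β ^ 4 * mom 4 4 β =
      mom 0 4 β - 4 * mom 0 3 β + 6 * mom 0 2 β - 4 * mom 0 1 β + mom 0 0 β := by
    linear_combination β ^ 3 * r44 + β ^ 2 * r34 + β * r24 + r14
      - β ^ 2 * r33 - 2 * β * r23 - 3 * r13 + β * r22 + 3 * r12 - r11
  have i5 : β ^ 5 * mom 5 4 β = mom 0 4 β - 5 * mom 0 3 β + 10 * mom 0 2 β - 10 * mom 0 1 β
      + 5 * mom 0 0 β - (mom 0 0 β - β * mom 1 0 β) := by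
    linear_combination β ^ 4 * r54 + β ^ 3 * r44 + β ^ 2 * r34 + β * r24 + r14
      - β ^ 3 * r43 - 2 * β ^ 2 * r33 - 3 * β * r23 - 4 * r13
      + β ^ 2 * r32 + 3 * β * r22 + 6 * r12 - β * r21 - 4 * r11
  have h4 : 4 - yF β ≠ 0 := by linarith
  have h2p : 2 + pF β ≠ 0 := by linarith
  refine ⟨?_, ?_, ?_, ?_⟩
  · rw [wmom, mul_left_comm, i2, e4, e3, e2, hε]; field_simp; ring
  · rw [wmom, mul_left_comm, i3, e4, e3, e2, e1, hε]; field_simp; ring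
  · rw [wmom, mul_left_comm, i4, e4, e3, e2, e1, e0, hε]; field_simp; ring
  · rw [wmom, mul_left_comm, i5, e4, e3, e2, e1, e0, e01, hε]; field_simp; ring

theorem gram_closed {β : ℝ} (h : β ∈ Ioo (0 : ℝ) 1) :
    β ^ 2 * gram2 β = 12 * yF β ^ 2 * (yF β - pF β ^ 2) / ((4 - yF β) * (2 + pF β) ^ 2) ∧
    β ^ 3 * gram32 β = 12 * yF β ^ 2 * (2 * yF β + yF β * pF β - 3 * pF β ^ 2) /
      ((4 - yF β) * (2 + pF β) ^ 2) := by
  have hβ := abs_lt_one_of_Ioo h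
  obtain ⟨hy0, hy1⟩ := yF_mem h
  have hp := pF_pos h
  obtain ⟨m2, m3, m4, m5⟩ := mom_closed h
  have h4 : 4 - yF β ≠ 0 := by linarith
  have h2p : 2 + pF β ≠ 0 := by linarith
  have hy := hy0.ne'
  have h1y : 1 - yF β ≠ 0 := by linarith
  have hb := h.1.ne'
  have hx : β ^ 2 = 1 - yF β := by rw [yF]; ring
  have m1 : β * wmom 1 β = 4 * (1 - yF β) / (4 - yF β) := by
    rw [wmom_one hβ, eRatio, hx, show 3 + (1 - yF β) = 4 - yF β by ring, ← hx]; ring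
  have g1 : gram1 β = 3 * yF β ^ 2 / (4 - yF β) ^ 2 := by
    rw [← mul_right_inj' h1y, ← hx, gram1]
    have : β ^ 2 * (wmom 2 β - wmom 1 β ^ 2) = β ^ 2 * wmom 2 β - (β * wmom 1 β) ^ 2 := by ring
    rw [this, m2, m1, hx]; field_simp; ring
  have g21 : β ^ 3 * gram21 β = (1 - yF β) * (12 - 6 * yF β - 6 * pF β) * yF β ^ 2 /
      ((4 - yF β) ^ 2 * (2 + pF β)) := by
    rw [gram21]
    have : β ^ 3 * (wmom 3 β - wmom 1 β * wmom 2 β)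
        = β ^ 3 * wmom 3 β - (β * wmom 1 β) * (β ^ 2 * wmom 2 β) := by ring
    rw [this, m3, m2, m1]; field_simp; ring
  have κ : β ^ 3 * (gram21 β / gram1 β) = (1 - yF β) * (4 - 2 * yF β - 2 * pF β) / (2 + pF β) := by
    rw [← mul_div_assoc, g21, g1]; field_simp; ring
  constructor
  · rw [← mul_right_inj' h1y, ← hx, gram2]
    have : β ^ 2 * (β ^ 2 * (wmom 4 β - gram21 β / gram1 β * gram21 β - wmom 2 β ^ 2))
        = β ^ 4 * wmom 4 β - (β ^ 3 * (gram21 β / gram1 β)) * (β ^ 3 * gram21 β) / β ^ 2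
          - (β ^ 2 * wmom 2 β) ^ 2 := by field_simp
    rw [this, m4, m2, g21, κ, hx]; field_simp; ring
  · rw [← mul_right_inj' h1y, ← hx, gram32]
    have : β ^ 2 * (β ^ 3 * (wmom 5 β - gram21 β / gram1 β * (wmom 4 β - wmom 1 β * wmom 3 β)
        - wmom 2 β * wmom 3 β)) = β ^ 5 * wmom 5 β - (β ^ 3 * (gram21 β / gram1 β)) *
          (β ^ 4 * wmom 4 β - (β * wmom 1 β) * (β ^ 3 * wmom 3 β)) / β ^ 2
          - (β ^ 2 * wmom 2 β) * (β ^ 3 * wmom 3 β) := by field_simp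
    rw [this, m5, m4, m3, m2, m1, κ, hx]; field_simp; ring

theorem flow_yF_pF {β : ℝ} (h : β ∈ Ioo (0 : ℝ) 1) : Flow yF pF β := by
  have hβ := abs_lt_one_of_Ioo h
  obtain ⟨hy0, hy1⟩ := yF_mem h
  have hp := pF_pos h
  have hb := h.1.ne'
  have hx : β ^ 2 = 1 - yF β := by rw [yF]; ring
  have hy' : HasDerivAt yF (-2 * (1 - yF β) / β) β := by
    refine ((hasDerivAt_id' β).fun_pow 2).const_sub 1 |>.congr_deriv ?_
    rw [← hx]; field_simp; simp
  have h5 : 1 - yF β * ell β ≠ 0 := by linarith [mul_ell_lt_one h]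
  refine ⟨hy', ?_, hx, h.1, hy0, hy1, by linarith, ?_⟩
  · have hl := hasDerivAt_ell hβ hb
    rw [hx, sub_sub_cancel] at hl
    refine ((hy'.const_mul 2).mul (hl.sub_const 1)).div ((hy'.mul hl).const_sub 1) h5
      |>.congr_deriv ?_
    simp only [Pi.mul_apply]
    rw [two_add_pF h, pF]
    field_simp
    ring
  · have h1 := (gram_closed h).1
    have h2 := gram2_pos hβ
    have h3 : 0 < β ^ 2 * gram2 β := mul_pos (pow_pos h.1 2) h2
    rw [h1] at h3
    have h4 : 0 < 4 - yF β := by linarith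
    by_contra hc
    push Not at hc
    have : 12 * yF β ^ 2 * (yF β - pF β ^ 2) / ((4 - yF β) * (2 + pF β) ^ 2) ≤ 0 :=
      div_nonpos_of_nonpos_of_nonneg (mul_nonpos_of_nonneg_of_nonpos (by positivity) hc)
        (by positivity)
    linarith

/-- The function `c = e ^ 3 - b e ^ 2 - g`. -/
noncomputable def coefC (β : ℝ) : ℝ := eRatio β ^ 3 - coefB β * eRatio β ^ 2 - coefG β

theorem coefB_eq {β : ℝ} (h : β ∈ Ioo (0 : ℝ) 1) : coefB β = fB (yF β) (pF β) / β := by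
  obtain ⟨g2, g32⟩ := gram_closed h
  obtain ⟨h0, h1, h2, h3, h4, h5, h6⟩ := (flow_yF_pF h).ne
  have : coefB β = (β ^ 3 * gram32 β) / (β ^ 2 * gram2 β) / β := by
    rw [coefB]; field_simp
  rw [this, g2, g32, fB]
  field_simp

theorem coefC_eq {β : ℝ} (h : β ∈ Ioo (0 : ℝ) 1) : coefC β = fC (yF β) (pF β) / β := by
  obtain ⟨m2, m3, -, -⟩ := mom_closed h
  have hF := flow_yF_pF h
  obtain ⟨h0, h1, h2, h3, h4, h5, h6⟩ := hF.ne
  have hx := hF.sq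
  have he : β * eRatio β = 4 * (1 - yF β) / (4 - yF β) := by
    rw [eRatio, hx, show 3 + (1 - yF β) = 4 - yF β by ring, ← hx]; ring
  have e : coefC β = ((β * eRatio β) ^ 3 - fB (yF β) (pF β) * (β * eRatio β) ^ 2
      - (β ^ 3 * wmom 3 β - (β ^ 2 * wmom 2 β) * fB (yF β) (pF β))) / β ^ 2 / β := by
    rw [coefC, coefG, coefB_eq h]; field_simp
  rw [e, he, m3, m2, fC, fB, nC, hx]
  field_simp
  ring

end M1P

/-! ### The closure as a function of the ratio `e = E₁ / E₀` -/

open MeasureTheory Set Filter Topology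

namespace M1P

/-- The inverse of `β ↦ 4 β / (3 + β ^ 2)`. -/
noncomputable def betaM (e : ℝ) : ℝ := 3 * e / (2 + √(4 - 3 * e ^ 2))

theorem alphaM1_eq (E₀ E₁ : ℝ) : alphaM1 E₀ E₁ = -betaM (E₁ / E₀) := by
  rw [alphaM1, betaM, neg_div]

theorem sqrt_betaM_pos (e : ℝ) : 0 < 2 + √(4 - 3 * e ^ 2) := by positivity

theorem eRatio_betaM {e : ℝ} (h : e ∈ Ioo (-1 : ℝ) 1) : eRatio (betaM e) = e := by
  have h1 : 0 ≤ 4 - 3 * e ^ 2 := by nlinarith [h.1, h.2]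
  obtain ⟨s, hs⟩ : ∃ s, s = √(4 - 3 * e ^ 2) := ⟨_, rfl⟩
  have hs0 : 0 ≤ s := hs ▸ Real.sqrt_nonneg _
  have hs2 : s ^ 2 = 4 - 3 * e ^ 2 := by rw [hs, Real.sq_sqrt h1]
  rw [eRatio, betaM, ← hs]
  have : (2 + s) ≠ 0 := by positivity
  have h3 : 3 * (2 + s) ^ 2 + (3 * e) ^ 2 = 12 * (2 + s) := by linear_combination 3 * hs2
  have e1 : 3 + (3 * e / (2 + s)) ^ 2 = 12 / (2 + s) := by
    field_simp; linear_combination h3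
  rw [e1]; field_simp; ring

theorem betaM_neg (e : ℝ) : betaM (-e) = -betaM e := by
  rw [betaM, betaM, neg_sq, mul_neg, neg_div]

theorem betaM_mem {e : ℝ} (h : e ∈ Ioo (0 : ℝ) 1) : betaM e ∈ Ioo (0 : ℝ) 1 := by
  have h1 : 1 < √(4 - 3 * e ^ 2) := by
    rw [Real.lt_sqrt zero_le_one]; nlinarith [h.1, h.2]
  have h0 := h.1
  refine ⟨by rw [betaM]; positivity, ?_⟩
  rw [betaM, div_lt_one (by positivity)]; linarith [h.2]

theorem betaM_zero : betaM 0 = 0 := by simp [betaM]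

theorem abs_betaM_lt {e : ℝ} (h : e ∈ Ioo (-1 : ℝ) 1) : |betaM e| < 1 := by
  rcases lt_trichotomy e 0 with h0 | rfl | h0
  · have := abs_lt_one_of_Ioo (betaM_mem (e := -e) ⟨by linarith, by linarith [h.1]⟩)
    rwa [betaM_neg, abs_neg] at this
  · simp [betaM_zero]
  · exact abs_lt_one_of_Ioo (betaM_mem ⟨h0, h.2⟩)

theorem contDiffOn_betaM (n : ℕ) : ContDiffOn ℝ n betaM (Ioo (-1) 1) := by
  intro e he
  have h1 : 4 - 3 * e ^ 2 ≠ 0 := by have := he.1; have := he.2; nlinarith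
  refine ContDiffAt.contDiffWithinAt ?_
  refine ContDiffAt.div (by fun_prop) (contDiffAt_const.add (ContDiffAt.sqrt (by fun_prop) h1))
    (sqrt_betaM_pos e).ne'

theorem hasDerivAt_eRatio (β : ℝ) :
    HasDerivAt eRatio (4 * (3 - β ^ 2) / (3 + β ^ 2) ^ 2) β := by
  have h : (3 + β ^ 2) ≠ 0 := by positivity
  refine ((hasDerivAt_id' β).const_mul 4).fun_div
    (((hasDerivAt_id' β).fun_pow 2).const_add 3) h |>.congr_deriv ?_
  simp; field_simp; ring

theorem hasDerivAt_betaM {e : ℝ} (h : e ∈ Ioo (-1 : ℝ) 1) :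
    HasDerivAt betaM ((3 + betaM e ^ 2) ^ 2 / (4 * (3 - betaM e ^ 2))) e := by
  have hd : HasDerivAt betaM (deriv betaM e) e :=
    (((contDiffOn_betaM 1).contDiffAt (isOpen_Ioo.mem_nhds h)).differentiableAt
      (by norm_num)).hasDerivAt
  have h2 := (one_sub_pos_of_abs (abs_betaM_lt h)).2.2
  have h3 := (hasDerivAt_eRatio (betaM e)).comp e hd
  have h4 : HasDerivAt (eRatio ∘ betaM) 1 e :=
    (hasDerivAt_id e).congr_of_eventuallyEq (by
      filter_upwards [isOpen_Ioo.mem_nhds h] with b hb using eRatio_betaM hb)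
  have h5 := h3.unique h4
  refine hd.congr_deriv ?_
  have h6 : 3 - betaM e ^ 2 ≠ 0 := by linarith
  have h7 : 3 + betaM e ^ 2 ≠ 0 := by positivity
  field_simp at h5 ⊢
  linear_combination h5

/-- Passage from a derivative in `β` to the derivative in `e`. -/
theorem HasDerivAt.comp_betaM {F : ℝ → ℝ} {D e : ℝ} (h : e ∈ Ioo (0 : ℝ) 1)
    (hF : HasDerivAt F (4 * (2 + yF (betaM e)) / (4 - yF (betaM e)) ^ 2 * D) (betaM e)) :
    HasDerivAt (fun e => F (betaM e)) D e := by
  have h1 : e ∈ Ioo (-1 : ℝ) 1 := ⟨by linarith [h.1], h.2⟩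
  refine (HasDerivAt.comp e hF (hasDerivAt_betaM h1)).congr_deriv ?_
  obtain ⟨-, -, h2⟩ := one_sub_pos_of_abs (abs_betaM_lt h1)
  have h6 : 3 - betaM e ^ 2 ≠ 0 := by linarith
  have h7 : 3 + betaM e ^ 2 ≠ 0 := by positivity
  rw [yF, show 2 + (1 - betaM e ^ 2) = 3 - betaM e ^ 2 by ring,
    show 4 - (1 - betaM e ^ 2) = 3 + betaM e ^ 2 by ring]
  field_simp

/-- The coefficient of `E₂` in `E₃` as a function of `E₁ / E₀`. -/
noncomputable def bE (e : ℝ) : ℝ := coefB (betaM e)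
/-- The coefficient of `E₀` in `E₃` as a function of `E₁ / E₀`. -/
noncomputable def gE (e : ℝ) : ℝ := coefG (betaM e)
/-- The constant coefficient of the characteristic polynomial in `s = λ - e`. -/
noncomputable def cE (e : ℝ) : ℝ := e ^ 3 - bE e * e ^ 2 - gE e

theorem contDiffOn_gram (n : ℕ) : ContDiffOn ℝ n gram1 (Ioo (-1) 1) ∧
    ContDiffOn ℝ n gram21 (Ioo (-1) 1) ∧ ContDiffOn ℝ n gram2 (Ioo (-1) 1) ∧
    ContDiffOn ℝ n gram32 (Ioo (-1) 1) := by
  have m := contDiffOn_wmom n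
  have h1 : ContDiffOn ℝ n gram1 (Ioo (-1) 1) := (m 2).sub ((m 1).pow 2)
  have h21 : ContDiffOn ℝ n gram21 (Ioo (-1) 1) := (m 3).sub ((m 1).mul (m 2))
  have hk : ContDiffOn ℝ n (fun β => gram21 β / gram1 β) (Ioo (-1) 1) :=
    h21.div h1 fun β hβ => (gram1_pos (abs_lt.2 hβ)).ne'
  exact ⟨h1, h21, ((m 4).sub (hk.mul h21)).sub ((m 2).pow 2),
    ((m 5).sub (hk.mul ((m 4).sub ((m 1).mul (m 3))))).sub ((m 2).mul (m 3))⟩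

theorem contDiffOn_coefB (n : ℕ) : ContDiffOn ℝ n coefB (Ioo (-1) 1) :=
  (contDiffOn_gram n).2.2.2.div (contDiffOn_gram n).2.2.1
    fun _ hβ => (gram2_pos (abs_lt.2 hβ)).ne'

theorem contDiffOn_coefG (n : ℕ) : ContDiffOn ℝ n coefG (Ioo (-1) 1) :=
  (contDiffOn_wmom n 3).sub ((contDiffOn_wmom n 2).mul (contDiffOn_coefB n))

theorem mapsTo_betaM : MapsTo betaM (Ioo (-1) 1) (Ioo (-1) 1) :=
  fun _ he => abs_lt.1 (abs_betaM_lt he)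

theorem contDiffOn_bE (n : ℕ) : ContDiffOn ℝ n bE (Ioo (-1) 1) :=
  (contDiffOn_coefB n).comp (contDiffOn_betaM n) mapsTo_betaM

theorem contDiffOn_gE (n : ℕ) : ContDiffOn ℝ n gE (Ioo (-1) 1) :=
  (contDiffOn_coefG n).comp (contDiffOn_betaM n) mapsTo_betaM

theorem contDiffOn_cE (n : ℕ) : ContDiffOn ℝ n cE (Ioo (-1) 1) := by
  have h := contDiffOn_bE n
  have h2 := contDiffOn_gE n
  unfold cE
  exact ((by fun_prop : ContDiffOn ℝ n (fun e : ℝ => e ^ 3) _).sub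
    (h.mul (by fun_prop))).sub h2

theorem cE_eq {e : ℝ} (h : e ∈ Ioo (-1 : ℝ) 1) : cE e = coefC (betaM e) := by
  rw [cE, coefC, eRatio_betaM h, bE, gE]

/-- The closed forms of the closure coefficients and of their derivatives in `e`. -/
theorem derivs_of_pos {e : ℝ} (h : e ∈ Ioo (0 : ℝ) 1) :
    bE e = fB (yF (betaM e)) (pF (betaM e)) / betaM e ∧
    deriv bE e = fB1 (yF (betaM e)) (pF (betaM e)) ∧
    deriv (deriv bE) e = fB2 (yF (betaM e)) (pF (betaM e)) / betaM e ∧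
    cE e = fC (yF (betaM e)) (pF (betaM e)) / betaM e ∧
    deriv cE e = fC1 (yF (betaM e)) (pF (betaM e)) ∧
    deriv (deriv cE) e = fC2 (yF (betaM e)) (pF (betaM e)) / betaM e := by
  have hI : ∀ᶠ e' in 𝓝 e, e' ∈ Ioo (0 : ℝ) 1 := isOpen_Ioo.mem_nhds h
  have hb0 : ∀ e' ∈ Ioo (0 : ℝ) 1, bE e' = fB (yF (betaM e')) (pF (betaM e')) / betaM e' :=
    fun e' h' => coefB_eq (betaM_mem h')
  have hc0 : ∀ e' ∈ Ioo (0 : ℝ) 1, cE e' = fC (yF (betaM e')) (pF (betaM e')) / betaM e' :=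
    fun e' h' => by rw [cE_eq ⟨by linarith [h'.1], h'.2⟩, coefC_eq (betaM_mem h')]
  have hb1 : ∀ e' ∈ Ioo (0 : ℝ) 1, deriv bE e' = fB1 (yF (betaM e')) (pF (betaM e')) := by
    intro e' h'
    have := HasDerivAt.comp_betaM h' (flow_yF_pF (betaM_mem h')).hasDerivAt_fB
    exact (this.congr_of_eventuallyEq (by
      filter_upwards [isOpen_Ioo.mem_nhds h'] with z hz using hb0 z hz)).deriv
  have hc1 : ∀ e' ∈ Ioo (0 : ℝ) 1, deriv cE e' = fC1 (yF (betaM e')) (pF (betaM e')) := by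
    intro e' h'
    have := HasDerivAt.comp_betaM h' (flow_yF_pF (betaM_mem h')).hasDerivAt_fC
    exact (this.congr_of_eventuallyEq (by
      filter_upwards [isOpen_Ioo.mem_nhds h'] with z hz using hc0 z hz)).deriv
  refine ⟨hb0 e h, hb1 e h, ?_, hc0 e h, hc1 e h, ?_⟩
  · have := HasDerivAt.comp_betaM h (flow_yF_pF (betaM_mem h)).hasDerivAt_fB1
    exact (this.congr_of_eventuallyEq (by filter_upwards [hI] with z hz using hb1 z hz)).deriv
  · have := HasDerivAt.comp_betaM h (flow_yF_pF (betaM_mem h)).hasDerivAt_fC1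
    exact (this.congr_of_eventuallyEq (by filter_upwards [hI] with z hz using hc1 z hz)).deriv

theorem coef_neg (β : ℝ) : coefB (-β) = -coefB β ∧ coefG (-β) = -coefG β := by
  have hb : coefB (-β) = -coefB β := by
    simp only [coefB, gram32, gram2, gram21, gram1, wmom_neg]
    norm_num
    ring
  refine ⟨hb, ?_⟩
  rw [coefG, coefG, hb, wmom_neg, wmom_neg]; ring

theorem bE_neg (e : ℝ) : bE (-e) = -bE e := by rw [bE, betaM_neg, (coef_neg _).1, bE]

theorem cE_neg (e : ℝ) : cE (-e) = -cE e := by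
  rw [cE, bE_neg, gE, betaM_neg, (coef_neg _).2, cE, gE]; ring

theorem deriv_neg_of_odd {f : ℝ → ℝ} (hf : ∀ x, f (-x) = -f x) (x : ℝ) :
    deriv f (-x) = deriv f x := by
  have := deriv_comp_neg f x
  simp only [hf] at this
  rw [deriv.fun_neg] at this
  linarith

theorem deriv_neg_of_even {f : ℝ → ℝ} (hf : ∀ x, f (-x) = f x) (x : ℝ) :
    deriv f (-x) = -deriv f x := by
  have := deriv_comp_neg f x
  simp only [hf] at this
  linarith

theorem deriv_at_zero : deriv bE 0 = 27 / 35 ∧ deriv cE 0 = -12 / 35 := by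
  have he : HasDerivAt eps 0 0 := by
    have : HasDerivAt (fun β : ℝ => 3 * (1 - β ^ 2) ^ 3 / (2 * (3 + β ^ 2))) _ 0 :=
      (((((hasDerivAt_id' (0 : ℝ)).fun_pow 2).const_sub 1).fun_pow 3).const_mul 3).fun_div
        ((((hasDerivAt_id' (0 : ℝ)).fun_pow 2).const_add 3).const_mul 2) (by norm_num)
    refine this.congr_deriv ?_
    norm_num
  have e0 : eps 0 = 1 / 2 := by norm_num [eps]
  have hm : ∀ k, HasDerivAt (wmom k) (2 * ((1 - (-1) ^ (k + 2)) / (k + 2))) 0 := by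
    intro k
    refine (he.mul (hasDerivAt_mom k 4 (β := 0) (by simp))).congr_deriv ?_
    rw [mom_at_zero k, mom_at_zero (k + 1), e0]; push_cast; ring
  have v : ∀ k, wmom k 0 = (1 / 2) * ((1 - (-1) ^ (k + 1)) / (k + 1)) := by
    intro k; rw [wmom, e0, mom_at_zero]
  have v1 : wmom 1 0 = 0 := by norm_num [v]
  have v2 : wmom 2 0 = 1 / 3 := by norm_num [v]
  have v3 : wmom 3 0 = 0 := by norm_num [v]
  have v4 : wmom 4 0 = 1 / 5 := by norm_num [v]
  have v5 : wmom 5 0 = 0 := by norm_num [v]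
  have d1 : HasDerivAt (wmom 1) (4 / 3) 0 := (hm 1).congr_deriv (by norm_num)
  have d2 : HasDerivAt (wmom 2) 0 0 := (hm 2).congr_deriv (by norm_num)
  have d3 : HasDerivAt (wmom 3) (4 / 5) 0 := (hm 3).congr_deriv (by norm_num)
  have d4 : HasDerivAt (wmom 4) 0 0 := (hm 4).congr_deriv (by norm_num)
  have d5 : HasDerivAt (wmom 5) (4 / 7) 0 := (hm 5).congr_deriv (by norm_num)
  have g1 : HasDerivAt gram1 0 0 :=
    (d2.fun_sub (d1.fun_pow 2)).congr_deriv (by rw [v1]; norm_num)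
  have g1v : gram1 0 = 1 / 3 := by rw [gram1, v1, v2]; norm_num
  have g21 : HasDerivAt gram21 (16 / 45) 0 :=
    (d3.fun_sub (d1.fun_mul d2)).congr_deriv (by rw [v1, v2]; norm_num)
  have g21v : gram21 0 = 0 := by rw [gram21, v1, v3]; norm_num
  have κ : HasDerivAt (fun β => gram21 β / gram1 β) (16 / 15) 0 :=
    (g21.fun_div g1 (by rw [g1v]; norm_num)).congr_deriv (by rw [g1v, g21v]; norm_num)
  have g2 : HasDerivAt gram2 0 0 :=
    ((d4.fun_sub (κ.fun_mul g21)).fun_sub (d2.fun_pow 2)).congr_deriv (by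
      rw [g21v]; norm_num)
  have g2v : gram2 0 = 4 / 45 := by rw [gram2, v4, g21v, v2]; norm_num
  have g32 : HasDerivAt gram32 (16 / 175) 0 :=
    ((d5.fun_sub (κ.fun_mul (d4.fun_sub (d1.fun_mul d3)))).fun_sub (d2.fun_mul d3)).congr_deriv
      (by rw [g21v, g1v, v1, v2, v3, v4]; norm_num)
  have g32v : gram32 0 = 0 := by rw [gram32, v5, g21v, v3]; norm_num
  have hB : HasDerivAt coefB (36 / 35) 0 :=
    (g32.fun_div g2 (by rw [g2v]; norm_num)).congr_deriv (by rw [g2v, g32v]; norm_num)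
  have hBv : coefB 0 = 0 := by rw [coefB, g32v, zero_div]
  have hG : HasDerivAt coefG (16 / 35) 0 :=
    (d3.fun_sub (d2.fun_mul hB)).congr_deriv (by rw [hBv, v2]; norm_num)
  have hM : HasDerivAt betaM (3 / 4) 0 :=
    (hasDerivAt_betaM (e := 0) (by norm_num)).congr_deriv (by rw [betaM_zero]; norm_num)
  have hb : HasDerivAt bE (27 / 35) 0 := by
    rw [← betaM_zero] at hB
    exact (hB.comp 0 hM).congr_deriv (by norm_num)
  have hg : HasDerivAt gE (12 / 35) 0 := by
    rw [← betaM_zero] at hG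
    exact (hG.comp 0 hM).congr_deriv (by norm_num)
  refine ⟨hb.deriv, ?_⟩
  have := (((hasDerivAt_id' (0 : ℝ)).fun_pow 3).fun_sub
    (hb.fun_mul ((hasDerivAt_id' (0 : ℝ)).fun_pow 2))).fun_sub hg
  rw [show cE = fun e => e ^ 3 - bE e * e ^ 2 - gE e from rfl, this.deriv]
  norm_num

end M1P

/-! ### The genuine nonlinearity test as a quartic -/

namespace M1P

/-- The characteristic polynomial in `s = λ - e`, with `v = E₂ / E₀ - e ^ 2`. -/
def charS (a c b₁ c₁ v s : ℝ) : ℝ := s ^ 3 + a * s ^ 2 + (c₁ - v * b₁) * s + c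

/-- The factor of `∇λ · r` that decides about genuine nonlinearity, at the speed `λ = e + s`. -/
def gnl (a b₁ b₂ c₂ v s : ℝ) : ℝ := 2 * b₁ * s ^ 2 + (2 * a - c₂ + v * b₂) * s - 2 * b₁ * v

/-- The quartic to which `b₁ s gnl` reduces at the roots of `charS` when `v` is eliminated. -/
def quartic (a c b₁ c₁ b₂ c₂ s : ℝ) : ℝ :=
  b₂ * s ^ 4 + (2 * b₁ ^ 2 - 2 * b₁ + a * b₂) * s ^ 3 + (c₁ * b₂ - c₂ * b₁) * s ^ 2
    + (c * b₂ - 2 * b₁ * c₁) * s - 2 * b₁ * c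

/-- The factor `2 b₁ - b₂ s` of the equation `charS = 0` eliminates `v`. -/
theorem mul_gnl {a c b₁ c₁ b₂ c₂ v s : ℝ} (h : charS a c b₁ c₁ v s = 0) :
    b₁ * s * gnl a b₁ b₂ c₂ v s = quartic a c b₁ c₁ b₂ c₂ s := by
  unfold charS at h
  unfold gnl quartic
  linear_combination (2 * b₁ - b₂ * s) * h

/-- Three simple real roots of the characteristic polynomial, the outer two of which pass the test
for genuine nonlinearity. -/
def OuterGNL (a c b₁ c₁ b₂ c₂ v : ℝ) : Prop :=
  ∃ s₁ s₂ s₃ : ℝ, s₁ < s₂ ∧ s₂ < s₃ ∧ charS a c b₁ c₁ v s₁ = 0 ∧ charS a c b₁ c₁ v s₂ = 0 ∧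
    charS a c b₁ c₁ v s₃ = 0 ∧ s₁ ≠ 0 ∧ s₃ ≠ 0 ∧
    gnl a b₁ b₂ c₂ v s₁ ≠ 0 ∧ gnl a b₁ b₂ c₂ v s₃ ≠ 0

theorem charS_eq (a c b₁ c₁ v s : ℝ) :
    charS a c b₁ c₁ v s = charS a c b₁ c₁ 0 s - v * (b₁ * s) := by unfold charS; ring

/-- The reflection `s ↦ -s`, which exchanges the outer roots. -/
theorem OuterGNL.of_neg {a c b₁ c₁ b₂ c₂ v : ℝ} (h : OuterGNL (-a) (-c) b₁ c₁ (-b₂) (-c₂) v) :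
    OuterGNL a c b₁ c₁ b₂ c₂ v := by
  obtain ⟨s₁, s₂, s₃, h12, h23, r1, r2, r3, n1, n3, g1, g3⟩ := h
  have hr : ∀ s, charS (-a) (-c) b₁ c₁ v s = -charS a c b₁ c₁ v (-s) := by
    intro s; unfold charS; ring
  have hg : ∀ s, gnl (-a) b₁ (-b₂) (-c₂) v s = gnl a b₁ b₂ c₂ v (-s) := by
    intro s; unfold gnl; ring
  rw [hr, neg_eq_zero] at r1 r2 r3
  rw [hg] at g1 g3
  exact ⟨-s₃, -s₂, -s₁, neg_lt_neg h23, neg_lt_neg h12, r3, r2, r1, neg_ne_zero.2 n3,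
    neg_ne_zero.2 n1, g3, g1⟩

theorem continuous_charS (a c b₁ c₁ v : ℝ) : Continuous (charS a c b₁ c₁ v) := by
  unfold charS; fun_prop

theorem exists_charS_neg (a c b₁ c₁ v m : ℝ) : ∃ s < m, charS a c b₁ c₁ v s < 0 := by
  set k := c₁ - v * b₁
  set M := 1 + |a| + |k| + |c| + |m| with hM
  have h0 : 1 ≤ M := by rw [hM]; linarith [abs_nonneg a, abs_nonneg k, abs_nonneg c, abs_nonneg m]
  refine ⟨-M, by linarith [neg_abs_le m, abs_nonneg a, abs_nonneg k, abs_nonneg c], ?_⟩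
  have e : charS a c b₁ c₁ v (-M) = -M ^ 3 + a * M ^ 2 - k * M + c := by
    unfold charS; simp only [k]; ring
  have h1 : a * M ^ 2 ≤ |a| * M ^ 2 := by gcongr; exact le_abs_self a
  have h2 : -k * M ≤ |k| * M ^ 2 := by
    calc -k * M ≤ |k| * M := by gcongr; exact neg_le_abs k
      _ ≤ |k| * M ^ 2 := by
        have := abs_nonneg k
        have : M ≤ M ^ 2 := by nlinarith
        gcongr
  have h3 : c ≤ |c| * M ^ 2 := by
    have := abs_nonneg c
    have : 1 ≤ M ^ 2 := by nlinarith
    calc c ≤ |c| := le_abs_self c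
      _ ≤ |c| * M ^ 2 := by nlinarith
  have h4 : M ^ 3 = (1 + |a| + |k| + |c| + |m|) * M ^ 2 := by rw [← hM]; ring
  have h5 : 0 < (1 + |m|) * M ^ 2 := by have := abs_nonneg m; positivity
  rw [e]; nlinarith

/-- As `charS` is negative at `0`, where it equals `c`, and positive at `m < 0`, it has roots `s₁
< m < s₂ < 0 < s₃`; so positivity of `gnl` is needed only at the roots outside `[m, 0]`. -/
theorem outerGNL_of {a c b₁ c₁ b₂ c₂ v m : ℝ} (hb : 0 < b₁) (hc : c < 0) (hv : 0 < v) (hm : m < 0)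
    (hp : 0 < charS a c b₁ c₁ 0 m)
    (hpos : ∀ s, 0 < s → charS a c b₁ c₁ v s = 0 → 0 < gnl a b₁ b₂ c₂ v s)
    (hneg : ∀ s, s < m → charS a c b₁ c₁ v s = 0 → 0 < gnl a b₁ b₂ c₂ v s) :
    OuterGNL a c b₁ c₁ b₂ c₂ v := by
  have hcont := continuous_charS a c b₁ c₁ v
  have h0 : charS a c b₁ c₁ v 0 < 0 := by simpa [charS] using hc
  have h1 : 0 < charS a c b₁ c₁ v m := by
    rw [charS_eq]; have : 0 < v * (b₁ * -m) := by have : 0 < -m := by linarith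
                                                  positivity
    linarith
  obtain ⟨l, hl, hl0⟩ := exists_charS_neg a c b₁ c₁ v m
  obtain ⟨r, hr, hr0⟩ := exists_charS_neg (-a) (-c) b₁ c₁ v 0
  have hr1 : 0 < charS a c b₁ c₁ v (-r) := by
    have : charS (-a) (-c) b₁ c₁ v r = -charS a c b₁ c₁ v (-r) := by unfold charS; ring
    linarith
  obtain ⟨s₁, ⟨-, k1⟩, r1⟩ := intermediate_value_Ioo hl.le hcont.continuousOn ⟨hl0, h1⟩
  obtain ⟨s₂, ⟨k2, k2'⟩, r2⟩ := intermediate_value_Ioo' hm.le hcont.continuousOn ⟨h0, h1⟩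
  obtain ⟨s₃, ⟨k3, -⟩, r3⟩ := intermediate_value_Ioo (by linarith : (0 : ℝ) ≤ -r)
    hcont.continuousOn ⟨h0, hr1⟩
  exact ⟨s₁, s₂, s₃, by linarith, by linarith, r1, r2, r3, by linarith, k3.ne',
    (hneg s₁ k1 r1).ne', (hpos s₃ k3 r3).ne'⟩

/-- The numerator of the constant coefficient of the quartic. -/
noncomputable def nQ0 (y p : ℝ) : ℝ := -72 * y ^ 2 + 144 * y ^ 3 - 18 * y ^ 4 + p * (24 * y
    + 132 * y ^ 2 - 12 * y ^ 3 + p * (-12 * y - 180 * y ^ 2 + 21 * y ^ 3 + p * (-234 * y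
    + 18 * y ^ 2 + p * (48 + 57 * y - 6 * y ^ 2 + p * (96 - 6 * y)))))
/-- The numerator of the linear coefficient of the quartic. -/
noncomputable def nQ1 (y p : ℝ) : ℝ := 144 * y ^ 3 - 252 * y ^ 4 - 54 * y ^ 5
    + 45 * y ^ 6 - 9 / 2 * y ^ 7 + p * (480 * y ^ 2 - 1488 * y ^ 3 + 882 * y ^ 4
    + 933 * y ^ 5 - 381 / 2 * y ^ 6 + 45 / 4 * y ^ 7 + p * (-192 * y - 2352 * y ^ 2
    + 1824 * y ^ 3 + 714 * y ^ 4 - 1731 / 2 * y ^ 5 + 327 / 4 * y ^ 6 + p * (672 * y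
    + 3000 * y ^ 2 - 2280 * y ^ 3 - 2076 * y ^ 4 + 969 / 4 * y ^ 5 - 111 / 8 * y ^ 6
    + p * (3000 * y - 1926 * y ^ 2 - 693 * y ^ 3 + 4497 / 4 * y ^ 4 - 351 / 4 * y ^ 5
    + p * (-768 - 3036 * y + 1455 * y ^ 2 + 3867 / 2 * y ^ 3 - 597 / 8 * y ^ 4
    + 33 / 8 * y ^ 5 + p * (-768 + 618 * y + 171 / 2 * y ^ 2 - 384 * y ^ 3 + 93 / 4 * y ^ 4
    + p * (1104 - 225 * y - 2565 / 4 * y ^ 2 - 39 / 8 * y ^ 3)))))))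
/-- The numerator of the quadratic coefficient of the quartic. -/
noncomputable def nQ2 (y p : ℝ) : ℝ := -288 * y ^ 3 + 684 * y ^ 4 - 675 * y ^ 5
    + 333 / 2 * y ^ 6 - 9 * y ^ 7 + p * (-96 * y ^ 2 + 1416 * y ^ 3 - 3186 * y ^ 4
    + 5025 / 2 * y ^ 5 - 681 / 2 * y ^ 6 + 18 * y ^ 7 + p * (96 * y
    + 2064 * y ^ 2 - 5166 * y ^ 3 + 3729 * y ^ 4 - 4035 / 4 * y ^ 5 - 153 / 8 * y ^ 6
    + 9 / 8 * y ^ 7 + p * (-912 * y + 600 * y ^ 2 + 4113 * y ^ 3 - 7149 / 2 * y ^ 4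
    + 843 / 8 * y ^ 5 - 225 / 8 * y ^ 6 + p * (-4176 * y + 6702 * y ^ 2 - 8403 / 2 * y ^ 3
    + 2385 / 2 * y ^ 4 + 159 / 2 * y ^ 5 - 3 / 2 * y ^ 6 + p * (1152 + 408 * y - 3639 * y ^ 2
    + 7155 / 4 * y ^ 3 + 393 * y ^ 4 + 75 / 4 * y ^ 5 + p * (1152 - 1806 * y
    + 2625 / 2 * y ^ 2 - 1737 / 4 * y ^ 3 - 339 / 8 * y ^ 4 + 3 / 8 * y ^ 5 + p * (-1008
    + 1449 * y - 1287 / 4 * y ^ 2 - 1719 / 8 * y ^ 3 - 45 / 8 * y ^ 4)))))))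
/-- The numerator of the cubic coefficient of the quartic. -/
noncomputable def nQ3 (y p : ℝ) : ℝ := -24 * y ^ 2 + 54 * y ^ 3 + 18 * y ^ 4 - 15 / 2 * y ^ 5
    + p * (16 * y + 60 * y ^ 2 - 120 * y ^ 3 - 121 * y ^ 4 + 33 / 2 * y ^ 5 + p * (32 * y
    + 72 * y ^ 2 + 3 * y ^ 3 + 155 / 2 * y ^ 4 + 9 / 8 * y ^ 5 + p * (-32 - 316 * y
    + 105 * y ^ 2 + 200 * y ^ 3 - 49 / 2 * y ^ 4 + p * (76
    + 61 * y - 69 / 2 * y ^ 2 - 1085 / 8 * y ^ 3 - 5 / 8 * y ^ 4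
    + p * (100 - 18 * y - 255 / 4 * y ^ 2 + 35 / 4 * y ^ 3 + p * (-63 + 9 / 4 * y
    + 459 / 8 * y ^ 2))))))

theorem aux_a {y p β : ℝ} (hβ : β ≠ 0) (hs : β ^ 2 = 1 - y) (h4 : 4 - y ≠ 0) (hH : y - p ^ 2 ≠ 0) :
    3 * (4 * β / (3 + β ^ 2)) - fB y p / β = y * nA y p / ((4 - y) * (y - p ^ 2) * β) := by
  have : 4 * β = 4 * β ^ 2 / β := by field_simp
  rw [this, hs, show 3 + (1 - y) = 4 - y by ring]
  unfold fB nA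
  field_simp
  ring

theorem quartic_coeff_zero {y p β : ℝ} (hβ : β ≠ 0) (hy : y ≠ 0) (h1 : 1 - y ≠ 0) (h2 : 2 + y ≠ 0)
    (h4 : 4 - y ≠ 0) (hp : 2 + p ≠ 0) (hH : y - p ^ 2 ≠ 0) :
    -2 * fB1 y p * (fC y p / β) =
    y ^ 2 * (1 - p) * p * nQ0 y p /
      ((y - p ^ 2) ^ 3 * (2 + y) * (1 - y) * (4 - y) * (2 + p) * β) := by
  unfold fB1 fC nB1 nC nQ0
  field_simp
  ring

theorem quartic_coeff_one {y p β : ℝ} (hs : β ^ 2 = 1 - y) (hy : y ≠ 0) (h1 : 1 - y ≠ 0)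
    (h2 : 2 + y ≠ 0) (h4 : 4 - y ≠ 0) (hp : 2 + p ≠ 0) (hH : y - p ^ 2 ≠ 0) :
    fC y p / β * (fB2 y p / β) - 2 * fB1 y p * fC1 y p =
    y * nQ1 y p / ((y - p ^ 2) ^ 3 * (2 + y) ^ 3 * (2 + p) * (1 - y) ^ 2) := by
  rw [div_mul_div_comm, ← sq, hs]
  unfold fB1 fB2 fC fC1 nB1 nB2 nC nC1 nQ1
  field_simp
  ring

theorem quartic_coeff_two {y p β : ℝ} (hβ : β ≠ 0) (hy : y ≠ 0) (h1 : 1 - y ≠ 0) (h2 : 2 + y ≠ 0)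
    (h4 : 4 - y ≠ 0) (hp : 2 + p ≠ 0) (hH : y - p ^ 2 ≠ 0) :
    fC1 y p * (fB2 y p / β) - fC2 y p / β * fB1 y p =
    (4 - y) * nQ2 y p / ((y - p ^ 2) ^ 3 * (2 + y) ^ 3 * (2 + p) * (1 - y) ^ 2 * β) := by
  unfold fB1 fB2 fC1 fC2 nB1 nB2 nC1 nC2 nQ2
  field_simp
  ring

theorem quartic_coeff_three {y p β : ℝ} (hs : β ^ 2 = 1 - y) (hy : y ≠ 0) (h1 : 1 - y ≠ 0)
    (h2 : 2 + y ≠ 0) (h4 : 4 - y ≠ 0) (hH : y - p ^ 2 ≠ 0) :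
    2 * fB1 y p ^ 2 - 2 * fB1 y p +
      y * nA y p / ((4 - y) * (y - p ^ 2) * β) * (fB2 y p / β) =
    (4 - y) ^ 2 * nQ3 y p / ((y - p ^ 2) ^ 3 * (2 + y) ^ 3 * (1 - y) ^ 2) := by
  rw [div_mul_div_comm, show (4 - y) * (y - p ^ 2) * β * β = (4 - y) * (y - p ^ 2) * β ^ 2 by ring,
    hs]
  unfold fB1 fB2 nA nB1 nB2 nQ3
  field_simp
  ring

end M1P

/-! ### The coefficients in the variables `x = β ^ 2` and `ω` -/

namespace M1P
open Encl Ex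

/-- The denominator of `p`, as `1 - x = y`, `p = y * cp / pDen`. -/
def pDen (x w : ℝ) : ℝ := 315 - 287 * x + 32 * x ^ 2 + w * (-35 * x + 23 * x ^ 2)

section
variable {x w y p : ℝ}

theorem nQ0_mul_pow (hy : y = 1 - x) (hp : p * pDen x w = y * polyEval cp x w) :
    nQ0 y p * pDen x w ^ 5 = y ^ 2 * x ^ 4 * polyEval cq0 x w := by
  have h : nQ0 y p * pDen x w ^ 5 = (-72 * y ^ 2 + 144 * y ^ 3 - 18 * y ^ 4) * pDen x w ^ 5
      + (24 * y + 132 * y ^ 2 - 12 * y ^ 3) * (p * pDen x w) ^ 1 * pDen x w ^ 4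
      + (-12 * y - 180 * y ^ 2 + 21 * y ^ 3) * (p * pDen x w) ^ 2 * pDen x w ^ 3 + (-234 * y
      + 18 * y ^ 2) * (p * pDen x w) ^ 3 * pDen x w ^ 2 + (48
      + 57 * y - 6 * y ^ 2) * (p * pDen x w) ^ 4 * pDen x w ^ 1
      + (96 - 6 * y) * (p * pDen x w) ^ 5 := by
    unfold nQ0; ring
  rw [h, hp, hy]
  simp only [pDen, polyEval, polyEval1, cp, cq0, List.foldr_cons, List.foldr_nil]
  push_cast
  ring

theorem nQ1_mul_pow (hy : y = 1 - x) (hp : p * pDen x w = y * polyEval cp x w) :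
    nQ1 y p * pDen x w ^ 7 = y ^ 3 * x ^ 5 * polyEval cq1 x w := by
  have h : nQ1 y p * pDen x w ^ 7 = (144 * y ^ 3 - 252 * y ^ 4 - 54 * y ^ 5
      + 45 * y ^ 6 - 9 / 2 * y ^ 7) * pDen x w ^ 7 + (480 * y ^ 2 - 1488 * y ^ 3
      + 882 * y ^ 4 + 933 * y ^ 5 - 381 / 2 * y ^ 6
      + 45 / 4 * y ^ 7) * (p * pDen x w) ^ 1 * pDen x w ^ 6 + (-192 * y - 2352 * y ^ 2
      + 1824 * y ^ 3 + 714 * y ^ 4 - 1731 / 2 * y ^ 5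
      + 327 / 4 * y ^ 6) * (p * pDen x w) ^ 2 * pDen x w ^ 5 + (672 * y
      + 3000 * y ^ 2 - 2280 * y ^ 3 - 2076 * y ^ 4
      + 969 / 4 * y ^ 5 - 111 / 8 * y ^ 6) * (p * pDen x w) ^ 3 * pDen x w ^ 4
      + (3000 * y - 1926 * y ^ 2 - 693 * y ^ 3
      + 4497 / 4 * y ^ 4 - 351 / 4 * y ^ 5) * (p * pDen x w) ^ 4 * pDen x w ^ 3
      + (-768 - 3036 * y + 1455 * y ^ 2 + 3867 / 2 * y ^ 3 - 597 / 8 * y ^ 4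
      + 33 / 8 * y ^ 5) * (p * pDen x w) ^ 5 * pDen x w ^ 2 + (-768 + 618 * y
      + 171 / 2 * y ^ 2 - 384 * y ^ 3 + 93 / 4 * y ^ 4) * (p * pDen x w) ^ 6 * pDen x w ^ 1
      + (1104 - 225 * y - 2565 / 4 * y ^ 2 - 39 / 8 * y ^ 3) * (p * pDen x w) ^ 7 := by
    unfold nQ1; ring
  rw [h, hp, hy]
  simp only [pDen, polyEval, polyEval1, cp, cq1, List.foldr_cons, List.foldr_nil]
  push_cast
  ring

theorem nQ2_mul_pow (hy : y = 1 - x) (hp : p * pDen x w = y * polyEval cp x w) :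
    nQ2 y p * pDen x w ^ 7 = y ^ 3 * x ^ 6 * polyEval cq2 x w := by
  have h : nQ2 y p * pDen x w ^ 7 = (-288 * y ^ 3 + 684 * y ^ 4 - 675 * y ^ 5
      + 333 / 2 * y ^ 6 - 9 * y ^ 7) * pDen x w ^ 7 + (-96 * y ^ 2
      + 1416 * y ^ 3 - 3186 * y ^ 4 + 5025 / 2 * y ^ 5 - 681 / 2 * y ^ 6
      + 18 * y ^ 7) * (p * pDen x w) ^ 1 * pDen x w ^ 6 + (96 * y
      + 2064 * y ^ 2 - 5166 * y ^ 3 + 3729 * y ^ 4 - 4035 / 4 * y ^ 5 - 153 / 8 * y ^ 6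
      + 9 / 8 * y ^ 7) * (p * pDen x w) ^ 2 * pDen x w ^ 5 + (-912 * y + 600 * y ^ 2
      + 4113 * y ^ 3 - 7149 / 2 * y ^ 4
      + 843 / 8 * y ^ 5 - 225 / 8 * y ^ 6) * (p * pDen x w) ^ 3 * pDen x w ^ 4 + (-4176 * y
      + 6702 * y ^ 2 - 8403 / 2 * y ^ 3 + 2385 / 2 * y ^ 4
      + 159 / 2 * y ^ 5 - 3 / 2 * y ^ 6) * (p * pDen x w) ^ 4 * pDen x w ^ 3 + (1152
      + 408 * y - 3639 * y ^ 2 + 7155 / 4 * y ^ 3 + 393 * y ^ 4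
      + 75 / 4 * y ^ 5) * (p * pDen x w) ^ 5 * pDen x w ^ 2 + (1152 - 1806 * y
      + 2625 / 2 * y ^ 2 - 1737 / 4 * y ^ 3 - 339 / 8 * y ^ 4
      + 3 / 8 * y ^ 5) * (p * pDen x w) ^ 6 * pDen x w ^ 1 + (-1008
      + 1449 * y - 1287 / 4 * y ^ 2 - 1719 / 8 * y ^ 3 - 45 / 8 * y ^ 4) * (p * pDen x w) ^ 7 :=
      by
    unfold nQ2; ring
  rw [h, hp, hy]
  simp only [pDen, polyEval, polyEval1, cp, cq2, List.foldr_cons, List.foldr_nil]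
  push_cast
  ring

theorem nQ3_mul_pow (hy : y = 1 - x) (hp : p * pDen x w = y * polyEval cp x w) :
    nQ3 y p * pDen x w ^ 6 = y ^ 2 * x ^ 5 * polyEval cq3 x w := by
  have h : nQ3 y p * pDen x w ^ 6 = (-24 * y ^ 2 + 54 * y ^ 3
      + 18 * y ^ 4 - 15 / 2 * y ^ 5) * pDen x w ^ 6 + (16 * y
      + 60 * y ^ 2 - 120 * y ^ 3 - 121 * y ^ 4
      + 33 / 2 * y ^ 5) * (p * pDen x w) ^ 1 * pDen x w ^ 5 + (32 * y + 72 * y ^ 2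
      + 3 * y ^ 3 + 155 / 2 * y ^ 4 + 9 / 8 * y ^ 5) * (p * pDen x w) ^ 2 * pDen x w ^ 4
      + (-32 - 316 * y + 105 * y ^ 2
      + 200 * y ^ 3 - 49 / 2 * y ^ 4) * (p * pDen x w) ^ 3 * pDen x w ^ 3 + (76
      + 61 * y - 69 / 2 * y ^ 2 - 1085 / 8 * y ^ 3 - 5 / 8 * y ^ 4) * (p * pDen x w) ^ 4 * pDen x
      w ^ 2 + (100 - 18 * y - 255 / 4 * y ^ 2
      + 35 / 4 * y ^ 3) * (p * pDen x w) ^ 5 * pDen x w ^ 1 + (-63 + 9 / 4 * y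
      + 459 / 8 * y ^ 2) * (p * pDen x w) ^ 6 := by
    unfold nQ3; ring
  rw [h, hp, hy]
  simp only [pDen, polyEval, polyEval1, cp, cq3, List.foldr_cons, List.foldr_nil]
  push_cast
  ring

theorem nB2_mul_pow (hy : y = 1 - x) (hp : p * pDen x w = y * polyEval cp x w) :
    nB2 y p * pDen x w ^ 6 = y ^ 3 * x ^ 5 * polyEval cq4 x w := by
  have h : nB2 y p * pDen x w ^ 6 = (-6 * y ^ 3 - 3 / 2 * y ^ 4
      + 3 / 4 * y ^ 5) * pDen x w ^ 6 + (4 * y ^ 2 + 16 * y ^ 3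
      + 10 * y ^ 4 - 15 / 8 * y ^ 5) * (p * pDen x w) ^ 1 * pDen x w ^ 5
      + (-17 * y ^ 2 - 13 / 2 * y ^ 3 - 37 / 8 * y ^ 4) * (p * pDen x w) ^ 2 * pDen x w ^ 4
      + (12 * y - 11 * y ^ 2 - 14 * y ^ 3
      + 7 / 4 * y ^ 4) * (p * pDen x w) ^ 3 * pDen x w ^ 3 + (-4 + 11 * y + 23 / 4 * y ^ 2
      + 39 / 4 * y ^ 3) * (p * pDen x w) ^ 4 * pDen x w ^ 2 + (-4 + 2 * y
      + 7 / 2 * y ^ 2 - 3 / 8 * y ^ 3) * (p * pDen x w) ^ 5 * pDen x w ^ 1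
      + (-1 - 1 / 4 * y - 35 / 8 * y ^ 2) * (p * pDen x w) ^ 6 := by
    unfold nB2; ring
  rw [h, hp, hy]
  simp only [pDen, polyEval, polyEval1, cp, cq4, List.foldr_cons, List.foldr_nil]
  push_cast
  ring

theorem nA_mul_pow (hy : y = 1 - x) (hp : p * pDen x w = y * polyEval cp x w) :
    nA y p * pDen x w ^ 2 = x ^ 2 * polyEval ca x w := by
  have h : nA y p * pDen x w ^ 2 = (4 - 10 * y) * pDen x w ^ 2 + (-4
      + 1 * y) * (p * pDen x w) ^ 1 * pDen x w ^ 1 + (9) * (p * pDen x w) ^ 2 := by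
    unfold nA; ring
  rw [h, hp, hy]
  simp only [pDen, polyEval, polyEval1, cp, ca, List.foldr_cons, List.foldr_nil]
  push_cast
  ring

theorem nC_mul_pow (hy : y = 1 - x) (hp : p * pDen x w = y * polyEval cp x w) :
    nC y p * pDen x w ^ 3 = y ^ 1 * x ^ 2 * polyEval cc x w := by
  have h : nC y p * pDen x w ^ 3 = (-24 * y + 48 * y ^ 2 - 6 * y ^ 3) * pDen x w ^ 3
      + (60 * y - 6 * y ^ 2) * (p * pDen x w) ^ 1 * pDen x w ^ 2 + (-30 * y
      + 3 * y ^ 2) * (p * pDen x w) ^ 2 * pDen x w ^ 1 + (-48 + 3 * y) * (p * pDen x w) ^ 3 := by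
    unfold nC; ring
  rw [h, hp, hy]
  simp only [pDen, polyEval, polyEval1, cp, cc, List.foldr_cons, List.foldr_nil]
  push_cast
  ring

theorem nC1_mul_pow (hy : y = 1 - x) (hp : p * pDen x w = y * polyEval cp x w) :
    nC1 y p * pDen x w ^ 5 = y ^ 2 * x ^ 3 * polyEval cc1 x w := by
  have h : nC1 y p * pDen x w ^ 5 = (96 * y ^ 2 - 204 * y ^ 3
      + 174 * y ^ 4 - 12 * y ^ 5) * pDen x w ^ 5 + (-480 * y ^ 2 + 378 * y ^ 3 - 36 * y ^ 4
      + 3 * y ^ 5) * (p * pDen x w) ^ 1 * pDen x w ^ 4 + (-48 * y + 288 * y ^ 2 - 297 * y ^ 3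
      + 33 / 2 * y ^ 4) * (p * pDen x w) ^ 2 * pDen x w ^ 3 + (696 * y - 516 * y ^ 2
      + 21 / 2 * y ^ 3 - 3 / 2 * y ^ 4) * (p * pDen x w) ^ 3 * pDen x w ^ 2 + (-108 * y
      + 126 * y ^ 2 - 9 / 2 * y ^ 3) * (p * pDen x w) ^ 4 * pDen x w ^ 1 + (-288 + 198 * y
      + 9 * y ^ 2) * (p * pDen x w) ^ 5 := by
    unfold nC1; ring
  rw [h, hp, hy]
  simp only [pDen, polyEval, polyEval1, cp, cc1, List.foldr_cons, List.foldr_nil]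
  push_cast
  ring

theorem nB1_mul_pow (hy : y = 1 - x) (hp : p * pDen x w = y * polyEval cp x w) :
    nB1 y p * pDen x w ^ 2 = y ^ 1 * x ^ 2 * polyEval cb1 x w := by
  have h : nB1 y p * pDen x w ^ 2 = (-3 / 2 * y) * pDen x w ^ 2
      + (1 / 2) * (p * pDen x w) ^ 1 * pDen x w ^ 1 + (1) * (p * pDen x w) ^ 2 := by
    unfold nB1; ring
  rw [h, hp, hy]
  simp only [pDen, polyEval, polyEval1, cp, cb1, List.foldr_cons, List.foldr_nil]
  push_cast
  ring

theorem one_sub_p_mul (hy : y = 1 - x) (hp : p * pDen x w = y * polyEval cp x w) :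
    (1 - p) * pDen x w = x * polyEval c1p x w := by
  rw [sub_mul, hp, hy]
  simp only [pDen, polyEval, polyEval1, cp, c1p, List.foldr_cons, List.foldr_nil]
  push_cast
  ring

theorem two_add_p_mul (hy : y = 1 - x) (hp : p * pDen x w = y * polyEval cp x w) :
    (2 + p) * pDen x w = polyEval c2p x w := by
  rw [add_mul, hp, hy]
  simp only [pDen, polyEval, polyEval1, cp, c2p, List.foldr_cons, List.foldr_nil]
  push_cast
  ring

theorem H_mul_sq (hy : y = 1 - x) (hp : p * pDen x w = y * polyEval cp x w) :
    (y - p ^ 2) * pDen x w ^ 2 = y * x * polyEval cH x w := by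
  rw [sub_mul, ← mul_pow, hp, hy]
  simp only [pDen, polyEval, polyEval1, cp, cH, List.foldr_cons, List.foldr_nil]
  push_cast
  ring

end
end M1P

/-! ### From the polynomial inequalities to genuine nonlinearity -/

namespace M1P
open Encl Ex

/-- The coefficients of the closure at `β` satisfy the conclusion for all admissible `v`. -/
def GNLAt (β y p : ℝ) : Prop :=
  ∀ v, 0 < v → v < y * (8 + y) / (4 - y) ^ 2 →
    OuterGNL (3 * (4 * β / (3 + β ^ 2)) - fB y p / β) (fC y p / β) (fB1 y p) (fC1 y p)
      (fB2 y p / β) (fC2 y p / β) v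

section
variable {β w : ℝ}

theorem dens_tS : dens β w tS =
    [β * (polyEval c1p (β * β) w * polyEval cp (β * β) w * ((3 + -(β * β)) * (3 + -(β * β)))
        * polyEval cq0 (β * β) w), polyEval cq1 (β * β) w, β * polyEval cq2 (β * β) w,
      polyEval c2p (β * β) w * polyEval cq3 (β * β) w,
      β * ((1 + -(β * β)) * (polyEval c2p (β * β) w * polyEval cq4 (β * β) w))] := by
  simp [dens, tS, den, eT0, eP, eX, eY, eY2, eB, eT3, eT4]

theorem dens_pwS : dens β w pwS =
    [β * (polyEval cc (β * β) w * (polyEval cH (β * β) w * (3 + -(β * β)))),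
      polyEval cc1 (β * β) w + -((9 + -(β * β)) * (polyEval c1p (β * β) w * polyEval cp (β * β) w)
        * (polyEval cb1 (β * β) w * ((3 + β * β) * (3 + β * β) * polyEval c2p (β * β) w))),
      β * (polyEval ca (β * β) w * (polyEval c2p (β * β) w *
        (polyEval cH (β * β) w * (3 + -(β * β))))),
      (1 + -(β * β)) * (polyEval c2p (β * β) w * polyEval cH (β * β) w *
        (polyEval cH (β * β) w * (3 + -(β * β))))] := by
  simp [dens, pwS, den, eP, eX, eY, eY2, eB, eP0, ePLin, eP2, eP3, eHY2, eY8, eZZ, eY4]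

theorem dens_mp0S : dens β w mp0S =
    [-polyEval cc1 (β * β) w,
      -(β * (polyEval ca (β * β) w * (polyEval c2p (β * β) w *
        (polyEval cH (β * β) w * (3 + -(β * β)))))),
      -((1 + -(β * β)) * (polyEval c2p (β * β) w * polyEval cH (β * β) w *
        (polyEval cH (β * β) w * (3 + -(β * β)))))] := by
  simp [dens, mp0S, den, eP, eX, eY, eY2, eP2, eP3, eHY2]

theorem dens_mtX : dens β w mtX =
    [-(β * ((1 + -(β * β)) * ((1 + -(β * β)) * (1 + -(β * β))) *
        (polyEval c1p (β * β) w * polyEval cp (β * β) w * ((3 + -(β * β)) * (3 + -(β * β)))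
        * polyEval cq0 (β * β) w))),
      (1 + -(β * β)) * (1 + -(β * β)) * (3 + β * β) * polyEval cq1 (β * β) w,
      -(β * ((1 + -(β * β)) * ((3 + β * β) * (3 + β * β)) * polyEval cq2 (β * β) w)),
      (3 + β * β) * ((3 + β * β) * (3 + β * β)) *
        (polyEval c2p (β * β) w * polyEval cq3 (β * β) w),
      -(β * ((3 + β * β) * (3 + β * β) * ((3 + β * β) * (3 + β * β)) *
        (polyEval c2p (β * β) w * polyEval cq4 (β * β) w)))] := by
  simp [dens, mtX, den, eT0, eP, eX, eY, eY2, eB, eT3, eT4, eYY, eY4, eZZ]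

theorem dens_p0X : dens β w p0X =
    [(1 + -(β * β)) * (1 + -(β * β)) *
        (β * (polyEval cc (β * β) w * (polyEval cH (β * β) w * (3 + -(β * β))))),
      -((1 + -(β * β)) * (3 + β * β) * polyEval cc1 (β * β) w),
      (3 + β * β) * (3 + β * β) * (β * (polyEval ca (β * β) w * (polyEval c2p (β * β) w *
        (polyEval cH (β * β) w * (3 + -(β * β)))))),
      -((3 + β * β) * ((3 + β * β) * (3 + β * β)) * (polyEval c2p (β * β) w *
        polyEval cH (β * β) w * (polyEval cH (β * β) w * (3 + -(β * β)))))] := by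
  simp [dens, p0X, den, eP, eX, eY, eY2, eP0, eP2, eP3, eHY2, eYY, eZZ, eY4]

theorem dens_mpwX : dens β w mpwX =
    [-((1 + -(β * β)) * (1 + -(β * β)) *
        (β * (polyEval cc (β * β) w * (polyEval cH (β * β) w * (3 + -(β * β)))))),
      (1 + -(β * β)) * (3 + β * β) *
        (polyEval cc1 (β * β) w + -((9 + -(β * β)) *
          (polyEval c1p (β * β) w * polyEval cp (β * β) w)
        * (polyEval cb1 (β * β) w * ((3 + β * β) * (3 + β * β) * polyEval c2p (β * β) w)))),
      -((3 + β * β) * (3 + β * β) * (β * (polyEval ca (β * β) w * (polyEval c2p (β * β) w *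
        (polyEval cH (β * β) w * (3 + -(β * β))))))),
      (3 + β * β) * ((3 + β * β) * (3 + β * β)) * (polyEval c2p (β * β) w *
        polyEval cH (β * β) w * (polyEval cH (β * β) w * (3 + -(β * β))))] := by
  simp [dens, mpwX, den, eP, eX, eY, eY2, eB, eP0, ePLin, eP2, eP3, eHY2, eY8, eYY, eZZ, eY4]

set_option maxHeartbeats 1000000 in
/-- The criterion `outerGNL_of` in terms of polynomial forms. The equations from `ea'` to `q4'`
express the coefficients of `charS` and of the quartic by the values of the polynomials in `x` and
`ω`; `sep`, `hneg` and `hpos` are the inequalities of `Claims`. At a point where the second or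
third alternative of `hneg` or `hpos` holds, `charS` has no root. -/
theorem outerGNL_of_forms {y hH a1 A a2 vb vc va vc1 v0 v1 v2 v3 v4 a c b₁ c₁ b₂ c₂ v : ℝ}
    (hβ : 0 < β) (hy0 : 0 < y) (n3 : 0 < 4 - y) (kH : 0 < hH) (k1 : 0 < a1)
    (kA : 0 < A) (k2 : 0 < a2) (kb : 0 < vb) (kc : 0 < -vc)
    (ea' : a = β * va / ((4 - y) * hH))
    (ec : c = β * y ^ 2 * vc / ((4 - y) ^ 3 * a2 * hH))
    (eb1 : b₁ = (4 - y) ^ 2 * a1 * A * vb / (hH ^ 2 * (2 + y)))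
    (ec1 : c₁ = y * vc1 / (a2 * (4 - y) ^ 2 * hH ^ 2 * (2 + y)))
    (q0' : -2 * b₁ * c = β * y ^ 2 * a1 * A * v0 / ((4 - y) * a2 * hH ^ 3 * (2 + y)))
    (q1' : c * b₂ - 2 * b₁ * c₁ = y * v1 / ((2 + y) ^ 3 * hH ^ 3 * a2))
    (q2' : c₁ * b₂ - c₂ * b₁ = β * (4 - y) * v2 / ((2 + y) ^ 3 * hH ^ 3 * a2))
    (q3' : 2 * b₁ ^ 2 - 2 * b₁ + a * b₂ = (4 - y) ^ 2 * v3 / (y * hH ^ 3 * (2 + y) ^ 3))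
    (q4' : b₂ = β * (4 - y) ^ 3 * v4 / (y * hH ^ 3 * (2 + y) ^ 3))
    (sep : 0 < (1 + -(1 - y)) * (1 + -(1 - y)) * (β * (vc * (hH * (3 + -(1 - y))))) +
      34 / 64 * (-((1 + -(1 - y)) * (3 + (1 - y)) * vc1) +
        34 / 64 * ((3 + (1 - y)) * (3 + (1 - y)) * (β * (va * (a2 * (hH * (3 + -(1 - y)))))) +
          34 / 64 * (-((3 + (1 - y)) * ((3 + (1 - y)) * (3 + (1 - y))) *
            (a2 * hH * (hH * (3 + -(1 - y))))) + 34 / 64 * 0))))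
    (hneg : ∀ X : ℝ, 34 / 64 ≤ X →
      0 < -(β * ((1 + -(1 - y)) * ((1 + -(1 - y)) * (1 + -(1 - y))) *
          (a1 * A * ((3 + -(1 - y)) * (3 + -(1 - y))) * v0))) +
        X * ((1 + -(1 - y)) * (1 + -(1 - y)) * (3 + (1 - y)) * v1 +
          X * (-(β * ((1 + -(1 - y)) * ((3 + (1 - y)) * (3 + (1 - y))) * v2)) +
            X * ((3 + (1 - y)) * ((3 + (1 - y)) * (3 + (1 - y))) * (a2 * v3) +
              X * (-(β * ((3 + (1 - y)) * (3 + (1 - y)) * ((3 + (1 - y)) * (3 + (1 - y))) *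
                (a2 * v4))) + X * 0)))) ∨
      0 < (1 + -(1 - y)) * (1 + -(1 - y)) * (β * (vc * (hH * (3 + -(1 - y))))) +
      X * (-((1 + -(1 - y)) * (3 + (1 - y)) * vc1) +
        X * ((3 + (1 - y)) * (3 + (1 - y)) * (β * (va * (a2 * (hH * (3 + -(1 - y)))))) +
          X * (-((3 + (1 - y)) * ((3 + (1 - y)) * (3 + (1 - y))) *
            (a2 * hH * (hH * (3 + -(1 - y))))) + X * 0))) ∨
      0 < -((1 + -(1 - y)) * (1 + -(1 - y)) * (β * (vc * (hH * (3 + -(1 - y)))))) +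
        X * ((1 + -(1 - y)) * (3 + (1 - y)) * (vc1 + -((9 + -(1 - y)) * (a1 * A) *
            (vb * ((3 + (1 - y)) * (3 + (1 - y)) * a2)))) +
          X * (-((3 + (1 - y)) * (3 + (1 - y)) * (β * (va * (a2 * (hH * (3 + -(1 - y))))))) +
            X * ((3 + (1 - y)) * ((3 + (1 - y)) * (3 + (1 - y))) *
              (a2 * hH * (hH * (3 + -(1 - y)))) + X * 0))))
    (hpos : ∀ σ : ℝ, 0 ≤ σ →
      0 < β * (a1 * A * ((3 + -(1 - y)) * (3 + -(1 - y))) * v0) +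
        σ * (v1 + σ * (β * v2 + σ * (a2 * v3 + σ * (β * ((1 + -(1 - y)) * (a2 * v4)) + σ * 0)))) ∨
      0 < β * (vc * (hH * (3 + -(1 - y)))) +
        σ * (vc1 + -((9 + -(1 - y)) * (a1 * A) * (vb * ((3 + (1 - y)) * (3 + (1 - y)) * a2))) +
          σ * (β * (va * (a2 * (hH * (3 + -(1 - y))))) +
            σ * ((1 + -(1 - y)) * (a2 * hH * (hH * (3 + -(1 - y)))) + σ * 0))) ∨
      0 < -vc1 + σ * (-(β * (va * (a2 * (hH * (3 + -(1 - y)))))) +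
        σ * (-((1 + -(1 - y)) * (a2 * hH * (hH * (3 + -(1 - y))))) + σ * 0)))
    (hv0 : 0 < v) (hvw : v < y * (8 + y) / (4 - y) ^ 2) : OuterGNL a c b₁ c₁ b₂ c₂ v := by
  have hq : ∀ s, quartic a c b₁ c₁ b₂ c₂ s =
      β * (4 - y) ^ 3 * v4 / (y * hH ^ 3 * (2 + y) ^ 3) * s ^ 4 +
      (4 - y) ^ 2 * v3 / (y * hH ^ 3 * (2 + y) ^ 3) * s ^ 3 +
      β * (4 - y) * v2 / ((2 + y) ^ 3 * hH ^ 3 * a2) * s ^ 2 +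
      y * v1 / ((2 + y) ^ 3 * hH ^ 3 * a2) * s +
      β * y ^ 2 * a1 * A * v0 / ((4 - y) * a2 * hH ^ 3 * (2 + y)) := by
    intro s; unfold quartic
    linear_combination s ^ 4 * q4' + s ^ 3 * q3' + s ^ 2 * q2' + s * q1' + q0'
  have hb : 0 < b₁ := by rw [eb1]; positivity
  have hc0 : c < 0 := by
    have : -c = β * y ^ 2 * -vc / ((4 - y) ^ 3 * a2 * hH) := by rw [ec]; ring
    have : 0 < -c := by rw [this]; positivity
    linarith
  have hD : 0 < (4 - y) ^ 3 * a2 * hH ^ 2 * (2 + y) := by positivity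
  have hF : 0 < a2 * hH ^ 3 * (2 + y) ^ 3 * (4 - y) * y := by positivity
  have hW : ∀ v s, charS a c b₁ c₁ v s =
      charS a c b₁ c₁ (y * (8 + y) / (4 - y) ^ 2) s + (y * (8 + y) / (4 - y) ^ 2 - v) * (b₁ * s) := by
    intro v s; unfold charS; ring
  have h0X : ∀ X, 0 < (1 + -(1 - y)) * (1 + -(1 - y)) * (β * (vc * (hH * (3 + -(1 - y))))) +
      X * (-((1 + -(1 - y)) * (3 + (1 - y)) * vc1) +
        X * ((3 + (1 - y)) * (3 + (1 - y)) * (β * (va * (a2 * (hH * (3 + -(1 - y)))))) +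
          X * (-((3 + (1 - y)) * ((3 + (1 - y)) * (3 + (1 - y))) *
            (a2 * hH * (hH * (3 + -(1 - y))))) + X * 0))) → 0 < charS a c b₁ c₁ 0 (-X) := by
    intro X h
    refine pos_of_mul_pos_right (a := (4 - y) ^ 3 * a2 * hH ^ 2 * (2 + y)) (h.trans_eq ?_) hD.le
    unfold charS; rw [ea', ec, ec1]
    field_simp; ring
  refine outerGNL_of hb hc0 hv0 (m := -(34 / 64)) (by norm_num) (h0X _ sep) ?_ ?_
  · intro s hs hroot
    have hσ : 0 ≤ (4 - y) * s / y := by positivity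
    have es : s = y * ((4 - y) * s / y) / (4 - y) := by field_simp
    generalize (4 - y) * s / y = σ at *
    have hbs : 0 < b₁ * s := mul_pos hb hs
    rcases hpos σ hσ with h | h | h
    · have : 0 < quartic a c b₁ c₁ b₂ c₂ s := by
        refine pos_of_mul_pos_right (a := a2 * hH ^ 3 * (2 + y) ^ 3 * (4 - y) * y)
          ((mul_pos (pow_pos hy0 3) h).trans_eq ?_) hF.le
        rw [hq, es]; field_simp; ring
      rw [← mul_gnl hroot] at this
      exact pos_of_mul_pos_right this hbs.le
    · have : 0 < charS a c b₁ c₁ (y * (8 + y) / (4 - y) ^ 2) s := by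
        refine pos_of_mul_pos_right (a := (4 - y) ^ 3 * a2 * hH ^ 2 * (2 + y))
          ((mul_pos (pow_pos hy0 2) h).trans_eq ?_) hD.le
        unfold charS; rw [ea', ec, ec1, eb1, es]; field_simp; ring
      rw [hW] at hroot
      have := mul_pos (sub_pos.2 hvw) hbs
      linarith
    · have : charS a c b₁ c₁ 0 s ≤ c := by
        have h' : 0 ≤ (4 - y) ^ 3 * a2 * hH ^ 2 * (2 + y) * (c - charS a c b₁ c₁ 0 s) := by
          refine (mul_nonneg (mul_nonneg (pow_pos hy0 2).le hσ) h.le).trans_eq ?_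
          unfold charS; rw [ea', ec1, es]; field_simp; ring
        have := nonneg_of_mul_nonneg_right h' hD
        linarith
      rw [charS_eq] at hroot
      have := mul_pos hv0 hbs
      linarith
  · intro s hs hroot
    obtain ⟨X, rfl⟩ : ∃ X, s = -X := ⟨-s, by ring⟩
    have hX : 34 / 64 ≤ X := by linarith
    have hbs : 0 < b₁ * X := mul_pos hb (by linarith)
    rcases hneg X hX with h | h | h
    · have : 0 < -quartic a c b₁ c₁ b₂ c₂ (-X) := by
        refine pos_of_mul_pos_right (a := a2 * hH ^ 3 * (2 + y) ^ 3 * (4 - y) * y)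
          (h.trans_eq ?_) hF.le
        rw [hq]; field_simp; ring
      rw [← mul_gnl hroot, ← neg_mul, mul_neg, neg_neg] at this
      exact pos_of_mul_pos_right this hbs.le
    · have := h0X X h
      rw [charS_eq] at hroot
      have := mul_pos hv0 hbs
      linarith
    · have : 0 < -charS a c b₁ c₁ (y * (8 + y) / (4 - y) ^ 2) (-X) := by
        refine pos_of_mul_pos_right (a := (4 - y) ^ 3 * a2 * hH ^ 2 * (2 + y))
          (h.trans_eq ?_) hD.le
        unfold charS; rw [ea', ec, ec1, eb1]; field_simp; ring
      rw [hW] at hroot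
      have := mul_pos (sub_pos.2 hvw) hbs
      linarith

set_option maxHeartbeats 1000000 in
/-- The inequalities of `Claims` suffice, if `ω` represents `p`. -/
theorem GNLAt.of_claims {y p : ℝ} (hc : Claims β w) (hβ : 0 < β) (hx : β ^ 2 = 1 - y)
    (hy0 : 0 < y) (hp0 : 0 < p) (hy : y = 1 - β * β)
    (hp : p * pDen (β * β) w = y * polyEval cp (β * β) w) : GNLAt β y p := by
  have hsimple := hc.simple
  have hmem : ∀ e : Ex, e ∈ simpleEx → 0 < e.den β w := hsimple
  have kH : 0 < polyEval cH (β * β) w := hmem (eP cH) (by simp [simpleEx])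
  have k1 : 0 < polyEval c1p (β * β) w := hmem (eP c1p) (by simp [simpleEx])
  have kA : 0 < polyEval cp (β * β) w := hmem (eP cp) (by simp [simpleEx])
  have k2 : 0 < polyEval c2p (β * β) w := hmem (eP c2p) (by simp [simpleEx])
  have kb : 0 < polyEval cb1 (β * β) w := hmem (eP cb1) (by simp [simpleEx])
  have kc : 0 < -polyEval cc (β * β) w := hmem (neg (eP cc)) (by simp [simpleEx])
  have sep := hc.sep
  have hneg := hc.neg_root
  have hpos := hc.pos_root
  simp only [dens_tS, dens_pwS, dens_mp0S, dens_mtX, dens_p0X, dens_mpwX, horner_cons, horner_nil,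
    List.mem_cons, List.not_mem_nil, or_false, exists_eq_or_imp, exists_eq_left] at sep hneg hpos
  have hB : 0 < pDen (β * β) w := by
    have : 0 < p * pDen (β * β) w := by rw [hp]; positivity
    exact (pos_iff_pos_of_mul_pos this).1 hp0
  have x0 : 0 < β * β := by positivity
  have r1 := one_sub_p_mul hy hp
  have r2 := two_add_p_mul hy hp
  have rH := H_mul_sq hy hp
  have ra := nA_mul_pow hy hp
  have rc := nC_mul_pow hy hp
  have rc1 := nC1_mul_pow hy hp
  have rb1 := nB1_mul_pow hy hp
  have rq0 := nQ0_mul_pow hy hp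
  have rq1 := nQ1_mul_pow hy hp
  have rq2 := nQ2_mul_pow hy hp
  have rq3 := nQ3_mul_pow hy hp
  have rq4 := nB2_mul_pow hy hp
  have eβ : β * β = 1 - y := by linarith
  have n3 : 0 < 4 - y := by nlinarith
  have n4 : 0 < 2 + y := by linarith
  have n5 : 0 < 1 - y := by linarith
  have n6 : 0 < 8 + y := by linarith
  generalize polyEval cH (β * β) w = hH at *
  generalize polyEval c1p (β * β) w = a1 at *
  generalize polyEval cp (β * β) w = A at *
  generalize polyEval c2p (β * β) w = a2 at *
  generalize polyEval cb1 (β * β) w = vb at *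
  generalize polyEval cc (β * β) w = vc at *
  generalize polyEval ca (β * β) w = va at *
  generalize polyEval cc1 (β * β) w = vc1 at *
  generalize polyEval cq0 (β * β) w = v0 at *
  generalize polyEval cq1 (β * β) w = v1 at *
  generalize polyEval cq2 (β * β) w = v2 at *
  generalize polyEval cq3 (β * β) w = v3 at *
  generalize polyEval cq4 (β * β) w = v4 at *
  generalize pDen (β * β) w = B at *
  rw [eβ] at *
  have ep : p = y * A / B := by rw [eq_div_iff hB.ne']; exact hp
  have e1 : 1 - p = (1 - y) * a1 / B := by rw [eq_div_iff hB.ne']; exact r1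
  have e2 : 2 + p = a2 / B := by rw [eq_div_iff hB.ne']; exact r2
  have eH : y - p ^ 2 = y * (1 - y) * hH / B ^ 2 := by
    rw [eq_div_iff (by positivity)]; exact rH
  rw [← eq_div_iff (by positivity)] at ra rc rc1 rb1 rq0 rq1 rq2 rq3 rq4
  have n1 : 2 + p ≠ 0 := by positivity
  have n2 : y - p ^ 2 ≠ 0 := by rw [eH]; positivity
  have q0 := quartic_coeff_zero hβ.ne' hy0.ne' n5.ne' n4.ne' n3.ne' n1 n2
  have q1 := quartic_coeff_one hx hy0.ne' n5.ne' n4.ne' n3.ne' n1 n2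
  have q2 := quartic_coeff_two hβ.ne' hy0.ne' n5.ne' n4.ne' n3.ne' n1 n2
  have q3 := quartic_coeff_three hx hy0.ne' n5.ne' n4.ne' n3.ne' n2
  have q4 : fB2 y p / β = (4 - y) ^ 3 * nB2 y p / (y * (2 + y) ^ 3 * (y - p ^ 2) ^ 3 * (1 - y) * β)
      := by rw [fB2, div_div]
  have ea := aux_a hβ.ne' hx n3.ne' n2
  rw [rq0] at q0; rw [rq1] at q1; rw [rq2] at q2; rw [rq3] at q3; rw [rq4] at q4
  rw [ra] at ea q3
  have eb1 : fB1 y p = (4 - y) ^ 2 * a1 * A * vb / (hH ^ 2 * (2 + y)) := by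
    rw [fB1, rb1, eH, e1, ep]; field_simp
  have ec : fC y p / β = β * y ^ 2 * vc / ((4 - y) ^ 3 * a2 * hH) := by
    rw [fC, rc, eH, e2]; field_simp; rw [hx]; ring
  have ec1 : fC1 y p = y * vc1 / (a2 * (4 - y) ^ 2 * hH ^ 2 * (2 + y)) := by
    rw [fC1, rc1, eH, e2]; field_simp
  rw [eH] at ea
  have ea' : 3 * (4 * β / (3 + β ^ 2)) - fB y p / β = β * va / ((4 - y) * hH) := by
    rw [ea]; field_simp; rw [hx]; ring
  have q0' : -2 * fB1 y p * (fC y p / β) = β * y ^ 2 * a1 * A * v0 /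
      ((4 - y) * a2 * hH ^ 3 * (2 + y)) := by
    rw [q0, eH, e1, e2, ep]; field_simp; rw [hx]; ring
  have q1' : fC y p / β * (fB2 y p / β) - 2 * fB1 y p * fC1 y p =
      y * v1 / ((2 + y) ^ 3 * hH ^ 3 * a2) := by
    rw [q1, eH, e2]; field_simp
  have q2' : fC1 y p * (fB2 y p / β) - fC2 y p / β * fB1 y p =
      β * (4 - y) * v2 / ((2 + y) ^ 3 * hH ^ 3 * a2) := by
    rw [q2, eH, e2]; field_simp; rw [hx]; ring
  have q4' : fB2 y p / β = β * (4 - y) ^ 3 * v4 / (y * hH ^ 3 * (2 + y) ^ 3) := by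
    rw [q4, eH]; field_simp; rw [hx]; ring
  have q3' : 2 * fB1 y p ^ 2 - 2 * fB1 y p +
      (3 * (4 * β / (3 + β ^ 2)) - fB y p / β) * (fB2 y p / β) =
      (4 - y) ^ 2 * v3 / (y * hH ^ 3 * (2 + y) ^ 3) := by
    rw [ea, ← eH, q3, eH]; field_simp
  intro v hv0 hvw
  exact outerGNL_of_forms hβ hy0 n3 kH k1 kA k2 kb kc ea' ec eb1 ec1 q0' q1' q2' q3' q4'
    sep hneg hpos hv0 hvw

end
end M1P

/-! ### The continued fraction of `artanh β / β` -/

open MeasureTheory Set Filter Topology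

namespace M1P
open Encl Ex

/-- The tails `u_n = (2 n + 1) - (n + 1) ^ 2 x / u_{n + 1}` of the continued fraction of
`β / artanh β`, `x = β ^ 2`, computed downwards (`n = 16 - j`) from the approximation
`u_16 = 33 - κ x`. -/
noncomputable def cfTail (κ : ℝ) : ℕ → ℝ → ℝ
  | 0, x => 33 - κ * x
  | j + 1, x => 2 * (15 - j) + 1 - (16 - j) ^ 2 * x / cfTail κ j x

/-- The defect of `u` in the Riccati equation of the `n`-th tail. -/
def riccati (n x u d : ℝ) : ℝ := 2 * x * (1 - x) * d + u ^ 2 - (2 * n + 1 - x) * u + n ^ 2 * x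

theorem cfTail_gt {κ x : ℝ} (hx0 : 0 ≤ x) (hx1 : x ≤ 1) (hκ : κ * x < 17) :
    ∀ j : ℕ, j ≤ 16 → (16 - j : ℝ) < cfTail κ j x := by
  intro j
  induction j with
  | zero => intro _; simp only [cfTail]; push_cast; linarith
  | succ j ih =>
    intro hj
    have h := ih (by omega)
    have hj' : (j : ℝ) ≤ 15 := by exact_mod_cast (by omega : j ≤ 15)
    simp only [cfTail]
    have h0 : 0 < cfTail κ j x := by linarith
    have : (16 - j) ^ 2 * x / cfTail κ j x < 16 - j ∨ x = 0 := by
      rcases eq_or_lt_of_le hx0 with h | h'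
      · exact Or.inr h.symm
      · left
        rw [div_lt_iff₀ h0]
        have h1 : (16 - j : ℝ) ^ 2 * x ≤ (16 - j) ^ 2 := by
          have := mul_le_mul_of_nonneg_left hx1 (sq_nonneg (16 - j : ℝ)); linarith
        have h2 : (16 - j : ℝ) * (16 - j) < (16 - j) * cfTail κ j x :=
          mul_lt_mul_of_pos_left h (by linarith)
        nlinarith
    push_cast
    rcases this with h | rfl
    · linarith
    · simp; linarith

/-- The sign of the Riccati defect is inherited by the next tail. -/
theorem cfTail_riccati {κ σ X : ℝ} (hX : X ≤ 1) (hκ : ∀ x ∈ Icc 0 X, κ * x < 17)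
    (hσ : ∀ x ∈ Icc 0 X, 0 ≤ σ * riccati 16 x (33 - κ * x) (-κ)) :
    ∀ j : ℕ, j ≤ 16 → ∀ x ∈ Icc 0 X, ∃ d, HasDerivAt (cfTail κ j) d x ∧
      0 ≤ σ * riccati (16 - j) x (cfTail κ j x) d := by
  intro j
  induction j with
  | zero =>
    intro _ x hx
    refine ⟨-κ, ?_, by simpa [cfTail] using hσ x hx⟩
    have : HasDerivAt (fun x : ℝ => 33 - κ * x) (-κ) x := by
      simpa using ((hasDerivAt_id x).const_mul κ).const_sub 33
    exact this
  | succ j ih =>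
    intro hj x hx
    obtain ⟨d, hd, hs⟩ := ih (by omega) x hx
    have hj' : (j : ℝ) ≤ 15 := by exact_mod_cast (by omega : j ≤ 15)
    have h0 : 0 < cfTail κ j x := by
      have := cfTail_gt hx.1 (hx.2.trans hX) (hκ x hx) j (by omega)
      linarith
    have hd' : HasDerivAt (cfTail κ (j + 1)) _ x :=
      (((hasDerivAt_id' x).const_mul ((16 - j : ℝ) ^ 2)).fun_div hd h0.ne').const_sub
        (2 * (15 - j : ℝ) + 1)
    refine ⟨_, hd', ?_⟩
    have e : riccati (16 - (j + 1 : ℕ)) x (cfTail κ (j + 1) x)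
        (-(((16 - j : ℝ) ^ 2 * 1 * cfTail κ j x - (16 - j : ℝ) ^ 2 * x * d) / cfTail κ j x ^ 2)) =
        (16 - j : ℝ) ^ 2 * x / cfTail κ j x ^ 2 * riccati (16 - j) x (cfTail κ j x) d := by
      simp only [cfTail, riccati]; push_cast; field_simp; ring
    rw [e, mul_left_comm]
    exact mul_nonneg (div_nonneg (mul_nonneg (sq_nonneg _) hx.1) (sq_nonneg _)) hs

theorem nonneg_of_deriv_nonneg {f f' : ℝ → ℝ} (h0 : f 0 = 0) {c : ℝ} (hc : ContinuousAt f 0)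
    (hf : ∀ b ∈ Ioc (0 : ℝ) c, HasDerivAt f (f' b) b) (hpos : ∀ b ∈ Ioo (0 : ℝ) c, 0 ≤ f' b)
    (hc0 : 0 ≤ c) : 0 ≤ f c := by
  have hcont : ContinuousOn f (Icc 0 c) := by
    intro b hb
    rcases eq_or_lt_of_le hb.1 with rfl | h
    · exact hc.continuousWithinAt
    · exact (hf b ⟨h, hb.2⟩).continuousAt.continuousWithinAt
  have := monotoneOn_of_deriv_nonneg (convex_Icc 0 c) hcont (by
    rw [interior_Icc]
    exact fun b hb => (hf b ⟨hb.1, hb.2.le⟩).differentiableAt.differentiableWithinAt) (by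
    intro b hb
    rw [interior_Icc] at hb
    rw [(hf b ⟨hb.1, hb.2.le⟩).deriv]
    exact hpos b hb)
  have h := this (left_mem_Icc.2 hc0) (right_mem_Icc.2 hc0) hc0
  rwa [h0] at h

/-- An approximation of a tail whose Riccati defect has a sign bounds `ℓ` on one side. -/
theorem cfTail_bound {κ σ β : ℝ} (hβ : β ∈ Ioo (0 : ℝ) 1) (hκ : ∀ x ∈ Icc 0 (β ^ 2), κ * x < 17)
    (hσ : ∀ x ∈ Icc 0 (β ^ 2), 0 ≤ σ * riccati 16 x (33 - κ * x) (-κ)) :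
    0 ≤ σ * (ell β * cfTail κ 16 (β ^ 2) - 1) := by
  have hX : β ^ 2 ≤ 1 := by nlinarith [hβ.1, hβ.2]
  have hr := cfTail_riccati hX hκ hσ 16 le_rfl
  have hpos : ∀ x ∈ Icc 0 (β ^ 2), 0 < cfTail κ 16 x := by
    intro x hx
    have := cfTail_gt hx.1 (hx.2.trans hX) (hκ x hx) 16 le_rfl
    norm_num at this; exact this
  have hd : ∀ x ∈ Icc 0 (β ^ 2), DifferentiableAt ℝ (cfTail κ 16) x :=
    fun x hx => (hr x hx).choose_spec.1.differentiableAt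
  have hmem : ∀ b ∈ Icc (0 : ℝ) β, b ^ 2 ∈ Icc 0 (β ^ 2) :=
    fun b hb => ⟨sq_nonneg b, by nlinarith [hb.1, hb.2]⟩
  have h0 : (0 : ℝ) ∈ Icc (0 : ℝ) β := ⟨le_rfl, hβ.1.le⟩
  have key := nonneg_of_deriv_nonneg
    (f := fun b => σ * (b * ell b - b / cfTail κ 16 (b ^ 2)))
    (f' := fun b => σ * (1 / (1 - b ^ 2) - (1 * cfTail κ 16 (b ^ 2)
      - b * (deriv (cfTail κ 16) (b ^ 2) * (2 * b))) / cfTail κ 16 (b ^ 2) ^ 2))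
    (c := β) (by simp) ?_ ?_ ?_ hβ.1.le
  · have e : σ * (β * ell β - β / cfTail κ 16 (β ^ 2)) =
        σ * (ell β * cfTail κ 16 (β ^ 2) - 1) * (β / cfTail κ 16 (β ^ 2)) := by
      have := (hpos _ (hmem β ⟨hβ.1.le, le_rfl⟩)).ne'
      field_simp
    simp only [e] at key
    exact nonneg_of_mul_nonneg_left key (div_pos hβ.1 (hpos _ (hmem β ⟨hβ.1.le, le_rfl⟩)))
  · refine ContinuousAt.mul continuousAt_const ((continuousAt_id.mul (continuousAt_ell
      (by simp))).sub (continuousAt_id.div ?_ (hpos _ (hmem 0 h0)).ne'))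
    exact ContinuousAt.comp (f := fun b : ℝ => b ^ 2) (hd _ (hmem 0 h0)).continuousAt (by fun_prop)
  · intro b hb
    have hb' : b ∈ Icc (0 : ℝ) β := ⟨hb.1.le, hb.2⟩
    refine ((hasDerivAt_mul_ell ⟨hb.1, hb.2.trans_lt hβ.2⟩).fun_sub
      ((hasDerivAt_id' b).fun_div ?_ (hpos _ (hmem b hb')).ne')).const_mul σ
    exact (HasDerivAt.comp (h := fun b : ℝ => b ^ 2) b (hd _ (hmem b hb')).hasDerivAt
      ((hasDerivAt_id' b).fun_pow 2)).congr_deriv (by simp)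
  · intro b hb
    have hb' : b ∈ Icc (0 : ℝ) β := ⟨hb.1.le, hb.2.le⟩
    obtain ⟨d, hd1, hs⟩ := hr _ (hmem b hb')
    rw [hd1.deriv]
    have h1 : 0 < 1 - b ^ 2 := by nlinarith [hb.1, hb.2, hβ.2]
    have h2 := hpos _ (hmem b hb')
    have e : σ * (1 / (1 - b ^ 2) - (1 * cfTail κ 16 (b ^ 2)
      - b * (d * (2 * b))) / cfTail κ 16 (b ^ 2) ^ 2) =
      σ * riccati (16 - (16 : ℕ)) (b ^ 2) (cfTail κ 16 (b ^ 2)) d /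
        ((1 - b ^ 2) * cfTail κ 16 (b ^ 2) ^ 2) := by
      simp only [riccati]; push_cast; field_simp; ring
    rw [e]; positivity

theorem cfTail_anti {κ κ' x : ℝ} (hx0 : 0 ≤ x) (hx1 : x ≤ 1) (hκ : κ ≤ κ') (h : κ' * x < 17) :
    ∀ j : ℕ, j ≤ 16 → cfTail κ' j x ≤ cfTail κ j x := by
  intro j
  induction j with
  | zero => intro _; simp only [cfTail]; nlinarith
  | succ j ih =>
    intro hj
    have hj' : (j : ℝ) ≤ 15 := by exact_mod_cast (by omega : j ≤ 15)
    have h0 := cfTail_gt hx0 hx1 h j (by omega)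
    simp only [cfTail]
    have : 0 < cfTail κ' j x := by linarith
    gcongr
    exact ih (by omega)

/-- The numerators of the tails: `cfTail κ j x = cfNum κ x (j + 1) / cfNum κ x j`. -/
noncomputable def cfNum (κ x : ℝ) : ℕ → ℝ
  | 0 => 1
  | 1 => 33 - κ * x
  | j + 2 => (2 * (15 - j) + 1) * cfNum κ x (j + 1) - (16 - j) ^ 2 * x * cfNum κ x j

theorem cfTail_mul_cfNum {κ x : ℝ} (hx0 : 0 ≤ x) (hx1 : x ≤ 1) (h : κ * x < 17) :
    ∀ j : ℕ, j ≤ 16 → cfTail κ j x * cfNum κ x j = cfNum κ x (j + 1) ∧ 0 < cfNum κ x j := by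
  intro j
  induction j with
  | zero => intro _; simp [cfTail, cfNum]
  | succ j ih =>
    intro hj
    obtain ⟨h1, h2⟩ := ih (by omega)
    have hj' : (j : ℝ) ≤ 15 := by exact_mod_cast (by omega : j ≤ 15)
    have h0 : 0 < cfTail κ j x := by
      have := cfTail_gt hx0 hx1 h j (by omega); linarith
    refine ⟨?_, by rw [← h1]; positivity⟩
    rw [cfNum, cfTail, ← h1]
    field_simp

/-- The fourth tail expressed through the parameter `ω = 25 / u_5`. -/
theorem cfTail_twelve {κ x : ℝ} (hx0 : 0 ≤ x) (hx1 : x ≤ 1) (h : κ * x < 17) {u : ℝ}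
    (hu : u = 9 - 25 * cfNum κ x 11 / cfNum κ x 12 * x) : cfTail κ 12 x = u := by
  obtain ⟨h1, h2⟩ := cfTail_mul_cfNum hx0 hx1 h 11 (by norm_num)
  obtain ⟨-, h3⟩ := cfTail_mul_cfNum hx0 hx1 h 12 (by norm_num)
  have h4 : cfTail κ 11 x = cfNum κ x 12 / cfNum κ x 11 := by rw [eq_div_iff h2.ne', h1]
  rw [cfTail, h4, hu]
  push_cast
  field_simp
  ring

/-- The sign of `y A - p B` decides on which side of the convergent `ℓ` lies. -/
theorem convergent_sign {κ β w : ℝ} (hβ : β ∈ Ioo (0 : ℝ) 1) (h : κ * (β * β) < 17)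
    (hw : w = 25 * cfNum κ (β * β) 11 / cfNum κ (β * β) 12) :
    ∃ K > 0, ell β * cfTail κ 16 (β ^ 2) - 1 =
      K * (pF β * pDen (β * β) w - yF β * polyEval cp (β * β) w) := by
  have hx0 : 0 ≤ β * β := by nlinarith [hβ.1]
  have hx1 : β * β ≤ 1 := by nlinarith [hβ.1, hβ.2]
  have hg := fun j hj => cfTail_gt hx0 hx1 h j hj
  have g12 := hg 12 (by norm_num)
  have g13 := hg 13 (by norm_num)
  have g14 := hg 14 (by norm_num)
  have g15 := hg 15 (by norm_num)
  have e12 := cfTail_twelve hx0 hx1 h (u := 9 - w * (β * β)) (by rw [hw])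
  have e13 : cfTail κ 13 (β * β) = 7 - 16 * (β * β) / (9 - w * (β * β)) := by
    rw [cfTail, e12]; norm_num
  have e14 : cfTail κ 14 (β * β) = 5 - 9 * (β * β) / cfTail κ 13 (β * β) := by
    rw [cfTail]; norm_num
  have e15 : cfTail κ 15 (β * β) = 3 - 4 * (β * β) / cfTail κ 14 (β * β) := by
    rw [cfTail]; norm_num
  have e16 : cfTail κ 16 (β * β) = 1 - (β * β) / cfTail κ 15 (β * β) := by
    rw [cfTail]; norm_num
  obtain ⟨u, hu⟩ : ∃ u, u = 9 - w * (β * β) := ⟨_, rfl⟩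
  rw [← hu] at e12 e13
  rw [e12] at g12
  push_cast at g12 g13 g14 g15
  have u0 : 0 < u := by linarith
  have t3 : 0 < cfTail κ 13 (β * β) := by linarith
  have t2 : 0 < cfTail κ 14 (β * β) := by linarith
  have t1 : 0 < cfTail κ 15 (β * β) := by linarith
  have m3 : cfTail κ 13 (β * β) * u = 7 * u - 16 * (β * β) := by rw [e13]; field_simp
  have m2 : cfTail κ 14 (β * β) * (7 * u - 16 * (β * β)) =
      35 * u - 80 * (β * β) - 9 * (β * β) * u := by
    have : cfTail κ 14 (β * β) * cfTail κ 13 (β * β) = 5 * cfTail κ 13 (β * β) - 9 * (β * β) := by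
      rw [e14, sub_mul, div_mul_cancel₀ _ t3.ne']
    rw [← m3]; linear_combination u * this + 5 * m3
  have m1 : cfTail κ 15 (β * β) * (35 * u - 80 * (β * β) - 9 * (β * β) * u) =
      105 * u - 240 * (β * β) - 55 * (β * β) * u + 64 * (β * β) ^ 2 := by
    have : cfTail κ 15 (β * β) * cfTail κ 14 (β * β) = 3 * cfTail κ 14 (β * β) - 4 * (β * β) := by
      rw [e15, sub_mul, div_mul_cancel₀ _ t2.ne']
    rw [← m2]; linear_combination (7 * u - 16 * (β * β)) * this + 3 * m2
  obtain ⟨C, hC⟩ : ∃ C, C = 105 * u - 240 * (β * β) - 55 * (β * β) * u + 64 * (β * β) ^ 2 :=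
    ⟨_, rfl⟩
  have m0 : cfTail κ 16 (β * β) * C = C - β * β * (35 * u - 80 * (β * β) - 9 * (β * β) * u) := by
    have : cfTail κ 16 (β * β) * cfTail κ 15 (β * β) = cfTail κ 15 (β * β) - β * β := by
      rw [e16, sub_mul, div_mul_cancel₀ _ t1.ne', one_mul]
    rw [hC, ← m1]
    linear_combination (35 * u - 80 * (β * β) - 9 * (β * β) * u) * this
  have C0 : 0 < C := by rw [hC, ← m1, ← m2, ← m3]; positivity
  have hl := mul_ell_lt_one hβ
  obtain ⟨hy0, -⟩ := yF_mem hβ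
  have l0 : 0 < 1 - yF β * ell β := by linarith
  refine ⟨(1 - yF β * ell β) / (yF β * C), by positivity, ?_⟩
  have hp : pF β * (1 - yF β * ell β) = 2 * yF β * (ell β - 1) := by
    rw [pF, div_mul_cancel₀ _ l0.ne']
  have hA : polyEval cp (β * β) w = 35 * u - 80 * (β * β) - 9 * (β * β) * u := by
    simp only [polyEval, polyEval1, cp, List.foldr_cons, List.foldr_nil, hu]; push_cast; ring
  have hB : 2 * pDen (β * β) w = C - (35 * u - 80 * (β * β) - 9 * (β * β) * u) := by
    rw [hC, pDen, hu]; ring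
  have e : ell β * cfTail κ 16 (β ^ 2) - 1 =
      (ell β * (cfTail κ 16 (β * β) * C) - C) / C := by rw [sq]; field_simp
  rw [e, m0, hA, div_mul_eq_mul_div, div_eq_div_iff C0.ne' (by positivity)]
  have hyx : β * β = 1 - yF β := by rw [yF]; ring
  generalize 35 * u - 80 * (β * β) - 9 * (β * β) * u = A at *
  generalize pDen (β * β) w = B at *
  rw [hyx]
  obtain rfl : C = 2 * B + A := by linarith
  linear_combination (-(2 * B + A) * B) * hp

/-- The number `ω` that represents `p` lies between two convergents, by the intermediate value
theorem: `p * pDen - y * cp` is affine in `ω` and, by `cfTail_bound` and `convergent_sign`,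
changes its sign between them. It is the tail `ω` of the continued fraction of `β / artanh β` with
`u_4 = 9 - ω x`. The constants `κ = 289 / 35` and `κ = 1407 / 100` are chosen so that the Riccati
defect of `33 - κ x` has a constant sign on `0 ≤ x ≤ (1003 / 1024) ^ 2`. -/
theorem exists_omega {β : ℝ} (hβ : β ∈ Ioo (0 : ℝ) 1) (hβ' : β ≤ 1003 / 1024) :
    ∃ w, pF β * pDen (β * β) w = yF β * polyEval cp (β * β) w ∧
      polyEval cLoN (1 - β ^ 2) 0 ≤ w * polyEval cLoD (1 - β ^ 2) 0 ∧
      w * polyEval cHiD (1 - β ^ 2) 0 ≤ polyEval cHiN (1 - β ^ 2) 0 := by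
  have hx : β ^ 2 ≤ (1003 / 1024) ^ 2 := by gcongr; exact hβ.1.le
  have hx0 : 0 ≤ β * β := by nlinarith [hβ.1]
  have hx1 : β * β ≤ 1 := by nlinarith [hβ.1, hβ.2]
  have k1 : ∀ x ∈ Icc 0 (β ^ 2), (289 / 35 : ℝ) * x < 17 := fun x hx' => by
    linarith [hx'.2, sq β]
  have k2 : ∀ x ∈ Icc 0 (β ^ 2), (1407 / 100 : ℝ) * x < 17 := fun x hx' => by
    linarith [hx'.2, sq β]
  have b1 := cfTail_bound (σ := 1) hβ k1 (by
    intro x hx'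
    have e : 1 * riccati 16 x (33 - 289 / 35 * x) (-(289 / 35)) =
        289 / 35 * (289 / 35 + 1) * x ^ 2 := by unfold riccati; ring
    rw [e]; positivity)
  have b2 := cfTail_bound (σ := -1) hβ k2 (by
    intro x hx'
    have e : -1 * riccati 16 x (33 - 1407 / 100 * x) (-(1407 / 100)) =
        x * (35 * (1407 / 100) - 289 - 1407 / 100 * (1407 / 100 + 1) * x) := by
      unfold riccati; ring
    rw [e]
    refine mul_nonneg hx'.1 ?_
    have : x ≤ (1003 / 1024) ^ 2 := hx'.2.trans hx
    norm_num at this ⊢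
    linarith)
  have k1' := k1 (β * β) ⟨hx0, by rw [sq]⟩
  have k2' := k2 (β * β) ⟨hx0, by rw [sq]⟩
  obtain ⟨lo, hlo⟩ : ∃ w, w = 25 * cfNum (289 / 35) (β * β) 11 / cfNum (289 / 35) (β * β) 12 :=
    ⟨_, rfl⟩
  obtain ⟨hi, hhi⟩ : ∃ w, w = 25 * cfNum (1407 / 100) (β * β) 11 / cfNum (1407 / 100) (β * β) 12 :=
    ⟨_, rfl⟩
  obtain ⟨K1, K1p, c1⟩ := convergent_sign hβ k1' hlo
  obtain ⟨K2, K2p, c2⟩ := convergent_sign hβ k2' hhi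
  rw [c1, one_mul] at b1
  rw [c2, neg_one_mul, ← mul_neg] at b2
  have s1 := nonneg_of_mul_nonneg_right b1 K1p
  have s2 := nonneg_of_mul_nonneg_right b2 K2p
  obtain ⟨p1, p1'⟩ := cfTail_mul_cfNum hx0 hx1 k1' 12 (by norm_num)
  obtain ⟨p2, p2'⟩ := cfTail_mul_cfNum hx0 hx1 k2' 12 (by norm_num)
  have hle : lo ≤ hi := by
    have h1 := cfTail_twelve hx0 hx1 k1' (u := 9 - lo * (β * β)) (by rw [hlo])
    have h2 := cfTail_twelve hx0 hx1 k2' (u := 9 - hi * (β * β)) (by rw [hhi])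
    have h3 := cfTail_anti hx0 hx1 (by norm_num : (289 / 35 : ℝ) ≤ 1407 / 100) k2' 12 (by norm_num)
    rw [h1, h2] at h3
    have hpos : 0 < β * β := mul_pos hβ.1 hβ.1
    exact le_of_mul_le_mul_right (by linarith) hpos
  have hcont : Continuous fun w => pF β * pDen (β * β) w - yF β * polyEval cp (β * β) w := by
    simp only [pDen, polyEval, polyEval1, cp, List.foldr_cons, List.foldr_nil]
    fun_prop
  obtain ⟨w, ⟨hw1, hw2⟩, hw⟩ := intermediate_value_Icc' hle hcont.continuousOn
    (⟨by linarith, s1⟩ : (0 : ℝ) ∈ Icc _ _)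
  have n1 : polyEval cLoN (1 - β ^ 2) 0 = 5 / 729 * cfNum (289 / 35) (β * β) 11 := by
    simp only [polyEval, polyEval1, cLoN, cfNum, List.foldr_cons, List.foldr_nil]
    push_cast; ring
  have n2 : polyEval cLoD (1 - β ^ 2) 0 = 1 / 3645 * cfNum (289 / 35) (β * β) 12 := by
    simp only [polyEval, polyEval1, cLoD, cfNum, List.foldr_cons, List.foldr_nil]
    push_cast; ring
  have n3 : polyEval cHiN (1 - β ^ 2) 0 = 100 / 189 * cfNum (1407 / 100) (β * β) 11 := by
    simp only [polyEval, polyEval1, cHiN, cfNum, List.foldr_cons, List.foldr_nil]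
    push_cast; ring
  have n4 : polyEval cHiD (1 - β ^ 2) 0 = 4 / 189 * cfNum (1407 / 100) (β * β) 12 := by
    simp only [polyEval, polyEval1, cHiD, cfNum, List.foldr_cons, List.foldr_nil]
    push_cast; ring
  refine ⟨w, sub_eq_zero.1 hw, ?_, ?_⟩
  · rw [n1, n2]
    rw [hlo, div_le_iff₀ p1'] at hw1
    linarith
  · rw [n3, n4]
    rw [hhi, le_div_iff₀ p2'] at hw2
    linarith

theorem GNLAt.of_le {β : ℝ} (hβ : β ∈ Ioo (0 : ℝ) 1) (hβ' : β ≤ 1003 / 1024) :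
    GNLAt β (yF β) (pF β) := by
  obtain ⟨w, hw, h1, h2⟩ := exists_omega hβ hβ'
  have hc : Claims β w := by
    by_cases c1 : 2 ^ 10 * β ≤ 378
    · exact chainCheck_sound chainCheck_0 (by simpa using hβ.1) (by norm_num at c1 ⊢; linarith) h1 h2
    by_cases c2 : 2 ^ 10 * β ≤ 682
    · exact chainCheck_sound chainCheck_378 (by push_cast; linarith)
        (by norm_num at c2 ⊢; linarith) h1 h2
    by_cases c3 : 2 ^ 10 * β ≤ 850
    · exact chainCheck_sound chainCheck_682 (by push_cast; linarith)
        (by norm_num at c3 ⊢; linarith) h1 h2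
    by_cases c4 : 2 ^ 10 * β ≤ 938
    · exact chainCheck_sound chainCheck_850 (by push_cast; linarith)
        (by norm_num at c4 ⊢; linarith) h1 h2
    by_cases c5 : 2 ^ 10 * β ≤ 985
    · exact chainCheck_sound chainCheck_938 (by push_cast; linarith)
        (by norm_num at c5 ⊢; linarith) h1 h2
    · exact chainCheck_sound chainCheck_985 (by push_cast; linarith)
        (by norm_num at hβ' ⊢; linarith) h1 h2
  exact GNLAt.of_claims hc hβ.1 (by rw [yF]; ring) (yF_mem hβ).1 (pF_pos hβ) (by rw [yF]; ring) hw

end M1P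

/-! ### The quartic near `β = 1`

As `β → 1`, the numbers `n = y / p` and `g = p ^ 3 / y ^ 2` tend to `0` and decrease, and
`y = g n ^ 3`, `p = g n ^ 2`. The polynomials below are listed by the powers of `g`, and then by the
powers of `n`. -/

namespace M1P
open Encl Ex

/-- `nB1` in `n` and `g`, without a monomial factor. -/
def nrB1 : List (List ℤ) :=
  [[1, -3], [0, 0, 2]]

/-- `-nC` in `n` and `g`, without a monomial factor. -/
def nrC : List (List ℤ) :=
  [[24], [0, 0, -60, -48], [0, 0, 0, 48, 30, 6, 6], [0, 0, 0, 0, 0, 0, -3, -3]]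

/-- `charS` at `v = 0`, `s = -1 / (2 β)`, without a positive factor. -/
def nrSep : List (List ℤ) :=
  [[256], [0, 0, -384, -2752], [0, 0, -256, 512, 2816, 7200, 3216], [0, 0, 0, 0, -128, -832,
  -10112, -4352, -6936, -2404], [0, 0, 0, 0, 0, 0, 0, 4064, 1712, 9216, 4080, 1590, 562], [0, 0,
  0, 0, 0, 0, 0, 0, 0, 0, -3528, -1820, -1400, -824, -639, -384], [0, 0, 0, 0, 0, 0, 0, 0, 0, 0,
  0, 0, 0, 314, 274, 890, 620, 60, 48], [0, 0, 0, 0, 0, 0, 0, 0, 0, 0, 0, 0, 0, 0, 0, 0, -341,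
  -236, -78, -72], [0, 0, 0, 0, 0, 0, 0, 0, 0, 0, 0, 0, 0, 0, 0, 0, 0, 0, 0, 24, 24]]

/-- `charS` at `v = 0`, `s = -(1 + 3 y) / β`, without a positive factor. -/
def nrFar : List (List ℤ) :=
  [[512, -512, -3456], [0, -512, 768, 8448, -448, -16320], [0, 0, 0, -256, -5376, 1536, 32608,
  -3840, -17472], [0, 0, 0, 0, 0, 0, -512, -17152, 9744, 34600, -20056, 1296], [0, 0, 0, 0, 0, 0,
  0, 0, 0, -4800, -16336, 34548, -4158, 6718, 4836], [0, 0, 0, 0, 0, 0, 0, 0, 0, 0, 0, 0, -16112,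
  2652, -10383, -8581, 1200, -1392], [0, 0, 0, 0, 0, 0, 0, 0, 0, 0, 0, 0, 0, 0, 0, 4376, 3763,
  -3030, 2541, -612, 108], [0, 0, 0, 0, 0, 0, 0, 0, 0, 0, 0, 0, 0, 0, 0, 0, 0, 0, 1698, -1149,
  1269, -198, 54], [0, 0, 0, 0, 0, 0, 0, 0, 0, 0, 0, 0, 0, 0, 0, 0, 0, 0, 0, 0, 0, -648, 90,
  -108], [0, 0, 0, 0, 0, 0, 0, 0, 0, 0, 0, 0, 0, 0, 0, 0, 0, 0, 0, 0, 0, 0, 0, 0, 54]]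

/-- `gnl` at `v = 0`, `s = -(1 + 3 y) / β`, without a positive factor. -/
def nrN0 : List (List ℤ) :=
  [[256, -768, -256], [0, -256, 1152, 2240, -2560, -1056], [0, 0, 0, -384, -2560, 3296, 5840,
  -3408, -1464], [0, 0, 0, 0, 0, 384, 640, -8080, 5592, 6920, -7764, -1484], [0, 0, 0, 0, 0, 0,
  0, -896, 2384, 648, -11492, 18684, 7426, 520, 912], [0, 0, 0, 0, 0, 0, 0, 0, 0, 0, -1368, 5076,
  -15486, -9824, 1477, -1571, 156, -108], [0, 0, 0, 0, 0, 0, 0, 0, 0, 0, 0, 0, 0, 4554, 4086,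
  -4102, 1042, 147, -51], [0, 0, 0, 0, 0, 0, 0, 0, 0, 0, 0, 0, 0, 0, 0, 0, 1865, -215, -468, 282,
  -216], [0, 0, 0, 0, 0, 0, 0, 0, 0, 0, 0, 0, 0, 0, 0, 0, 0, 0, 0, 201, -159, 360], [0, 0, 0, 0,
  0, 0, 0, 0, 0, 0, 0, 0, 0, 0, 0, 0, 0, 0, 0, 0, 0, 0, -144]]

/-- `gnl` at `v = 1 - e ^ 2`, `s = -(1 + 3 y) / β`, without a positive factor. -/
def nrNw : List (List ℤ) :=
  [[512, -2560, 1024], [0, 512, -768, 7936, -10240, 2816], [0, 0, 0, 768, -6144, 1024, 20800,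
  -16960, -2112], [0, 0, 0, 0, 0, 1536, 4352, -27072, 29024, 8304, -19376, -3088], [0, 0, 0, 0,
  0, 0, 0, -1664, 6208, -6112, -18256, 46488, 11528, 7036, 2608], [0, 0, 0, 0, 0, 0, 0, 0, 0, 0,
  -2144, 8720, -36712, -16380, -7552, -5950, 94, -654], [0, 0, 0, 0, 0, 0, 0, 0, 0, 0, 0, 0, 0,
  10360, 7908, -3542, 6372, -749, 607, -114, 54], [0, 0, 0, 0, 0, 0, 0, 0, 0, 0, 0, 0, 0, 0, 0,
  0, 3230, -2458, 1504, 176, -507, 3], [0, 0, 0, 0, 0, 0, 0, 0, 0, 0, 0, 0, 0, 0, 0, 0, 0, 0, 0,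
  -673, -281, 1042, -120, 108], [0, 0, 0, 0, 0, 0, 0, 0, 0, 0, 0, 0, 0, 0, 0, 0, 0, 0, 0, 0, 0,
  0, -433, 75, -180], [0, 0, 0, 0, 0, 0, 0, 0, 0, 0, 0, 0, 0, 0, 0, 0, 0, 0, 0, 0, 0, 0, 0, 0, 0,
  72]]

/-- The constant coefficient in `W` of the quartic, where `σ = (2 + y) / 2 + (4 - y) W`, without a
monomial factor. -/
def nrT0 : List (List ℤ) :=
  [[64, -96], [0, -224, 352, 368, -48], [0, 0, 288, -976, 64, -248, -64, 24], [0, 0, 0, 0, 288,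
  360, -584, 748, -188, -164, 12], [0, 0, 0, 0, 0, 0, -144, 224, -28, -264, 348, -18, -24], [0,
  0, 0, 0, 0, 0, 0, 0, 0, -140, 128, 56, -80, 9, -15], [0, 0, 0, 0, 0, 0, 0, 0, 0, 0, 0, 0, -104,
  38, 62, 14], [0, 0, 0, 0, 0, 0, 0, 0, 0, 0, 0, 0, 0, 0, 0, -35, -3]]

/-- The linear coefficient in `W` of the quartic. -/
def nrT1 : List (List ℤ) :=
  [[768, -1152], [0, -2688, 4608, 2944, 768], [0, 0, 3072, -10048, -576, -3264, -3296, 480], [0,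
  0, 0, 0, 3072, 3264, 800, 5136, -624, -1040, -96], [0, 0, 0, 0, 0, 0, -1824, -48, -1104, 1144,
  864, 168, 192], [0, 0, 0, 0, 0, 0, 0, 0, 0, -632, -336, -756, 296, -36, 120], [0, 0, 0, 0, 0,
  0, 0, 0, 0, 0, 0, 0, 268, -120, -516, -112], [0, 0, 0, 0, 0, 0, 0, 0, 0, 0, 0, 0, 0, 0, 0, 280,
  24]]

/-- The quadratic coefficient in `W` of the quartic. -/
def nrT2 : List (List ℤ) :=
  [[768, 0, -3456], [0, 0, -8832, 18816, 14400, 5184], [0, 0, 0, 9216, -30912, -13632, -27552,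
  -19968, -1152], [0, 0, 0, 0, 0, 9216, 13920, 36192, 25488, 13296, 3840, 288], [0, 0, 0, 0, 0,
  0, 0, -8064, -10752, -18672, -13488, -5184, -432, -576], [0, 0, 0, 0, 0, 0, 0, 0, 0, 0, 6000,
  3696, 1704, -48, 0, -360], [0, 0, 0, 0, 0, 0, 0, 0, 0, 0, 0, 0, 0, 168, -144, 1608, 336], [0,
  0, 0, 0, 0, 0, 0, 0, 0, 0, 0, 0, 0, 0, 0, 0, -840, -72]]

/-- The cubic coefficient in `W` of the quartic. -/
def nrT3 : List (List ℤ) :=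
  [[1024, -1536], [0, -2048, 2560, 4352, 1536], [0, 0, 0, 2816, -16640, 3328, -1024, 384], [0, 0,
  0, 0, 0, 7296, -1664, 1408, -4352, -3392, -384], [0, 0, 0, 0, 0, 0, 0, -1600, 3776, 2976, 6336,
  288, 768], [0, 0, 0, 0, 0, 0, 0, 0, 0, -2144, -1024, -1648, -800, 144, 480], [0, 0, 0, 0, 0, 0,
  0, 0, 0, 0, 0, 0, -560, 800, -2224, -448], [0, 0, 0, 0, 0, 0, 0, 0, 0, 0, 0, 0, 0, 0, 0, 1120,
  96]]

/-- The leading coefficient in `W` of the quartic. -/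
def nrT4 : List (List ℤ) :=
  [[1024, -1536], [-1024, 3072, -3840, 3328, -384], [0, 0, -1536, 4352, -4992, 384, 2368, 192],
  [0, 0, 0, 0, -768, 1920, 64, -4416, 96, -384], [0, 0, 0, 0, 0, 0, -128, 192, 1632, 704, -144,
  -240], [0, 0, 0, 0, 0, 0, 0, 0, 0, -32, -672, 1152, 224], [0, 0, 0, 0, 0, 0, 0, 0, 0, 0, 0, 0,
  -560, -48]]

section
variable {y p n g : ℝ}

theorem nB1_near (hy : y = g * n ^ 3) (hp : p = g * n ^ 2) :
    nB1 y p = n ^ 2 * g / 2 * polyEval nrB1 n g := by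
  subst hy hp
  simp only [nB1, polyEval, polyEval1, nrB1, List.foldr_cons, List.foldr_nil]; push_cast; ring

theorem nC_near (hy : y = g * n ^ 3) (hp : p = g * n ^ 2) :
    nC y p = -(n ^ 3 * g * polyEval nrC n g) := by
  subst hy hp
  simp only [nC, polyEval, polyEval1, nrC, List.foldr_cons, List.foldr_nil]; push_cast; ring

/-- The numerator of `β ^ 3 * charS` at `s = -S / β`, `v = 0`. -/
noncomputable def nrChar (y p S : ℝ) : ℝ :=
  -(S ^ 3 * (4 - y) ^ 3 * (y - p ^ 2) ^ 2 * (2 + p) * (2 + y))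
    + y * nA y p * (4 - y) ^ 2 * (y - p ^ 2) * (2 + p) * (2 + y) * S ^ 2
    - y * nC1 y p * (4 - y) * S + (1 - y) * y ^ 2 * nC y p * (y - p ^ 2) * (2 + y)

theorem nrChar_sep (hy : y = g * n ^ 3) (hp : p = g * n ^ 2) :
    nrChar y p (1 / 2) = n ^ 6 * g ^ 2 / 8 * polyEval nrSep n g := by
  subst hy hp
  simp only [nrChar, nA, nC, nC1, polyEval, polyEval1, nrSep, List.foldr_cons, List.foldr_nil]
  push_cast; ring

theorem nrChar_far (hy : y = g * n ^ 3) (hp : p = g * n ^ 2) :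
    nrChar y p (1 + 3 * y) = n ^ 7 * g ^ 3 / 2 * polyEval nrFar n g := by
  subst hy hp
  simp only [nrChar, nA, nC, nC1, polyEval, polyEval1, nrFar, List.foldr_cons, List.foldr_nil]
  push_cast; ring

/-- The numerator of `β ^ 2 * gnl` at `s = -S / β`. -/
noncomputable def nrGnl (y p v S : ℝ) : ℝ :=
  2 * (4 - y) ^ 3 * (1 - p) * p * nB1 y p * (y - p ^ 2) * (2 + p) * (2 + y) ^ 2 * y
      * (S ^ 2 - v * (1 - y))
    - (2 * y ^ 2 * nA y p * (2 + p) * (y - p ^ 2) ^ 2 * (2 + y) ^ 3 * (1 - y) - nC2 y p * y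
      + v * (4 - y) ^ 4 * nB2 y p * (2 + p)) * S

theorem nrGnl_zero (hy : y = g * n ^ 3) (hp : p = g * n ^ 2) :
    nrGnl y p 0 (1 + 3 * y) = y * (4 - y) ^ 2 * (n ^ 7 * g ^ 3) / 8 * polyEval nrN0 n g := by
  subst hy hp
  simp only [nrGnl, nA, nB1, nB2, nC2, polyEval, polyEval1, nrN0, List.foldr_cons, List.foldr_nil]
  push_cast; ring

theorem nrGnl_top (hy : y = g * n ^ 3) (hp : p = g * n ^ 2) (h4 : 4 - y ≠ 0) :
    nrGnl y p (y * (8 + y) / (4 - y) ^ 2) (1 + 3 * y) =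
      y * (4 - y) * (n ^ 7 * g ^ 3) / 4 * polyEval nrNw n g := by
  have e : nrGnl y p (y * (8 + y) / (4 - y) ^ 2) (1 + 3 * y) = y * (
      2 * (4 - y) * (1 - p) * p * nB1 y p * (y - p ^ 2) * (2 + p) * (2 + y) ^ 2
      * ((4 - y) ^ 2 * (1 + 3 * y) ^ 2 - y * (8 + y) * (1 - y))
    - (2 * y * nA y p * (2 + p) * (y - p ^ 2) ^ 2 * (2 + y) ^ 3 * (1 - y) - nC2 y p
      + (8 + y) * (4 - y) ^ 2 * nB2 y p * (2 + p)) * (1 + 3 * y)) := by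
    unfold nrGnl; field_simp
  rw [e]
  subst hy hp
  simp only [nA, nB1, nB2, nC2, polyEval, polyEval1, nrNw, List.foldr_cons, List.foldr_nil]
  push_cast; ring

/-- The quartic in the variable `σ = (4 - y) β s / y`, without its positive factor. -/
noncomputable def nrQuartic (y p σ : ℝ) : ℝ :=
  (2 + p) * y * nB2 y p * σ ^ 4 + (2 + p) * y * nQ3 y p * σ ^ 3 + nQ2 y p * σ ^ 2
    + (1 - y) * nQ1 y p * σ + (1 - y) ^ 2 * (1 - p) * p * (2 + y) ^ 2 * nQ0 y p

theorem nrQuartic_eq (hy : y = g * n ^ 3) (hp : p = g * n ^ 2) (W : ℝ) :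
    128 * n ^ 2 * nrQuartic y p ((2 + y) / 2 + (4 - y) * W) = (4 - y) ^ 4 * y ^ 3 *
      (n * polyEval nrT0 n g + n * polyEval nrT1 n g * W + polyEval nrT2 n g * W ^ 2
        + n * polyEval nrT3 n g * W ^ 3 + n ^ 4 * g * polyEval nrT4 n g * W ^ 4) := by
  subst hy hp
  simp only [nrQuartic, nB2, nQ0, nQ1, nQ2, nQ3, polyEval, polyEval1, nrT0, nrT1, nrT2, nrT3, nrT4,
    List.foldr_cons, List.foldr_nil]
  push_cast; ring

end
end M1P

/-! ### Certificates near `β = 1` -/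

namespace M1P
open Encl Ex

/-- The discriminant condition of `quartic_pos_of_disc` for the quartic in `W`, at `m = (2 + y) /
(2 (4 - y))`, which corresponds to `σ = 0`. -/
def exDisc : Ex :=
  add (mul (poly nrT0 v0 v1) (add
      (mul (mul (con 8) (add (con 4) (neg (mul v1 (mul v0 (mul v0 v0)))))) (poly nrT2 v0 v1))
      (neg (mul (mul (con 4) (add (con 2) (mul v1 (mul v0 (mul v0 v0)))))
        (mul v0 (poly nrT3 v0 v1))))))
    (neg (mul (mul (mul (con 2) (add (con 4) (neg (mul v1 (mul v0 (mul v0 v0)))))) v0)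
      (mul (poly nrT1 v0 v1) (poly nrT1 v0 v1))))

/-- The polynomials whose positivity is asserted by `NearClaims`. -/
def nearEx : List Ex :=
  [poly nrB1 v0 v1, poly nrC v0 v1, poly nrSep v0 v1, poly nrFar v0 v1, poly nrN0 v0 v1,
    poly nrNw v0 v1, poly nrT0 v0 v1, poly nrT3 v0 v1, poly nrT4 v0 v1, exDisc]

/-- The polynomial inequalities behind the theorem near `β = 1`, at `n = y / p` and
`g = p ^ 3 / y ^ 2`. -/
structure NearClaims (n g : ℝ) : Prop where
  b1 : 0 < polyEval nrB1 n g
  c : 0 < polyEval nrC n g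
  sep : 0 < polyEval nrSep n g
  far : 0 < polyEval nrFar n g
  gnl_zero : 0 < polyEval nrN0 n g
  gnl_top : 0 < polyEval nrNw n g
  t0 : 0 < polyEval nrT0 n g
  t3 : 0 < polyEval nrT3 n g
  t4 : 0 < polyEval nrT4 n g
  disc : 2 * (4 - g * n ^ 3) * n * polyEval nrT1 n g ^ 2 <
    polyEval nrT0 n g * (8 * (4 - g * n ^ 3) * polyEval nrT2 n g
      - 4 * (2 + g * n ^ 3) * (n * polyEval nrT3 n g))

/-- The check of the box of lower corner `(a, c) / 1024` and side lengths `(b, d) / 1024`. -/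
noncomputable def nearCheck (a b c d : ℕ) : Bool :=
  posChecks (varTM a b 0 10) (varTM c 0 d 10) nearEx

theorem nearCheck_sound {a b c d : ℕ} (h : nearCheck a b c d = true) (hb : 0 < b) (hd : 0 < d)
    {n g : ℝ} (h1 : a ≤ 1024 * n) (h2 : 1024 * n ≤ a + b) (h3 : c ≤ 1024 * g)
    (h4 : 1024 * g ≤ c + d) : NearClaims n g := by
  have hb' : (0 : ℝ) < b := by exact_mod_cast hb
  have hd' : (0 : ℝ) < d := by exact_mod_cast hd
  have t0 : 0 ≤ (1024 * n - a) / b := div_nonneg (by linarith) hb'.le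
  have t1 : (1024 * n - a) / b ≤ 1 := by rw [div_le_one hb']; linarith
  have s0 : 0 ≤ (1024 * g - c) / d := div_nonneg (by linarith) hd'.le
  have s1 : (1024 * g - c) / d ≤ 1 := by rw [div_le_one hd']; linarith
  have hA := encloses_varTM ((1024 * n - a) / b) ((1024 * g - c) / d) a b 0 10
  have hB := encloses_varTM ((1024 * n - a) / b) ((1024 * g - c) / d) c 0 d 10
  have eA : (a + b * ((1024 * n - a) / b) + (0 : ℕ) * ((1024 * g - c) / d)) / 2 ^ 10 = n := by
    field_simp; push_cast; ring
  have eB : (c + (0 : ℕ) * ((1024 * n - a) / b) + d * ((1024 * g - c) / d)) / 2 ^ 10 = g := by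
    field_simp; push_cast; ring
  rw [eA] at hA
  rw [eB] at hB
  have key := posChecks_sound t0 t1 s0 s1 hA hB h
  have hmem : ∀ e : Ex, e ∈ nearEx → 0 < e.den n g := key
  have hD : 0 < exDisc.den n g := hmem exDisc (by simp [nearEx])
  refine ⟨hmem (poly nrB1 v0 v1) (by simp [nearEx]), hmem (poly nrC v0 v1) (by simp [nearEx]),
    hmem (poly nrSep v0 v1) (by simp [nearEx]), hmem (poly nrFar v0 v1) (by simp [nearEx]),
    hmem (poly nrN0 v0 v1) (by simp [nearEx]), hmem (poly nrNw v0 v1) (by simp [nearEx]),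
    hmem (poly nrT0 v0 v1) (by simp [nearEx]), hmem (poly nrT3 v0 v1) (by simp [nearEx]),
    hmem (poly nrT4 v0 v1) (by simp [nearEx]), ?_⟩
  simp only [exDisc, den] at hD
  push_cast at hD
  linarith

/-- The number in the name is the value of `(1 + β) / (1 - β)` from which on the box is used; it
ends where the next one begins. -/
theorem nearCheck_96 : nearCheck 323 26 1002 61 = true := by decide +kernel
theorem nearCheck_128 : nearCheck 292 32 908 95 = true := by decide +kernel
theorem nearCheck_192 : nearCheck 272 21 837 72 = true := by decide +kernel
theorem nearCheck_256 : nearCheck 234 40 664 175 = true := by decide +kernel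
theorem nearCheck_512 : nearCheck 204 31 502 163 = true := by decide +kernel
theorem nearCheck_1024 : nearCheck 161 44 255 248 = true := by decide +kernel
theorem nearCheck_4096_low : nearCheck 0 162 0 128 = true := by decide +kernel
theorem nearCheck_4096_high : nearCheck 0 162 128 128 = true := by decide +kernel

end M1P

/-! ### Genuine nonlinearity near `β = 1` -/

namespace M1P
open Encl Ex

/-- A monic cubic that is negative at `0` and positive at `m < 0` and at `m' < m` has no root in
`[m', m]`: otherwise its third divided difference would be negative. -/
theorem charS_pos_between {a c b₁ c₁ v m m' s : ℝ} (hc : c < 0) (hm : m < 0) (hs : s ≤ m)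
    (hs' : m' ≤ s) (h : 0 < charS a c b₁ c₁ v m) (h' : 0 < charS a c b₁ c₁ v m') :
    0 < charS a c b₁ c₁ v s := by
  rcases eq_or_lt_of_le hs with rfl | hs
  · exact h
  rcases eq_or_lt_of_le hs' with rfl | hs'
  · exact h'
  by_contra hneg
  push Not at hneg
  have e : c * ((m - s) * (m - m') * (s - m')) =
      charS a c b₁ c₁ v m * ((-s) * (s - m') * (-m'))
        + charS a c b₁ c₁ v m' * ((-m) * (m - s) * (-s))
        - charS a c b₁ c₁ v s * ((-m) * (m - m') * (-m'))
        + (-m) * (-s) * (-m') * (m - s) * (m - m') * (s - m') := by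
    unfold charS; ring
  have p1 : 0 < -m := by linarith
  have p2 : 0 < -s := by linarith
  have p3 : 0 < -m' := by linarith
  have p4 : 0 < m - s := by linarith
  have p5 : 0 < m - m' := by linarith
  have p6 : 0 < s - m' := by linarith
  have k1 : c * ((m - s) * (m - m') * (s - m')) < 0 := mul_neg_of_neg_of_pos hc (by positivity)
  have k2 : 0 < charS a c b₁ c₁ v m * ((-s) * (s - m') * (-m')) := by positivity
  have k3 : 0 < charS a c b₁ c₁ v m' * ((-m) * (m - s) * (-s)) := by positivity
  have k4 : charS a c b₁ c₁ v s * ((-m) * (m - m') * (-m')) ≤ 0 :=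
    mul_nonpos_of_nonpos_of_nonneg hneg (by positivity)
  have k5 : 0 < (-m) * (-s) * (-m') * (m - s) * (m - m') * (s - m') := by positivity
  linarith

section
variable {β y p n g a c b₁ c₁ b₂ c₂ v : ℝ}

theorem gnl_pos_of_le {X₁ s : ℝ} (hb : 0 < b₁) (hv : 0 < v) (hX : 0 < X₁) (hs : s ≤ -X₁)
    (h : 0 < gnl a b₁ b₂ c₂ v (-X₁)) : 0 < gnl a b₁ b₂ c₂ v s := by
  have e : X₁ * gnl a b₁ b₂ c₂ v s = -s * gnl a b₁ b₂ c₂ v (-X₁)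
      + 2 * b₁ * (-s * X₁ + v) * (-s - X₁) := by unfold gnl; ring
  have h1 : 0 < -s := by linarith
  have h2 : 0 ≤ -s - X₁ := by linarith
  have : 0 < X₁ * gnl a b₁ b₂ c₂ v s := by rw [e]; positivity
  exact (pos_iff_pos_of_mul_pos this).1 hX

/-- A quartic in `W` is positive on `W ≥ -m` when its terms up to the second order dominate. -/
theorem quartic_pos_of_disc {t₀ t₁ t₂ t₃ t₄ m W : ℝ} (h0 : 0 < t₀) (h3 : 0 ≤ t₃) (h4 : 0 ≤ t₄)
    (hd : t₁ ^ 2 < 4 * t₀ * (t₂ - m * t₃)) (hW : -m ≤ W) :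
    0 < t₀ + t₁ * W + t₂ * W ^ 2 + t₃ * W ^ 3 + t₄ * W ^ 4 := by
  have k1 : 0 ≤ t₃ * (W + m) * W ^ 2 := by
    have : 0 ≤ W + m := by linarith
    positivity
  have k2 : 0 ≤ t₄ * W ^ 4 := by positivity
  have k3 : 0 < t₀ + t₁ * W + (t₂ - m * t₃) * W ^ 2 := by
    have : 0 < 4 * t₀ * (t₀ + t₁ * W + (t₂ - m * t₃) * W ^ 2) := by
      have e : 4 * t₀ * (t₀ + t₁ * W + (t₂ - m * t₃) * W ^ 2) =
          (2 * t₀ + t₁ * W) ^ 2 + (4 * t₀ * (t₂ - m * t₃) - t₁ ^ 2) * W ^ 2 := by ring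
      rw [e]
      rcases eq_or_ne W 0 with rfl | hW0
      · simp; positivity
      · have : 0 < W ^ 2 := by positivity
        have := mul_pos (sub_pos.2 hd) this
        positivity
    exact (pos_iff_pos_of_mul_pos this).1 (by positivity)
  nlinarith

theorem cube_mul_charS (hβ : β ≠ 0) (hs : β ^ 2 = 1 - y)
    (h2 : 2 + y ≠ 0) (h4 : 4 - y ≠ 0) (hp : 2 + p ≠ 0) (hH : y - p ^ 2 ≠ 0) (S : ℝ) :
    β ^ 3 * charS (y * nA y p / ((4 - y) * (y - p ^ 2) * β)) (fC y p / β) b₁ (fC1 y p) 0 (-S / β) *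
      ((4 - y) ^ 3 * (y - p ^ 2) ^ 2 * (2 + p) * (2 + y)) = nrChar y p S := by
  unfold charS fC fC1 nrChar
  rw [← hs]
  field_simp
  ring

theorem sq_mul_gnl (hβ : β ≠ 0) (hs : β ^ 2 = 1 - y) (hy : y ≠ 0)
    (h2 : 2 + y ≠ 0) (h4 : 4 - y ≠ 0) (hp : 2 + p ≠ 0) (hH : y - p ^ 2 ≠ 0) (S : ℝ) :
    β ^ 2 * gnl (y * nA y p / ((4 - y) * (y - p ^ 2) * β)) (fB1 y p) (fB2 y p / β) (fC2 y p / β) v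
      (-S / β) * ((4 - y) * (2 + p) * (y - p ^ 2) ^ 3 * (2 + y) ^ 3 * (1 - y) * y)
      = nrGnl y p v S := by
  unfold gnl fB1 fB2 fC2 nrGnl
  rw [← hs]
  field_simp
  ring

theorem mul_quartic (hβ : β ≠ 0) (hs : β ^ 2 = 1 - y) (hy : y ≠ 0) (h1 : 1 - y ≠ 0)
    (h2 : 2 + y ≠ 0) (h4 : 4 - y ≠ 0) (hp : 2 + p ≠ 0) (hH : y - p ^ 2 ≠ 0) (σ : ℝ) :
    quartic (y * nA y p / ((4 - y) * (y - p ^ 2) * β)) (fC y p / β) (fB1 y p) (fC1 y p)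
      (fB2 y p / β) (fC2 y p / β) (y * σ / ((4 - y) * β)) *
      ((4 - y) * (y - p ^ 2) ^ 3 * (2 + y) ^ 3 * (1 - y) ^ 2 * β ^ 3 * (2 + p)) =
    y ^ 2 * nrQuartic y p σ := by
  have q0 := quartic_coeff_zero hβ hy h1 h2 h4 hp hH
  have q1 := quartic_coeff_one hs hy h1 h2 h4 hp hH
  have q2 := quartic_coeff_two hβ hy h1 h2 h4 hp hH
  have q3 := quartic_coeff_three hs hy h1 h2 h4 hH
  have q4 : fB2 y p / β = (4 - y) ^ 3 * nB2 y p / (y * (2 + y) ^ 3 * (y - p ^ 2) ^ 3 * (1 - y) * β)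
      := by rw [fB2, div_div]
  have e : ∀ a c b₁ c₁ b₂ c₂ s : ℝ, quartic a c b₁ c₁ b₂ c₂ s =
      b₂ * s ^ 4 + (2 * b₁ ^ 2 - 2 * b₁ + a * b₂) * s ^ 3 + (c₁ * b₂ - c₂ * b₁) * s ^ 2
        + (c * b₂ - 2 * b₁ * c₁) * s + -2 * b₁ * c := by intros; unfold quartic; ring
  rw [e, q0, q1, q2, q3, q4]
  unfold nrQuartic
  generalize nQ0 y p = N0
  generalize nQ1 y p = N1
  generalize nQ2 y p = N2
  generalize nQ3 y p = N3
  generalize nB2 y p = N4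
  rw [← hs] at h1 ⊢
  field_simp

theorem GNLAt.of_nearClaims (h : NearClaims n g) (hβ : 0 < β) (hs : β ^ 2 = 1 - y) (hn : 0 < n)
    (hg : 0 < g) (hy : y = g * n ^ 3) (hp : p = g * n ^ 2) (hy1 : y < 1) (hp1 : p < 1)
    (hH : 0 < y - p ^ 2) : GNLAt β y p := by
  intro v hv hvw
  have y0 : 0 < y := by rw [hy]; positivity
  have p0 : 0 < p := by rw [hp]; positivity
  have n1 : 0 < 1 - y := by linarith
  have n2 : 0 < 2 + y := by linarith
  have n4 : 0 < 4 - y := by linarith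
  have np : 0 < 2 + p := by linarith
  have np1 : 0 < 1 - p := by linarith
  rw [aux_a hβ.ne' hs n4.ne' hH.ne']
  have hB1 : 0 < nB1 y p := by rw [nB1_near hy hp]; have := h.b1; positivity
  have hb : 0 < fB1 y p := by unfold fB1; positivity
  have hc : fC y p / β < 0 := by
    have : fC y p / β = -(y ^ 2 * (n ^ 3 * g * polyEval nrC n g) /
        ((4 - y) ^ 3 * (y - p ^ 2) * (2 + p) * β)) := by
      unfold fC; rw [nC_near hy hp, div_div]; ring
    rw [this, neg_lt_zero]
    have := h.c
    positivity
  have key : ∀ S : ℝ, 0 < nrChar y p S → 0 < charS (y * nA y p / ((4 - y) * (y - p ^ 2) * β))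
      (fC y p / β) (fB1 y p) (fC1 y p) 0 (-S / β) := by
    intro S hS
    rw [← cube_mul_charS hβ.ne' hs n2.ne' n4.ne' np.ne' hH.ne' S
      (b₁ := fB1 y p)] at hS
    have := (pos_iff_pos_of_mul_pos hS).2 (by positivity)
    exact (pos_iff_pos_of_mul_pos this).1 (by positivity)
  have hsep := key (1 / 2) (by rw [nrChar_sep hy hp]; have := h.sep; positivity)
  have hfar := key (1 + 3 * y) (by rw [nrChar_far hy hp]; have := h.far; positivity)
  have hX : (0 : ℝ) < (1 + 3 * y) / β := by positivity
  have hm : -(1 / 2) / β < 0 := div_neg_of_neg_of_pos (by norm_num) hβ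
  have hG : 0 < gnl (y * nA y p / ((4 - y) * (y - p ^ 2) * β)) (fB1 y p) (fB2 y p / β)
      (fC2 y p / β) v (-((1 + 3 * y) / β)) := by
    have e0 := nrGnl_zero hy hp
    have e1 := nrGnl_top hy hp n4.ne'
    have k0 : 0 < nrGnl y p 0 (1 + 3 * y) := by rw [e0]; have := h.gnl_zero; positivity
    have k1 : 0 < nrGnl y p (y * (8 + y) / (4 - y) ^ 2) (1 + 3 * y) := by
      rw [e1]; have := h.gnl_top; positivity
    set w := y * (8 + y) / (4 - y) ^ 2
    have e : w * nrGnl y p v (1 + 3 * y) = (w - v) * nrGnl y p 0 (1 + 3 * y)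
        + v * nrGnl y p w (1 + 3 * y) := by unfold nrGnl; ring
    have k2 : 0 < w * nrGnl y p v (1 + 3 * y) := by
      rw [e]
      have := sub_pos.2 hvw
      positivity
    have k3 := (pos_iff_pos_of_mul_pos k2).1 (hv.trans hvw)
    rw [← sq_mul_gnl hβ.ne' hs y0.ne' n2.ne' n4.ne' np.ne' hH.ne'] at k3
    have := (pos_iff_pos_of_mul_pos k3).2 (by positivity)
    rw [neg_div] at this
    exact (pos_iff_pos_of_mul_pos this).1 (by positivity)
  have hshift : ∀ s < 0, 0 < charS (y * nA y p / ((4 - y) * (y - p ^ 2) * β))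
      (fC y p / β) (fB1 y p) (fC1 y p) 0 s → 0 < charS (y * nA y p / ((4 - y) * (y - p ^ 2) * β))
      (fC y p / β) (fB1 y p) (fC1 y p) v s := by
    intro s hs0 h0
    rw [charS_eq]
    have : v * (fB1 y p * s) < 0 :=
      mul_neg_of_pos_of_neg hv (mul_neg_of_pos_of_neg hb hs0)
    linarith
  refine outerGNL_of (m := -(1 / 2) / β) hb hc hv hm hsep ?_ ?_
  · intro s hs0 hroot
    have hq : 0 < quartic (y * nA y p / ((4 - y) * (y - p ^ 2) * β)) (fC y p / β) (fB1 y p)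
        (fC1 y p) (fB2 y p / β) (fC2 y p / β) s := by
      have hσ : s = y * ((4 - y) * β * s / y) / ((4 - y) * β) := by field_simp
      set σ := (4 - y) * β * s / y with hσd
      have hσ0 : 0 < σ := by rw [hσd]; positivity
      rw [hσ]
      refine (pos_iff_pos_of_mul_pos (b := (4 - y) * (y - p ^ 2) ^ 3 * (2 + y) ^ 3 * (1 - y) ^ 2
        * β ^ 3 * (2 + p)) ?_).2 (by positivity)
      rw [mul_quartic hβ.ne' hs y0.ne' n1.ne' n2.ne' n4.ne' np.ne' hH.ne']
      have eW : σ = (2 + y) / 2 + (4 - y) * ((σ - (2 + y) / 2) / (4 - y)) := by field_simp; ring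
      have hW : -((2 + y) / (2 * (4 - y))) ≤ (σ - (2 + y) / 2) / (4 - y) := by
        rw [← neg_div, div_le_div_iff₀ (by positivity) n4]; nlinarith
      set W := (σ - (2 + y) / 2) / (4 - y)
      rw [eW]
      have := nrQuartic_eq hy hp W
      have hT : 0 < n * polyEval nrT0 n g + n * polyEval nrT1 n g * W + polyEval nrT2 n g * W ^ 2
          + n * polyEval nrT3 n g * W ^ 3 + n ^ 4 * g * polyEval nrT4 n g * W ^ 4 := by
        have ht0 := h.t0
        have ht3 := h.t3
        have ht4 := h.t4
        have hd := h.disc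
        rw [← hy] at hd
        refine quartic_pos_of_disc (by positivity) (by positivity) (by positivity) ?_ hW
        have e : 4 * (n * polyEval nrT0 n g) * (polyEval nrT2 n g
            - (2 + y) / (2 * (4 - y)) * (n * polyEval nrT3 n g)) =
            n / (2 * (4 - y)) * (polyEval nrT0 n g * (8 * (4 - y) * polyEval nrT2 n g
              - 4 * (2 + y) * (n * polyEval nrT3 n g))) := by field_simp; ring
        have e' : (n * polyEval nrT1 n g) ^ 2 =
            n / (2 * (4 - y)) * (2 * (4 - y) * n * polyEval nrT1 n g ^ 2) := by field_simp
        rw [e, e']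
        exact mul_lt_mul_of_pos_left hd (by positivity)
      have h2 : 0 < 128 * n ^ 2 * nrQuartic y p ((2 + y) / 2 + (4 - y) * W) := by
        rw [this]; positivity
      have := (pos_iff_pos_of_mul_pos h2).1 (by positivity)
      positivity
    rw [← mul_gnl hroot] at hq
    exact (pos_iff_pos_of_mul_pos hq).1 (by positivity)
  · intro s hsm hroot
    refine gnl_pos_of_le hb hv hX ?_ hG
    by_contra hcon
    push Not at hcon
    have := charS_pos_between hc hm hsm.le hcon.le (hshift _ hm hsep)
      (hshift _ (neg_neg_of_pos hX) (by rw [← neg_div]; exact hfar))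
    exact this.ne' hroot

end
end M1P

/-! ### Monotonicity near `β = 1` -/

open MeasureTheory Set Filter Topology

namespace M1P
open Encl Ex

/-- The variable `n = y / p`, which decreases to `0` (logarithmically) as `β → 1`. -/
noncomputable def nF (β : ℝ) : ℝ := yF β / pF β
/-- The variable `g = p ^ 3 / y ^ 2`, which decreases to `0` as `β → 1`. -/
noncomputable def gF (β : ℝ) : ℝ := pF β ^ 3 / yF β ^ 2

section
variable {β : ℝ}

theorem pF_lt_one (h : β ∈ Ioo (0 : ℝ) 1) : pF β < 1 := by
  have f := flow_yF_pF h
  have := f.H_pos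
  have := f.y_lt
  nlinarith [pF_pos h]

theorem nF_pos (h : β ∈ Ioo (0 : ℝ) 1) : 0 < nF β := div_pos (yF_mem h).1 (pF_pos h)

theorem gF_pos (h : β ∈ Ioo (0 : ℝ) 1) : 0 < gF β := by
  have := pF_pos h
  have := (yF_mem h).1
  unfold gF; positivity

theorem yF_eq_near (h : β ∈ Ioo (0 : ℝ) 1) : yF β = gF β * nF β ^ 3 := by
  have := (pF_pos h).ne'
  have := (yF_mem h).1.ne'
  unfold gF nF; field_simp

theorem pF_eq_near (h : β ∈ Ioo (0 : ℝ) 1) : pF β = gF β * nF β ^ 2 := by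
  have := (pF_pos h).ne'
  have := (yF_mem h).1.ne'
  unfold gF nF; field_simp

theorem hasDerivAt_nF (h : β ∈ Ioo (0 : ℝ) 1) : HasDerivAt nF
    (-(2 * yF β - yF β * pF β - pF β ^ 2) / (β * pF β ^ 2)) β := by
  have f := flow_yF_pF h
  have hp := (pF_pos h).ne'
  have hy := f.y_pos.ne'
  have hβ := h.1.ne'
  refine (f.hy.fun_div f.hp hp).congr_deriv ?_
  field_simp; ring

theorem hasDerivAt_gF (h : β ∈ Ioo (0 : ℝ) 1) : HasDerivAt gF
    (-(pF β ^ 3 * (2 + yF β + 3 * pF β - 6 * nF β) / (β * yF β ^ 3))) β := by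
  have f := flow_yF_pF h
  have hp := (pF_pos h).ne'
  have hy := f.y_pos.ne'
  have hβ := h.1.ne'
  refine ((f.hp.fun_pow 3).fun_div (f.hy.fun_pow 2) (by positivity)).congr_deriv ?_
  unfold nF
  field_simp; push_cast; ring

theorem antitoneOn_nF : AntitoneOn nF (Ioo 0 1) := by
  refine antitoneOn_of_deriv_nonpos (convex_Ioo 0 1)
    (fun β h => (hasDerivAt_nF h).continuousAt.continuousWithinAt) ?_ ?_ <;> rw [interior_Ioo]
  · exact fun β h => (hasDerivAt_nF h).differentiableAt.differentiableWithinAt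
  · intro β h
    rw [(hasDerivAt_nF h).deriv]
    have f := flow_yF_pF h
    have k1 : 0 < 2 * yF β - yF β * pF β - pF β ^ 2 := by
      have := f.H_pos
      have := mul_pos f.y_pos (sub_pos.2 (pF_lt_one h))
      linarith
    have := h.1
    have := pF_pos h
    rw [neg_div]
    exact neg_nonpos.2 (by positivity)

/-- The values of `n` and `g` where `(1 + β) / (1 - β) = r`, from bounds for the logarithm. -/
theorem near_bounds {r L₁ L₂ N₁ N₂ : ℝ} (hr : 1 < r) (h1 : L₁ ≤ Real.log r) (h2 : Real.log r ≤ L₂)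
    (hN : 0 < N₁) (hN' : 0 < N₂)
    (k1 : 1 + 2 * N₂ ≤ L₁ * (r + 1) / (2 * (r - 1)) * (2 * N₂ + 4 * r / (r + 1) ^ 2))
    (k2 : L₂ * (r + 1) / (2 * (r - 1)) * (2 * N₁ + 4 * r / (r + 1) ^ 2) ≤ 1 + 2 * N₁) :
    (r - 1) / (r + 1) ∈ Ioo (0 : ℝ) 1 ∧ N₁ ≤ nF ((r - 1) / (r + 1)) ∧
      nF ((r - 1) / (r + 1)) ≤ N₂ ∧ 4 * r / (r + 1) ^ 2 / N₂ ^ 3 ≤ gF ((r - 1) / (r + 1)) ∧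
      gF ((r - 1) / (r + 1)) ≤ 4 * r / (r + 1) ^ 2 / N₁ ^ 3 := by
  have hr1 : 0 < r - 1 := by linarith
  have hr2 : 0 < r + 1 := by linarith
  have hβ : (r - 1) / (r + 1) ∈ Ioo (0 : ℝ) 1 :=
    ⟨by positivity, by rw [div_lt_one hr2]; linarith⟩
  have hl : ell ((r - 1) / (r + 1)) = Real.log r * (r + 1) / (2 * (r - 1)) := by
    rw [ell_eq_log (abs_lt_one_of_Ioo hβ) hβ.1.ne']
    have : (1 + (r - 1) / (r + 1)) / (1 - (r - 1) / (r + 1)) = r := by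
      have : r + 1 - (r - 1) ≠ 0 := by norm_num
      field_simp; ring
    rw [this]; field_simp
  have hy : yF ((r - 1) / (r + 1)) = 4 * r / (r + 1) ^ 2 := by
    unfold yF; field_simp; ring
  have g1 := one_lt_ell hβ
  have g2 := mul_ell_lt_one hβ
  have g3 := (yF_mem hβ).1
  have hn : nF ((r - 1) / (r + 1)) * (2 * (ell ((r - 1) / (r + 1)) - 1)) =
      1 - yF ((r - 1) / (r + 1)) * ell ((r - 1) / (r + 1)) := by
    unfold nF pF
    have : ell ((r - 1) / (r + 1)) - 1 ≠ 0 := by linarith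
    have := g3.ne'
    field_simp
  have hg := yF_eq_near hβ
  have hn0 := nF_pos hβ
  have hg0 := gF_pos hβ
  rw [← hy] at k1 k2 ⊢
  have m1 : L₁ * (r + 1) / (2 * (r - 1)) ≤ ell ((r - 1) / (r + 1)) := by rw [hl]; gcongr
  have m2 : ell ((r - 1) / (r + 1)) ≤ L₂ * (r + 1) / (2 * (r - 1)) := by rw [hl]; gcongr
  have m3 : 1 + 2 * N₂ ≤ ell ((r - 1) / (r + 1)) * (2 * N₂ + yF ((r - 1) / (r + 1))) :=
    k1.trans (by gcongr)
  have m4 : ell ((r - 1) / (r + 1)) * (2 * N₁ + yF ((r - 1) / (r + 1))) ≤ 1 + 2 * N₁ :=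
    le_trans (by gcongr) k2
  have n1 : N₁ ≤ nF ((r - 1) / (r + 1)) := by
    refine le_of_mul_le_mul_right ?_ (by linarith : 0 < 2 * (ell ((r - 1) / (r + 1)) - 1))
    linarith
  have n2 : nF ((r - 1) / (r + 1)) ≤ N₂ := by
    refine le_of_mul_le_mul_right ?_ (by linarith : 0 < 2 * (ell ((r - 1) / (r + 1)) - 1))
    linarith
  refine ⟨hβ, n1, n2, ?_, ?_⟩
  · rw [hg, div_le_iff₀ (by positivity)]; gcongr
  · rw [hg, le_div_iff₀ (by positivity)]; gcongr

/-- The number in the name is `(1 + β) / (1 - β)`. -/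
theorem near_bounds_96 : (95 / 97 : ℝ) ∈ Ioo (0 : ℝ) 1 ∧ 34013 / 100000 ≤ nF (95 / 97) ∧
    nF (95 / 97) ≤ 34014 / 100000 ∧ 384 / 9409 / (34014 / 100000) ^ 3 ≤ gF (95 / 97) ∧
    gF (95 / 97) ≤ 384 / 9409 / (34013 / 100000) ^ 3 := by
  have e : Real.log 96 = 5 * Real.log 2 + Real.log 3 := by
    rw [show (96 : ℝ) = (2 : ℝ) ^ 5 * 3 by norm_num, Real.log_mul (by norm_num) (by norm_num), Real.log_pow]; norm_num
  have := near_bounds (r := 96) (N₁ := 34013 / 100000) (N₂ := 34014 / 100000)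
    (L₁ := 5 * 0.6931471803 + 1.0986122885) (L₂ := 5 * 0.6931471808 + 1.0986122888) (by norm_num)
    (by rw [e]; linarith [Real.log_two_gt_d9, Real.log_three_gt_d9])
    (by rw [e]; linarith [Real.log_two_lt_d9, Real.log_three_lt_d9]) (by norm_num)
    (by norm_num) (by norm_num) (by norm_num)
  norm_num at this ⊢
  exact this

theorem near_bounds_128 : (127 / 129 : ℝ) ∈ Ioo (0 : ℝ) 1 ∧ 31558 / 100000 ≤ nF (127 / 129) ∧
    nF (127 / 129) ≤ 31559 / 100000 ∧ 512 / 16641 / (31559 / 100000) ^ 3 ≤ gF (127 / 129) ∧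
    gF (127 / 129) ≤ 512 / 16641 / (31558 / 100000) ^ 3 := by
  have e : Real.log 128 = 7 * Real.log 2 := by
    rw [show (128 : ℝ) = (2 : ℝ) ^ 7 by norm_num, Real.log_pow]; norm_num
  have := near_bounds (r := 128) (N₁ := 31558 / 100000) (N₂ := 31559 / 100000)
    (L₁ := 7 * 0.6931471803) (L₂ := 7 * 0.6931471808) (by norm_num)
    (by rw [e]; linarith [Real.log_two_gt_d9])
    (by rw [e]; linarith [Real.log_two_lt_d9]) (by norm_num)
    (by norm_num) (by norm_num) (by norm_num)
  norm_num at this ⊢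
  exact this

theorem near_bounds_192 : (191 / 193 : ℝ) ∈ Ioo (0 : ℝ) 1 ∧ 28534 / 100000 ≤ nF (191 / 193) ∧
    nF (191 / 193) ≤ 28535 / 100000 ∧ 768 / 37249 / (28535 / 100000) ^ 3 ≤ gF (191 / 193) ∧
    gF (191 / 193) ≤ 768 / 37249 / (28534 / 100000) ^ 3 := by
  have e : Real.log 192 = 6 * Real.log 2 + Real.log 3 := by
    rw [show (192 : ℝ) = (2 : ℝ) ^ 6 * 3 by norm_num, Real.log_mul (by norm_num) (by norm_num), Real.log_pow]; norm_num
  have := near_bounds (r := 192) (N₁ := 28534 / 100000) (N₂ := 28535 / 100000)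
    (L₁ := 6 * 0.6931471803 + 1.0986122885) (L₂ := 6 * 0.6931471808 + 1.0986122888) (by norm_num)
    (by rw [e]; linarith [Real.log_two_gt_d9, Real.log_three_gt_d9])
    (by rw [e]; linarith [Real.log_two_lt_d9, Real.log_three_lt_d9]) (by norm_num)
    (by norm_num) (by norm_num) (by norm_num)
  norm_num at this ⊢
  exact this

theorem near_bounds_256 : (255 / 257 : ℝ) ∈ Ioo (0 : ℝ) 1 ∧ 26658 / 100000 ≤ nF (255 / 257) ∧
    nF (255 / 257) ≤ 26659 / 100000 ∧ 1024 / 66049 / (26659 / 100000) ^ 3 ≤ gF (255 / 257) ∧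
    gF (255 / 257) ≤ 1024 / 66049 / (26658 / 100000) ^ 3 := by
  have e : Real.log 256 = 8 * Real.log 2 := by
    rw [show (256 : ℝ) = (2 : ℝ) ^ 8 by norm_num, Real.log_pow]; norm_num
  have := near_bounds (r := 256) (N₁ := 26658 / 100000) (N₂ := 26659 / 100000)
    (L₁ := 8 * 0.6931471803) (L₂ := 8 * 0.6931471808) (by norm_num)
    (by rw [e]; linarith [Real.log_two_gt_d9])
    (by rw [e]; linarith [Real.log_two_lt_d9]) (by norm_num)
    (by norm_num) (by norm_num) (by norm_num)
  norm_num at this ⊢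
  exact this

theorem near_bounds_512 : (511 / 513 : ℝ) ∈ Ioo (0 : ℝ) 1 ∧ 22887 / 100000 ≤ nF (511 / 513) ∧
    nF (511 / 513) ≤ 22888 / 100000 ∧ 2048 / 263169 / (22888 / 100000) ^ 3 ≤ gF (511 / 513) ∧
    gF (511 / 513) ≤ 2048 / 263169 / (22887 / 100000) ^ 3 := by
  have e : Real.log 512 = 9 * Real.log 2 := by
    rw [show (512 : ℝ) = (2 : ℝ) ^ 9 by norm_num, Real.log_pow]; norm_num
  have := near_bounds (r := 512) (N₁ := 22887 / 100000) (N₂ := 22888 / 100000)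
    (L₁ := 9 * 0.6931471803) (L₂ := 9 * 0.6931471808) (by norm_num)
    (by rw [e]; linarith [Real.log_two_gt_d9])
    (by rw [e]; linarith [Real.log_two_lt_d9]) (by norm_num)
    (by norm_num) (by norm_num) (by norm_num)
  norm_num at this ⊢
  exact this

theorem near_bounds_1024 : (1023 / 1025 : ℝ) ∈ Ioo (0 : ℝ) 1 ∧ 19948 / 100000 ≤ nF (1023 / 1025) ∧
    nF (1023 / 1025) ≤ 19949 / 100000 ∧ 4096 / 1050625 / (19949 / 100000) ^ 3 ≤ gF (1023 / 1025) ∧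
    gF (1023 / 1025) ≤ 4096 / 1050625 / (19948 / 100000) ^ 3 := by
  have e : Real.log 1024 = 10 * Real.log 2 := by
    rw [show (1024 : ℝ) = (2 : ℝ) ^ 10 by norm_num, Real.log_pow]; norm_num
  have := near_bounds (r := 1024) (N₁ := 19948 / 100000) (N₂ := 19949 / 100000)
    (L₁ := 10 * 0.6931471803) (L₂ := 10 * 0.6931471808) (by norm_num)
    (by rw [e]; linarith [Real.log_two_gt_d9])
    (by rw [e]; linarith [Real.log_two_lt_d9]) (by norm_num)
    (by norm_num) (by norm_num) (by norm_num)
  norm_num at this ⊢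
  exact this

theorem near_bounds_4096 : (4095 / 4097 : ℝ) ∈ Ioo (0 : ℝ) 1 ∧ 15753 / 100000 ≤ nF (4095 / 4097) ∧
    nF (4095 / 4097) ≤ 15754 / 100000 ∧ 16384 / 16785409 / (15754 / 100000) ^ 3 ≤ gF (4095 / 4097) ∧
    gF (4095 / 4097) ≤ 16384 / 16785409 / (15753 / 100000) ^ 3 := by
  have e : Real.log 4096 = 12 * Real.log 2 := by
    rw [show (4096 : ℝ) = (2 : ℝ) ^ 12 by norm_num, Real.log_pow]; norm_num
  have := near_bounds (r := 4096) (N₁ := 15753 / 100000) (N₂ := 15754 / 100000)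
    (L₁ := 12 * 0.6931471803) (L₂ := 12 * 0.6931471808) (by norm_num)
    (by rw [e]; linarith [Real.log_two_gt_d9])
    (by rw [e]; linarith [Real.log_two_lt_d9]) (by norm_num)
    (by norm_num) (by norm_num) (by norm_num)
  norm_num at this ⊢
  exact this

theorem antitoneOn_gF : AntitoneOn gF (Ico (95 / 97) 1) := by
  have hI : ∀ β ∈ Ico (95 / 97 : ℝ) 1, β ∈ Ioo (0 : ℝ) 1 :=
    fun β h => ⟨by linarith [h.1], h.2⟩
  refine antitoneOn_of_deriv_nonpos (convex_Ico _ 1)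
    (fun β h => (hasDerivAt_gF (hI β h)).continuousAt.continuousWithinAt) ?_ ?_ <;>
    rw [interior_Ico]
  · exact fun β h => (hasDerivAt_gF (hI β ⟨h.1.le, h.2⟩)).differentiableAt.differentiableWithinAt
  · intro β h'
    have h := hI β ⟨h'.1.le, h'.2⟩
    rw [(hasDerivAt_gF h).deriv]
    have hy := (yF_mem h).1
    have hp := pF_pos h
    have hn := nF_pos h
    have := h.1
    have k : 0 ≤ 2 + yF β + 3 * pF β - 6 * nF β := by
      by_cases c : β ≤ 127 / 129
      · obtain ⟨m1, -, m2, -⟩ := near_bounds_96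
        have m3 := antitoneOn_nF m1 h h'.1.le
        have m4 : (3 : ℝ) / 100 ≤ yF β := by
          have : β ^ 2 ≤ (127 / 129) ^ 2 := by gcongr
          unfold yF; linarith
        have m5 : nF β * pF β = yF β := by unfold nF; field_simp
        have m6 : (8 : ℝ) / 100 ≤ pF β := by nlinarith
        linarith
      · push Not at c
        obtain ⟨m1, -, m2, -⟩ := near_bounds_128
        have m3 := antitoneOn_nF m1 h c.le
        linarith
    exact neg_nonpos.2 (by positivity)

theorem GNLAt.of_near (h : β ∈ Ioo (0 : ℝ) 1) (hc : NearClaims (nF β) (gF β)) :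
    GNLAt β (yF β) (pF β) :=
  GNLAt.of_nearClaims hc h.1 (by unfold yF; ring) (nF_pos h) (gF_pos h) (yF_eq_near h)
    (pF_eq_near h) (yF_mem h).2 (pF_lt_one h) (flow_yF_pF h).H_pos

theorem NearClaims.of_mem {β₀ β₁ : ℝ} {a b c d : ℕ} (hchk : nearCheck a b c d = true) (hb : 0 < b)
    (hd : 0 < d) (h0 : 95 / 97 ≤ β₀) (h : β₀ ≤ β) (h' : β ≤ β₁) (h1 : β₁ < 1)
    (k1 : a ≤ 1024 * nF β₁) (k2 : 1024 * nF β₀ ≤ a + b) (k3 : c ≤ 1024 * gF β₁)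
    (k4 : 1024 * gF β₀ ≤ c + d) : NearClaims (nF β) (gF β) := by
  have i : ∀ x, β₀ ≤ x → x ≤ β₁ → x ∈ Ico (95 / 97 : ℝ) 1 :=
    fun x hx hx' => ⟨h0.trans hx, hx'.trans_lt h1⟩
  have i' : ∀ x, β₀ ≤ x → x ≤ β₁ → x ∈ Ioo (0 : ℝ) 1 :=
    fun x hx hx' => ⟨by linarith, hx'.trans_lt h1⟩
  have q0 := le_refl β₀
  have q1 := h.trans h'
  have m1 := antitoneOn_nF (i' β₀ q0 q1) (i' β h h') h
  have m2 := antitoneOn_nF (i' β h h') (i' β₁ q1 le_rfl) h'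
  have m3 := antitoneOn_gF (i β₀ q0 q1) (i β h h') h
  have m4 := antitoneOn_gF (i β h h') (i β₁ q1 le_rfl) h'
  exact nearCheck_sound hchk hb hd (by linarith) (by linarith) (by linarith) (by linarith)

theorem GNLAt.of_ge (h : 95 / 97 ≤ β) (h1 : β < 1) : GNLAt β (yF β) (pF β) := by
  have hβ : β ∈ Ioo (0 : ℝ) 1 := ⟨by linarith, h1⟩
  obtain ⟨a96, b96, c96, d96, e96⟩ := near_bounds_96
  obtain ⟨a128, b128, c128, d128, e128⟩ := near_bounds_128
  obtain ⟨a192, b192, c192, d192, e192⟩ := near_bounds_192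
  obtain ⟨a256, b256, c256, d256, e256⟩ := near_bounds_256
  obtain ⟨a512, b512, c512, d512, e512⟩ := near_bounds_512
  obtain ⟨a1024, b1024, c1024, d1024, e1024⟩ := near_bounds_1024
  obtain ⟨a4096, b4096, c4096, d4096, e4096⟩ := near_bounds_4096
  refine GNLAt.of_near hβ ?_
  by_cases c : β ≤ 127 / 129
  · refine NearClaims.of_mem nearCheck_96 (by norm_num) (by norm_num) (by norm_num) h c a128.2 ?_ ?_
      ?_ ?_ <;> push_cast <;> linarith
  have k := (not_le.1 c).le
  clear c
  by_cases c : β ≤ 191 / 193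
  · refine NearClaims.of_mem nearCheck_128 (by norm_num) (by norm_num) (by norm_num) k c a192.2 ?_ ?_
      ?_ ?_ <;> push_cast <;> linarith
  have k := (not_le.1 c).le
  clear c
  by_cases c : β ≤ 255 / 257
  · refine NearClaims.of_mem nearCheck_192 (by norm_num) (by norm_num) (by norm_num) k c a256.2 ?_ ?_
      ?_ ?_ <;> push_cast <;> linarith
  have k := (not_le.1 c).le
  clear c
  by_cases c : β ≤ 511 / 513
  · refine NearClaims.of_mem nearCheck_256 (by norm_num) (by norm_num) (by norm_num) k c a512.2 ?_ ?_
      ?_ ?_ <;> push_cast <;> linarith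
  have k := (not_le.1 c).le
  clear c
  by_cases c : β ≤ 1023 / 1025
  · refine NearClaims.of_mem nearCheck_512 (by norm_num) (by norm_num) (by norm_num) k c a1024.2 ?_ ?_
      ?_ ?_ <;> push_cast <;> linarith
  have k := (not_le.1 c).le
  clear c
  by_cases c : β ≤ 4095 / 4097
  · refine NearClaims.of_mem nearCheck_1024 (by norm_num) (by norm_num) (by norm_num) k c a4096.2 ?_ ?_
      ?_ ?_ <;> push_cast <;> linarith
  have k := (not_le.1 c).le
  clear c
  have m1 := antitoneOn_nF a4096 hβ k
  have m2 := antitoneOn_gF ⟨by norm_num, a4096.2⟩ ⟨h, h1⟩ k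
  have hn := nF_pos hβ
  have hg := gF_pos hβ
  by_cases c : 1024 * gF β ≤ 128
  · refine nearCheck_sound nearCheck_4096_low (by norm_num) (by norm_num) ?_ ?_ ?_ ?_ <;>
      push_cast <;> linarith
  · refine nearCheck_sound nearCheck_4096_high (by norm_num) (by norm_num) ?_ ?_ ?_ ?_ <;>
      push_cast <;> linarith

/-- The closure passes the test for all `β ∈ (0, 1)`. -/
theorem gnlAt (hβ : β ∈ Ioo (0 : ℝ) 1) : GNLAt β (yF β) (pF β) := by
  by_cases h : β ≤ 1003 / 1024
  · exact GNLAt.of_le hβ h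
  · exact GNLAt.of_ge (by linarith) hβ.2

end
end M1P

/-! ### The test in terms of `E₁ / E₀` -/

open MeasureTheory Set Filter Topology

namespace M1P

theorem outerGNL_of_pos {e v : ℝ} (he : e ∈ Ioo (0 : ℝ) 1) (hv : 0 < v) (hv' : v < 1 - e ^ 2) :
    OuterGNL (3 * e - bE e) (cE e) (deriv bE e) (deriv cE e) (deriv (deriv bE) e)
      (deriv (deriv cE) e) v := by
  obtain ⟨h1, h2, h3, h4, h5, h6⟩ := derivs_of_pos he
  have hβ := betaM_mem he
  have hE : eRatio (betaM e) = e := eRatio_betaM ⟨by linarith [he.1], he.2⟩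
  rw [h1, h2, h3, h4, h5, h6]
  have hx : betaM e ^ 2 = 1 - yF (betaM e) := by unfold yF; ring
  have hy := (yF_mem hβ).2
  have h4' : 4 - yF (betaM e) ≠ 0 := by linarith
  have key := gnlAt hβ v hv (hv'.trans_eq (by
    have e2 : e ^ 2 = 16 * (1 - yF (betaM e)) / (4 - yF (betaM e)) ^ 2 := by
      conv_lhs => rw [← hE]
      rw [eRatio, div_pow, mul_pow, hx]; congr 1 <;> ring
    rw [e2]; field_simp; ring))
  have hE' : 4 * betaM e / (3 + betaM e ^ 2) = e := hE
  rwa [hE'] at key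

/-- At `E₁ = 0` the closure is odd, and the roots are explicit. -/
theorem outerGNL_at_zero {v : ℝ} (hv : 0 < v) (hv' : v < 1) :
    OuterGNL 0 0 (27 / 35) (-12 / 35) 0 0 v := by
  have h0 : 0 < (27 * v + 12) / 35 := by positivity
  set R := √((27 * v + 12) / 35)
  have hR : 0 < R := Real.sqrt_pos.2 h0
  have hR2 : R ^ 2 = (27 * v + 12) / 35 := Real.sq_sqrt h0.le
  have hg : 0 < 2 * (27 / 35 : ℝ) * (R ^ 2 - v) := by rw [hR2]; linarith
  refine ⟨-R, 0, R, by linarith, hR, ?_, ?_, ?_, by linarith, hR.ne', ?_, ?_⟩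
  · unfold charS; linear_combination -R * hR2
  · unfold charS; ring
  · unfold charS; linear_combination R * hR2
  · unfold gnl; intro h; linarith
  · unfold gnl; intro h; linarith

theorem derivs_zero : bE 0 = 0 ∧ cE 0 = 0 ∧ deriv (deriv bE) 0 = 0 ∧ deriv (deriv cE) 0 = 0 := by
  have h1 := bE_neg 0
  have h2 := cE_neg 0
  have h3 := deriv_neg_of_even (deriv_neg_of_odd bE_neg) 0
  have h4 := deriv_neg_of_even (deriv_neg_of_odd cE_neg) 0
  rw [neg_zero] at h1 h2 h3 h4
  refine ⟨?_, ?_, ?_, ?_⟩ <;> linarith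

/-- On the whole range of `e = E₁ / E₀` and `v = E₂ / E₀ - e ^ 2`, the characteristic polynomial has
three simple roots, the outer two of which pass the test for genuine nonlinearity. -/
theorem outerGNL_closure {e v : ℝ} (he : e ∈ Ioo (-1 : ℝ) 1) (hv : 0 < v) (hv' : v < 1 - e ^ 2) :
    OuterGNL (3 * e - bE e) (cE e) (deriv bE e) (deriv cE e) (deriv (deriv bE) e)
      (deriv (deriv cE) e) v := by
  rcases lt_trichotomy e 0 with h | rfl | h
  · have := outerGNL_of_pos (e := -e) ⟨by linarith, by linarith [he.1]⟩ hv (by rwa [neg_sq])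
    rw [bE_neg, cE_neg, deriv_neg_of_odd bE_neg, deriv_neg_of_odd cE_neg,
      deriv_neg_of_even (deriv_neg_of_odd bE_neg),
      deriv_neg_of_even (deriv_neg_of_odd cE_neg)] at this
    refine OuterGNL.of_neg ?_
    rwa [show -(3 * e - bE e) = 3 * -e - -bE e by ring]
  · obtain ⟨h1, h2, h3, h4⟩ := derivs_zero
    rw [h1, h2, h3, h4, deriv_at_zero.1, deriv_at_zero.2, mul_zero, sub_zero]
    exact outerGNL_at_zero hv (by linarith)
  · exact outerGNL_of_pos ⟨h, he.2⟩ hv hv'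

end M1P

/-! ### The characteristic polynomial of the flux -/

open MeasureTheory Set Filter Topology

namespace M1P

/-- The strict moment inequalities between `E₀, E₁, E₂`. -/
def momentDomain : Set (Fin 3 → ℝ) :=
  {U | 0 < U 0 ∧ |U 1| < U 0 ∧ U 1 ^ 2 < U 0 * U 2 ∧ U 2 < U 0}

theorem isOpen_momentDomain : IsOpen momentDomain := by
  have h : ∀ i : Fin 3, Continuous fun U : Fin 3 → ℝ => U i := fun i => continuous_apply i
  exact (isOpen_lt continuous_const (h 0)).inter ((isOpen_lt (h 1).abs (h 0)).inter
    ((isOpen_lt ((h 1).pow 2) ((h 0).mul (h 2))).inter (isOpen_lt (h 2) (h 0))))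

/-- The characteristic polynomial of the Jacobian of the flux. -/
noncomputable def charU (U : Fin 3 → ℝ) (x : ℝ) : ℝ :=
  x ^ 3 - bE (U 1 / U 0) * x ^ 2 - (deriv gE (U 1 / U 0) + U 2 / U 0 * deriv bE (U 1 / U 0)) * x
    - (gE (U 1 / U 0) - U 1 / U 0 * deriv gE (U 1 / U 0)
      - U 1 / U 0 * (U 2 / U 0) * deriv bE (U 1 / U 0))

section
variable {U : Fin 3 → ℝ}

theorem ratio_mem (hU : U ∈ momentDomain) : U 1 / U 0 ∈ Ioo (-1 : ℝ) 1 := by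
  obtain ⟨h0, h1, -, -⟩ := hU
  rw [mem_Ioo, ← abs_lt, abs_div, abs_of_pos h0]
  exact (div_lt_one h0).2 h1

theorem ratio_bounds (hU : U ∈ momentDomain) :
    0 < U 2 / U 0 - (U 1 / U 0) ^ 2 ∧ U 2 / U 0 - (U 1 / U 0) ^ 2 < 1 - (U 1 / U 0) ^ 2 := by
  obtain ⟨h0, -, h2, h3⟩ := hU
  refine ⟨?_, sub_lt_sub_right ((div_lt_one h0).2 h3) _⟩
  rw [show U 2 / U 0 - (U 1 / U 0) ^ 2 = (U 0 * U 2 - U 1 ^ 2) / U 0 ^ 2 by field_simp]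
  have := sub_pos.2 h2
  positivity

theorem hasDerivAt_bE {e : ℝ} (he : e ∈ Ioo (-1 : ℝ) 1) :
    HasDerivAt bE (deriv bE e) e ∧ HasDerivAt (deriv bE) (deriv (deriv bE) e) e ∧
      HasDerivAt gE (deriv gE e) e ∧ HasDerivAt (deriv gE) (deriv (deriv gE) e) e := by
  have hn := isOpen_Ioo.mem_nhds he
  have key : ∀ f : ℝ → ℝ, ContDiffOn ℝ 2 f (Ioo (-1) 1) →
      HasDerivAt f (deriv f e) e ∧ HasDerivAt (deriv f) (deriv (deriv f) e) e := by
    intro f hf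
    have h1 : ContDiffOn ℝ 1 (deriv f) (Ioo (-1) 1) :=
      hf.deriv_of_isOpen isOpen_Ioo (by norm_num)
    exact ⟨((hf.differentiableOn (by norm_num)).differentiableAt hn).hasDerivAt,
      ((h1.differentiableOn (by norm_num)).differentiableAt hn).hasDerivAt⟩
  obtain ⟨h1, h2⟩ := key bE (contDiffOn_bE 2)
  obtain ⟨h3, h4⟩ := key gE (contDiffOn_gE 2)
  exact ⟨h1, h2, h3, h4⟩

theorem derivs_cE {e : ℝ} (he : e ∈ Ioo (-1 : ℝ) 1) :
    deriv cE e = 3 * e ^ 2 - 2 * e * bE e - e ^ 2 * deriv bE e - deriv gE e ∧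
    deriv (deriv cE) e = 6 * e - 2 * bE e - 4 * e * deriv bE e - e ^ 2 * deriv (deriv bE) e
      - deriv (deriv gE) e := by
  have h1 : ∀ x ∈ Ioo (-1 : ℝ) 1,
      deriv cE x = 3 * x ^ 2 - 2 * x * bE x - x ^ 2 * deriv bE x - deriv gE x := by
    intro x hx
    obtain ⟨k1, -, k3, -⟩ := hasDerivAt_bE hx
    have : HasDerivAt cE _ x :=
      (((hasDerivAt_id' x).fun_pow 3).fun_sub (k1.fun_mul ((hasDerivAt_id' x).fun_pow 2))).fun_sub k3
    rw [this.deriv]; push_cast; ring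
  refine ⟨h1 e he, ?_⟩
  obtain ⟨k1, k2, -, k4⟩ := hasDerivAt_bE he
  have hid := hasDerivAt_id' e
  have := ((((hid.fun_pow 2).const_mul 3).fun_sub ((hid.const_mul 2).fun_mul k1)).fun_sub
    ((hid.fun_pow 2).fun_mul k2)).fun_sub k4
  have e1 : deriv cE =ᶠ[𝓝 e]
      fun x => 3 * x ^ 2 - 2 * x * bE x - x ^ 2 * deriv bE x - deriv gE x := by
    filter_upwards [isOpen_Ioo.mem_nhds he] with x hx using h1 x hx
  rw [(this.congr_of_eventuallyEq e1).deriv]; push_cast; ring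

theorem charU_add (hU : U ∈ momentDomain) (s : ℝ) :
    charU U (U 1 / U 0 + s) = charS (3 * (U 1 / U 0) - bE (U 1 / U 0)) (cE (U 1 / U 0))
      (deriv bE (U 1 / U 0)) (deriv cE (U 1 / U 0)) (U 2 / U 0 - (U 1 / U 0) ^ 2) s := by
  rw [charU, charS, (derivs_cE (ratio_mem hU)).1, cE]; ring

/-- A monic cubic with three distinct roots is the product of its linear factors. -/
theorem cubic_eq_prod {a b c : ℝ} {s : Fin 3 → ℝ} (hs : StrictMono s)
    (h : ∀ k, s k ^ 3 - a * s k ^ 2 - b * s k - c = 0) (x : ℝ) :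
    x ^ 3 - a * x ^ 2 - b * x - c = (x - s 0) * (x - s 1) * (x - s 2) := by
  have d01 : s 0 - s 1 ≠ 0 := (sub_neg.2 (hs (by decide))).ne
  have d02 : s 0 - s 2 ≠ 0 := (sub_neg.2 (hs (by decide))).ne
  have d12 : s 1 - s 2 ≠ 0 := (sub_neg.2 (hs (by decide))).ne
  have k0 := h 0
  have k1 := h 1
  have k2 := h 2
  have e1 : s 0 ^ 2 + s 0 * s 1 + s 1 ^ 2 - a * (s 0 + s 1) - b = 0 :=
    mul_left_cancel₀ d01 (by linear_combination k0 - k1)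
  have e2 : s 1 ^ 2 + s 1 * s 2 + s 2 ^ 2 - a * (s 1 + s 2) - b = 0 :=
    mul_left_cancel₀ d12 (by linear_combination k1 - k2)
  have e3 : a = s 0 + s 1 + s 2 :=
    mul_left_cancel₀ d02 (by linear_combination e2 - e1)
  have e4 : b = s 0 ^ 2 + s 0 * s 1 + s 1 ^ 2 - a * (s 0 + s 1) := by linear_combination -e1
  have e5 : c = s 0 ^ 3 - a * s 0 ^ 2 - b * s 0 := by linear_combination -k0
  rw [e5, e4, e3]; ring

theorem charU_eq_prod {s : Fin 3 → ℝ} (hs : StrictMono s) (h : ∀ k, charU U (s k) = 0) (x : ℝ) :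
    charU U x = (x - s 0) * (x - s 1) * (x - s 2) := cubic_eq_prod hs h x

theorem roots_unique {s t : Fin 3 → ℝ} (hs : StrictMono s) (ht : StrictMono t)
    (h : ∀ k, charU U (s k) = 0) (h' : ∀ k, charU U (t k) = 0) : s = t := by
  have key : ∀ {s : Fin 3 → ℝ}, StrictMono s → (∀ k, charU U (s k) = 0) →
      range s = {x | charU U x = 0} := by
    intro s hs h
    ext x
    simp only [mem_range, mem_ofPred_eq]
    constructor
    · rintro ⟨k, rfl⟩; exact h k
    · intro hx
      rw [charU_eq_prod hs h, mul_eq_zero, mul_eq_zero, sub_eq_zero, sub_eq_zero, sub_eq_zero] at hx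
      rcases hx with (hx | hx) | hx
      exacts [⟨0, hx.symm⟩, ⟨1, hx.symm⟩, ⟨2, hx.symm⟩]
  exact (hs.range_inj ht).1 ((key hs h).trans (key ht h').symm)

/-- The value at the speed `x` of the factor deciding about genuine nonlinearity: on an eigenvector
`r` with `r 0 = 1` the derivative of the speed is `gnlU U x / (U 0 * χ'(x))`. -/
noncomputable def gnlU (U : Fin 3 → ℝ) (x : ℝ) : ℝ :=
  (x - U 1 / U 0) * gnl (3 * (U 1 / U 0) - bE (U 1 / U 0)) (deriv bE (U 1 / U 0))
    (deriv (deriv bE) (U 1 / U 0)) (deriv (deriv cE) (U 1 / U 0))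
    (U 2 / U 0 - (U 1 / U 0) ^ 2) (x - U 1 / U 0)

theorem exists_roots (hU : U ∈ momentDomain) : ∃ s : Fin 3 → ℝ, StrictMono s ∧
    (∀ k, charU U (s k) = 0) ∧ gnlU U (s 0) ≠ 0 ∧ gnlU U (s 2) ≠ 0 := by
  obtain ⟨hv, hv'⟩ := ratio_bounds hU
  obtain ⟨s₁, s₂, s₃, h12, h23, r1, r2, r3, n1, n3, g1, g3⟩ :=
    outerGNL_closure (ratio_mem hU) hv hv'
  rw [← charU_add hU] at r1 r2 r3
  refine ⟨![U 1 / U 0 + s₁, U 1 / U 0 + s₂, U 1 / U 0 + s₃], ?_, ?_, ?_, ?_⟩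
  · rw [Fin.strictMono_iff_lt_succ]
    intro i
    fin_cases i <;> simpa
  · intro k
    fin_cases k <;> assumption
  · simpa [gnlU] using ⟨n1, g1⟩
  · simpa [gnlU] using ⟨n3, g3⟩

open Classical in
/-- The characteristic speeds in increasing order (`0` outside the domain). -/
noncomputable def speed (k : Fin 3) (U : Fin 3 → ℝ) : ℝ :=
  if h : U ∈ momentDomain then (exists_roots h).choose k else 0

theorem speed_spec (hU : U ∈ momentDomain) : StrictMono (fun k => speed k U) ∧
    (∀ k, charU U (speed k U) = 0) ∧ gnlU U (speed 0 U) ≠ 0 ∧ gnlU U (speed 2 U) ≠ 0 := by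
  have e : (fun k => speed k U) = (exists_roots hU).choose := by
    funext k; simp [speed, hU]
  have h := (exists_roots hU).choose_spec
  rw [← e] at h
  exact h

theorem hasDerivAt_charU (x : ℝ) : HasDerivAt (charU U) (3 * x ^ 2 - bE (U 1 / U 0) * (2 * x)
    - (deriv gE (U 1 / U 0) + U 2 / U 0 * deriv bE (U 1 / U 0))) x := by
  have hid := hasDerivAt_id' x
  refine ((((hid.fun_pow 3).fun_sub ((hid.fun_pow 2).const_mul _)).fun_sub
    (hid.const_mul _)).sub_const _).congr_deriv ?_
  push_cast; ring

/-- The roots are simple. -/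
theorem deriv_charU_ne_zero (hU : U ∈ momentDomain) (k : Fin 3) :
    deriv (charU U) (speed k U) ≠ 0 := by
  obtain ⟨hs, h, -⟩ := speed_spec hU
  have e : charU U = fun x => (x - speed 0 U) * (x - speed 1 U) * (x - speed 2 U) :=
    funext (charU_eq_prod hs h)
  have d01 : speed 0 U < speed 1 U := hs (by decide : (0 : Fin 3) < 1)
  have d12 : speed 1 U < speed 2 U := hs (by decide : (1 : Fin 3) < 2)
  have hd : ∀ x, HasDerivAt (charU U) ((x - speed 1 U) * (x - speed 2 U)
      + (x - speed 0 U) * (x - speed 2 U) + (x - speed 0 U) * (x - speed 1 U)) x := by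
    intro x
    rw [e]
    have hid := hasDerivAt_id' x
    refine (((hid.sub_const _).fun_mul (hid.sub_const _)).fun_mul (hid.sub_const _)).congr_deriv ?_
    ring
  rw [(hd _).deriv]
  have p01 := sub_pos.2 d01
  have p12 := sub_pos.2 d12
  have p02 := sub_pos.2 (d01.trans d12)
  have n01 := p01.ne'
  fin_cases k
  · have := mul_pos p01 p02
    simp only [Fin.zero_eta]; nlinarith
  · have := mul_pos p01 p12
    simp only [Fin.mk_one]; nlinarith
  · have := mul_pos p02 p12
    simp only [Fin.reduceFinMk]; nlinarith

end
end M1P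

/-! ### Differentiability of the flux and of the characteristic speeds -/

open MeasureTheory Set Filter Topology

namespace M1P

section
variable {U r : Fin 3 → ℝ}

theorem closureE3_eqOn (hU : U ∈ momentDomain) :
    closureE3 U = U 0 * gE (U 1 / U 0) + U 2 * bE (U 1 / U 0) := by
  have he := ratio_mem hU
  have hβ := abs_betaM_lt he
  rw [closureE3_eq hβ (alphaM1_eq _ _) (by
    rw [eRatio_betaM he, mul_div_cancel₀ _ hU.1.ne'])]
  rfl

theorem hasDerivAt_line (U r : Fin 3 → ℝ) (t : ℝ) : HasDerivAt (fun t : ℝ => U + t • r) r t := by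
  simpa using ((hasDerivAt_id' t).smul_const r).const_add U

theorem hasDerivAt_line_apply (U r : Fin 3 → ℝ) (i : Fin 3) (t : ℝ) :
    HasDerivAt (fun t : ℝ => (U + t • r) i) (r i) t := (hasDerivAt_pi.1 (hasDerivAt_line U r t)) i

theorem hasDerivAt_ratio (hU : U ∈ momentDomain) (r : Fin 3 → ℝ) (i : Fin 3) :
    HasDerivAt (fun t : ℝ => (U + t • r) i / (U + t • r) 0) ((r i - U i / U 0 * r 0) / U 0) 0 := by
  have h0 : U 0 ≠ 0 := hU.1.ne'
  refine ((hasDerivAt_line_apply U r i 0).fun_div (hasDerivAt_line_apply U r 0 0)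
    (by simpa using h0)).congr_deriv ?_
  simp only [zero_smul, add_zero]
  field_simp

theorem line_zero (U r : Fin 3 → ℝ) : U + (0 : ℝ) • r = U := by simp

theorem HasDerivAt.comp_ratio {f : ℝ → ℝ} {f' : ℝ} (hU : U ∈ momentDomain) (r : Fin 3 → ℝ)
    (hf : HasDerivAt f f' (U 1 / U 0)) :
    HasDerivAt (fun t : ℝ => f ((U + t • r) 1 / (U + t • r) 0))
      (f' * ((r 1 - U 1 / U 0 * r 0) / U 0)) 0 := by
  have := hasDerivAt_ratio hU r 1
  refine HasDerivAt.comp (0 : ℝ) (h := fun t : ℝ => (U + t • r) 1 / (U + t • r) 0) ?_ this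
  simpa using hf

theorem contDiffAt_comp_ratio {f : ℝ → ℝ} {n : ℕ} (hf : ContDiffOn ℝ n f (Ioo (-1) 1))
    (hU : U ∈ momentDomain) : ContDiffAt ℝ n (fun U : Fin 3 → ℝ => f (U 1 / U 0)) U := by
  have h : ContDiffAt ℝ n (fun U : Fin 3 → ℝ => U 1 / U 0) U :=
    (contDiff_apply ℝ ℝ 1).contDiffAt.div (contDiff_apply ℝ ℝ 0).contDiffAt hU.1.ne'
  exact ContDiffAt.comp U (hf.contDiffAt (isOpen_Ioo.mem_nhds (ratio_mem hU))) h

theorem contDiffOn_deriv_bE : ContDiffOn ℝ (1 : ℕ) (deriv bE) (Ioo (-1) 1) ∧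
    ContDiffOn ℝ (1 : ℕ) (deriv gE) (Ioo (-1) 1) :=
  ⟨(contDiffOn_bE 2).deriv_of_isOpen isOpen_Ioo (by norm_num),
    (contDiffOn_gE 2).deriv_of_isOpen isOpen_Ioo (by norm_num)⟩

theorem differentiableAt_closureE3 (hU : U ∈ momentDomain) : DifferentiableAt ℝ closureE3 U := by
  have e : closureE3 =ᶠ[𝓝 U] fun U => U 0 * gE (U 1 / U 0) + U 2 * bE (U 1 / U 0) := by
    filter_upwards [isOpen_momentDomain.mem_nhds hU] with V hV using closureE3_eqOn hV
  have hb := (contDiffAt_comp_ratio (contDiffOn_bE 1) hU).differentiableAt (by norm_num)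
  have hg := (contDiffAt_comp_ratio (contDiffOn_gE 1) hU).differentiableAt (by norm_num)
  exact (((differentiableAt_apply 0 U).mul hg).add
    ((differentiableAt_apply 2 U).mul hb)).congr_of_eventuallyEq e

theorem differentiableAt_flux (hU : U ∈ momentDomain) : DifferentiableAt ℝ flux U := by
  rw [differentiableAt_pi]
  intro i
  fin_cases i
  · exact differentiableAt_apply 1 U
  · exact differentiableAt_apply 2 U
  · exact differentiableAt_closureE3 hU

/-- The derivative of `f` along a line. -/
theorem hasDerivAt_comp_line {E : Type*} [NormedAddCommGroup E] [NormedSpace ℝ E]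
    {f : (Fin 3 → ℝ) → E} (hf : DifferentiableAt ℝ f U) (r : Fin 3 → ℝ) :
    HasDerivAt (fun t : ℝ => f (U + t • r)) (fderiv ℝ f U r) 0 := by
  have h : HasFDerivAt f (fderiv ℝ f U) (U + (0 : ℝ) • r) := by
    rw [line_zero]; exact hf.hasFDerivAt
  exact h.comp_hasDerivAt (0 : ℝ) (hasDerivAt_line U r 0)

theorem fderiv_closureE3 (hU : U ∈ momentDomain) (r : Fin 3 → ℝ) :
    fderiv ℝ closureE3 U r = bE (U 1 / U 0) * r 2
      + (deriv gE (U 1 / U 0) + U 2 / U 0 * deriv bE (U 1 / U 0)) * r 1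
      + (gE (U 1 / U 0) - U 1 / U 0 * deriv gE (U 1 / U 0)
        - U 1 / U 0 * (U 2 / U 0) * deriv bE (U 1 / U 0)) * r 0 := by
  obtain ⟨k1, -, k3, -⟩ := hasDerivAt_bE (ratio_mem hU)
  have h1 := hasDerivAt_comp_line (differentiableAt_closureE3 hU) r
  have h2 := ((hasDerivAt_line_apply U r 0 0).fun_mul (HasDerivAt.comp_ratio hU r k3)).fun_add
    ((hasDerivAt_line_apply U r 2 0).fun_mul (HasDerivAt.comp_ratio hU r k1))
  have hev : ∀ᶠ t in 𝓝 (0 : ℝ), U + t • r ∈ momentDomain := by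
    refine (hasDerivAt_line U r 0).continuousAt.eventually_mem (isOpen_momentDomain.mem_nhds ?_)
    rwa [line_zero]
  have h3 := h1.unique (h2.congr_of_eventuallyEq (by
    filter_upwards [hev] with t ht using closureE3_eqOn ht))
  rw [h3]
  have h0 : U 0 ≠ 0 := hU.1.ne'
  simp only [zero_smul, add_zero]
  field_simp
  ring

theorem fderiv_flux (hU : U ∈ momentDomain) (r : Fin 3 → ℝ) :
    fderiv ℝ flux U r = ![r 1, r 2, fderiv ℝ closureE3 U r] := by
  have h := hasDerivAt_pi.1 (hasDerivAt_comp_line (differentiableAt_flux hU) r)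
  funext i
  fin_cases i
  · exact (h 0).unique (hasDerivAt_line_apply U r 1 0)
  · exact (h 1).unique (hasDerivAt_line_apply U r 2 0)
  · exact (h 2).unique (hasDerivAt_comp_line (differentiableAt_closureE3 hU) r)

/-- The eigenvectors of the Jacobian are the multiples of `(1, x, x ^ 2)`. -/
theorem eigenvector_apply {x : ℝ} (hU : U ∈ momentDomain) (h : Module.End.HasEigenvector
    (fderiv ℝ flux U : (Fin 3 → ℝ) →ₗ[ℝ] (Fin 3 → ℝ)) x r) :
    r 0 ≠ 0 ∧ r 1 = x * r 0 ∧ r 2 = x ^ 2 * r 0 := by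
  have h1 : fderiv ℝ flux U r = x • r := h.apply_eq_smul
  rw [fderiv_flux hU] at h1
  have e0 : r 1 = x * r 0 := congrFun h1 0
  have e1 : r 2 = x * r 1 := congrFun h1 1
  refine ⟨fun h0 => h.2 ?_, e0, by rw [e1, e0]; ring⟩
  rw [h0, mul_zero] at e0
  rw [e0, mul_zero] at e1
  funext i
  fin_cases i <;> assumption

theorem hasEigenvector_of_root {x : ℝ} (hU : U ∈ momentDomain) (h : charU U x = 0) :
    Module.End.HasEigenvector (fderiv ℝ flux U : (Fin 3 → ℝ) →ₗ[ℝ] (Fin 3 → ℝ)) x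
      ![1, x, x ^ 2] := by
  refine ⟨Module.End.mem_eigenspace_iff.2 ?_, fun h0 => one_ne_zero (congrFun h0 0)⟩
  change fderiv ℝ flux U _ = _
  rw [fderiv_flux hU, fderiv_closureE3 hU]
  unfold charU at h
  funext i
  fin_cases i
  · simp
  · simp [sq]
  · simp
    linear_combination -h

theorem contDiffAt_charU (hU : U ∈ momentDomain) (x : ℝ) :
    ContDiffAt ℝ (1 : ℕ) (fun q : (Fin 3 → ℝ) × ℝ => charU q.1 q.2) (U, x) := by
  have key : ∀ f : (Fin 3 → ℝ) → ℝ, ContDiffAt ℝ (1 : ℕ) f U →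
      ContDiffAt ℝ (1 : ℕ) (fun q : (Fin 3 → ℝ) × ℝ => f q.1) (U, x) :=
    fun f hf => ContDiffAt.comp (U, x) hf contDiffAt_fst
  have hb := key _ (contDiffAt_comp_ratio (contDiffOn_bE 1) hU)
  have hg := key _ (contDiffAt_comp_ratio (contDiffOn_gE 1) hU)
  have hb' := key _ (contDiffAt_comp_ratio contDiffOn_deriv_bE.1 hU)
  have hg' := key _ (contDiffAt_comp_ratio contDiffOn_deriv_bE.2 hU)
  have h1 := key _ (contDiffAt_comp_ratio (f := fun e => e) (n := 1) contDiffOn_id hU)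
  have h2 : ContDiffAt ℝ (1 : ℕ) (fun q : (Fin 3 → ℝ) × ℝ => q.1 2 / q.1 0) (U, x) :=
    key _ ((contDiff_apply ℝ ℝ 2).contDiffAt.div (contDiff_apply ℝ ℝ 0).contDiffAt hU.1.ne')
  have hx : ContDiffAt ℝ (1 : ℕ) (fun q : (Fin 3 → ℝ) × ℝ => q.2) (U, x) := contDiffAt_snd
  exact (((hx.pow 3).sub (hb.mul (hx.pow 2))).sub ((hg'.add (h2.mul hb')).mul hx)).sub
    ((hg.sub (h1.mul hg')).sub ((h1.mul h2).mul hb'))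

/-- A simple root of the characteristic polynomial continues to a differentiable root. -/
theorem exists_local_root {x : ℝ} (hU : U ∈ momentDomain) (h : charU U x = 0)
    (hd : deriv (charU U) x ≠ 0) : ∃ ψ : (Fin 3 → ℝ) → ℝ, ψ U = x ∧ DifferentiableAt ℝ ψ U ∧
      ∀ᶠ V in 𝓝 U, charU V (ψ V) = 0 := by
  have hc := contDiffAt_charU hU x
  have hn : ((1 : ℕ) : WithTop ℕ∞) ≠ 0 := by norm_num
  set L := fderiv ℝ (fun q : (Fin 3 → ℝ) × ℝ => charU q.1 q.2) (U, x) ∘L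
    .inr ℝ (Fin 3 → ℝ) ℝ with hL
  have hL1 : ∀ t : ℝ, L t = deriv (charU U) x * t := by
    intro t
    have h1 : HasFDerivAt (fun q : (Fin 3 → ℝ) × ℝ => charU q.1 q.2) _ (U, x) :=
      (hc.differentiableAt hn).hasFDerivAt
    have h2 : HasFDerivAt (charU U) L x := h1.comp x (hasFDerivAt_prodMk_right U x)
    have h3 : L 1 = deriv (charU U) x := h2.hasDerivAt.deriv.symm
    have h4 : L (t • (1 : ℝ)) = t • L 1 := L.map_smul t 1
    rw [smul_eq_mul, mul_one, smul_eq_mul] at h4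
    rw [h4, h3, mul_comm]
  have hinv : L.IsInvertible := by
    refine ⟨ContinuousLinearEquiv.unitsEquivAut ℝ (Units.mk0 _ hd), ?_⟩
    ext
    simp [hL1]
  refine ⟨hc.implicitFunction hn hinv, hc.implicitFunction_apply_self hn hinv,
    (hc.contDiffAt_implicitFunction hn hinv).differentiableAt hn, ?_⟩
  filter_upwards [hc.eventually_apply_implicitFunction hn hinv] with V hV
  exact hV.trans h

/-- The local continuations of the three roots stay in increasing order near `U`, hence coincide
there with the three speeds. -/
theorem differentiableAt_speed (hU : U ∈ momentDomain) (k : Fin 3) :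
    DifferentiableAt ℝ (speed k) U := by
  obtain ⟨hs, hr, -⟩ := speed_spec hU
  choose ψ h1 h2 h3 using fun k => exists_local_root hU (hr k) (deriv_charU_ne_zero hU k)
  have hlt : ∀ i j : Fin 3, i < j → ∀ᶠ V in 𝓝 U, ψ i V < ψ j V := by
    intro i j hij
    refine (h2 i).continuousAt.eventually_lt (h2 j).continuousAt ?_
    rw [h1, h1]; exact hs hij
  have e : speed k =ᶠ[𝓝 U] ψ k := by
    filter_upwards [isOpen_momentDomain.mem_nhds hU, eventually_all.2 h3, hlt 0 1 (by decide),
      hlt 1 2 (by decide)] with V hV k0 k1 k2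
    obtain ⟨hs', hr', -⟩ := speed_spec hV
    refine congrFun (roots_unique hs' (t := fun k => ψ k V) ?_ hr' k0) k
    rw [Fin.strictMono_iff_lt_succ]
    intro i
    fin_cases i
    · exact k1
    · exact k2
  exact (h2 k).congr_of_eventuallyEq e

/-- Implicit differentiation of the characteristic equation along an eigenvector. -/
theorem deriv_charU_mul_fderiv_speed (hU : U ∈ momentDomain) (k : Fin 3)
    (hr1 : r 1 = speed k U * r 0) (hr2 : r 2 = speed k U ^ 2 * r 0) :
    deriv (charU U) (speed k U) * fderiv ℝ (speed k) U r =
      r 0 / U 0 * gnlU U (speed k U) := by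
  have hev : ∀ᶠ t in 𝓝 (0 : ℝ), charU (U + t • r) (speed k (U + t • r)) = 0 := by
    have : ∀ᶠ t in 𝓝 (0 : ℝ), U + t • r ∈ momentDomain := by
      refine (hasDerivAt_line U r 0).continuousAt.eventually_mem (isOpen_momentDomain.mem_nhds ?_)
      rwa [line_zero]
    filter_upwards [this] with t ht using (speed_spec ht).2.1 k
  obtain ⟨k1, k2, k3, k4⟩ := hasDerivAt_bE (ratio_mem hU)
  have c1 := HasDerivAt.comp_ratio hU r k1
  have c2 := HasDerivAt.comp_ratio hU r k2
  have c3 := HasDerivAt.comp_ratio hU r k3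
  have c4 := HasDerivAt.comp_ratio hU r k4
  have e1 := hasDerivAt_ratio hU r 1
  have e2 := hasDerivAt_ratio hU r 2
  have hx := hasDerivAt_comp_line (differentiableAt_speed hU k) r
  have H := ((((hx.fun_pow 3).fun_sub (c1.fun_mul (hx.fun_pow 2))).fun_sub
    ((c4.fun_add (e2.fun_mul c2)).fun_mul hx)).fun_sub
    ((c3.fun_sub (e1.fun_mul c4)).fun_sub ((e1.fun_mul e2).fun_mul c2)))
  have key := H.unique ((hasDerivAt_const (0 : ℝ) (0 : ℝ)).congr_of_eventuallyEq hev)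
  rw [hasDerivAt_charU _ |>.deriv]
  unfold gnlU gnl
  rw [(derivs_cE (ratio_mem hU)).2]
  simp only [zero_smul, add_zero, hr1, hr2] at key
  have h0 : U 0 ≠ 0 := hU.1.ne'
  have hd : ∀ z, z / U 0 = z * (U 0)⁻¹ := fun z => div_eq_mul_inv _ _
  push_cast at key
  norm_num at key
  linear_combination key

end
end M1P

/-! ### Realizable moments -/

open MeasureTheory Set Filter Topology

namespace M1P

theorem realizableDomain_subset : realizableDomain ⊆ momentDomain := by
  rintro U ⟨I, hI, hpos, hU⟩
  have hint : ∀ k : ℕ, IntervalIntegrable (fun μ => μ ^ k * I μ) volume (-1) 1 :=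
    fun k => hI.continuousOn_mul (by fun_prop)
  have hq : ∀ a b c : ℝ, IntervalIntegrable (fun μ => (a + b * μ + c * μ ^ 2) * I μ) volume (-1) 1 ∧
      ∫ μ in (-1 : ℝ)..1, (a + b * μ + c * μ ^ 2) * I μ = a * U 0 + b * U 1 + c * U 2 := by
    intro a b c
    refine ⟨hI.continuousOn_mul (by fun_prop), ?_⟩
    have e : (fun μ => (a + b * μ + c * μ ^ 2) * I μ) =
        fun μ => a * (μ ^ 0 * I μ) + b * (μ ^ 1 * I μ) + c * (μ ^ 2 * I μ) := by
      funext μ; ring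
    rw [e, intervalIntegral.integral_add (((hint 0).const_mul a).add ((hint 1).const_mul b))
      ((hint 2).const_mul c), intervalIntegral.integral_add ((hint 0).const_mul a)
      ((hint 1).const_mul b), intervalIntegral.integral_const_mul,
      intervalIntegral.integral_const_mul, intervalIntegral.integral_const_mul]
    have k0 := hU 0
    have k1 := hU 1
    have k2 := hU 2
    simp only [moment] at k0 k1 k2
    rw [← k0, ← k1, ← k2]
    rfl
  have hI' : ∀ μ ∈ Ioo (-1 : ℝ) 1, 0 < I μ := fun μ h => hpos μ ⟨h.1.le, h.2.le⟩
  have key : ∀ a b c : ℝ, (∀ μ ∈ Ioo (-1 : ℝ) 1, 0 < a + b * μ + c * μ ^ 2) →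
      0 < a * U 0 + b * U 1 + c * U 2 := by
    intro a b c h
    rw [← (hq a b c).2]
    exact intervalIntegral.intervalIntegral_pos_of_pos_on (hq a b c).1
      (fun μ hμ => mul_pos (h μ hμ) (hI' μ hμ)) (by norm_num)
  have h0 : 0 < U 0 := by simpa using key 1 0 0 (fun μ _ => by norm_num)
  have h1 := key 1 1 0 (fun μ h => by linarith [h.1])
  have h2 := key 1 (-1) 0 (fun μ h => by linarith [h.2])
  have h3 := key 1 0 (-1) (fun μ h => by nlinarith [h.1, h.2])
  have habs : |U 1| < U 0 := abs_lt.2 ⟨by linarith, by linarith⟩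
  refine ⟨h0, habs, ?_, by linarith⟩
  -- `(μ - e) ^ 2` vanishes at `e` only, so the integral is split there
  obtain ⟨e, he⟩ : ∃ e, e = U 1 / U 0 := ⟨_, rfl⟩
  have he' : U 1 = e * U 0 := by rw [he, div_mul_cancel₀ _ h0.ne']
  have he1 : e ∈ Ioo (-1 : ℝ) 1 := by
    rw [mem_Ioo, ← abs_lt, he, abs_div, abs_of_pos h0]; exact (div_lt_one h0).2 habs
  obtain ⟨hq1, hq2⟩ := hq (e ^ 2) (-2 * e) 1
  have hsq : ∀ μ, μ ≠ e → 0 < e ^ 2 + -2 * e * μ + 1 * μ ^ 2 := by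
    intro μ hμ
    have := sub_ne_zero.2 hμ
    have : 0 < (μ - e) ^ 2 := by positivity
    linarith
  have i1 := hq1.mono_set (c := -1) (d := e) (by
    rw [uIcc_of_le he1.1.le, uIcc_of_le (by norm_num)]; exact Icc_subset_Icc_right he1.2.le)
  have i2 := hq1.mono_set (c := e) (d := 1) (by
    rw [uIcc_of_le he1.2.le, uIcc_of_le (by norm_num)]; exact Icc_subset_Icc_left he1.1.le)
  have p1 := intervalIntegral.intervalIntegral_pos_of_pos_on i1
    (fun μ hμ => mul_pos (hsq μ hμ.2.ne) (hI' μ ⟨hμ.1, hμ.2.trans he1.2⟩)) he1.1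
  have p2 := intervalIntegral.intervalIntegral_pos_of_pos_on i2
    (fun μ hμ => mul_pos (hsq μ hμ.1.ne') (hI' μ ⟨he1.1.trans hμ.1, hμ.2⟩)) he1.2
  have p := add_pos p1 p2
  rw [intervalIntegral.integral_add_adjacent_intervals i1 i2, hq2, he'] at p
  have : 0 < U 0 * (e ^ 2 * U 0 + -2 * e * (e * U 0) + 1 * U 2) := mul_pos h0 p
  rw [he']
  linarith

/-- The moments of `1 + a μ + b (μ ^ 2 - 1 / 3)`. -/
theorem quadratic_mem_realizableDomain {a b : ℝ} (ha : |a| < 1 / 2) (hb : 0 ≤ b) (hb' : b < 1) :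
    ![2, 2 / 3 * a, 2 / 3 + 8 / 45 * b] ∈ realizableDomain := by
  refine ⟨fun μ => 1 + a * μ + b * (μ ^ 2 - 1 / 3), Continuous.intervalIntegrable (by fun_prop) _ _,
    fun μ hμ => ?_, fun k => ?_⟩
  · have h1 : |a * μ| < 1 / 2 := by
      rw [abs_mul]
      have : |μ| ≤ 1 := abs_le.2 hμ
      exact (mul_le_of_le_one_right (abs_nonneg a) this).trans_lt ha
    have h2 : 0 ≤ b * μ ^ 2 := by positivity
    have := (abs_lt.1 h1).1
    linarith
  · have key : ∀ k : ℕ, moment (fun μ => 1 + a * μ + b * (μ ^ 2 - 1 / 3)) k =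
        ((1 - b / 3) / (k + 1) + a / (k + 2) + b / (k + 3)) -
          ((1 - b / 3) * (-1) ^ (k + 1) / (k + 1) + a * (-1) ^ (k + 2) / (k + 2)
            + b * (-1) ^ (k + 3) / (k + 3)) := by
      intro k
      have hd : ∀ x : ℝ, HasDerivAt (fun μ : ℝ => (1 - b / 3) * μ ^ (k + 1) / (k + 1)
          + a * μ ^ (k + 2) / (k + 2) + b * μ ^ (k + 3) / (k + 3))
          (x ^ k * (1 + a * x + b * (x ^ 2 - 1 / 3))) x := by
        intro x
        have hid := hasDerivAt_id' x
        refine (((((hid.fun_pow (k + 1)).const_mul (1 - b / 3)).div_const (k + 1 : ℝ)).fun_add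
          (((hid.fun_pow (k + 2)).const_mul a).div_const (k + 2 : ℝ))).fun_add
          (((hid.fun_pow (k + 3)).const_mul b).div_const (k + 3 : ℝ))).congr_deriv ?_
        simp only [Nat.add_sub_cancel]
        push_cast
        field_simp
        ring
      rw [moment, intervalIntegral.integral_eq_sub_of_hasDerivAt (fun x _ => hd x)
        (Continuous.intervalIntegrable (by fun_prop) _ _)]
      simp
    rw [key]
    fin_cases k <;> norm_num <;> ring

end M1P

/-! ### The three characteristic fields -/

namespace M1P
open MeasureTheory Set Filter Topology

theorem fderiv_speed_ne_zero {U r : Fin 3 → ℝ} (hU : U ∈ momentDomain) {k : Fin 3}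
    (hg : gnlU U (speed k U) ≠ 0) (hr : Module.End.HasEigenvector
      (fderiv ℝ flux U : (Fin 3 → ℝ) →ₗ[ℝ] (Fin 3 → ℝ)) (speed k U) r) :
    fderiv ℝ (speed k) U r ≠ 0 := by
  obtain ⟨h0, h1, h2⟩ := eigenvector_apply hU hr
  have key := deriv_charU_mul_fderiv_speed hU k h1 h2
  intro h
  rw [h, mul_zero] at key
  exact mul_ne_zero (div_ne_zero h0 hU.1.ne') hg key.symm

/-- At the moments of the constant intensity the second speed is `E₁ / E₀ = 0`, and the derivative
along its field vanishes. -/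
theorem not_genuinelyNonlinearOn_speed_one :
    ¬ GenuinelyNonlinearOn flux realizableDomain (speed 1) := by
  intro h
  have hU : ![2, 2 / 3 * 0, 2 / 3 + 8 / 45 * 0] ∈ realizableDomain :=
    quadratic_mem_realizableDomain (by norm_num) le_rfl one_pos
  set U : Fin 3 → ℝ := ![2, 2 / 3 * 0, 2 / 3 + 8 / 45 * 0] with hUd
  have hm := realizableDomain_subset hU
  have e1 : U 1 / U 0 = 0 := by simp [hUd]
  have e2 : U 2 / U 0 = 1 / 3 := by simp [hUd]; norm_num
  obtain ⟨hs, hr, -⟩ := speed_spec hm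
  have hch : ∀ s, charU U s = charS 0 0 (27 / 35) (-12 / 35) (1 / 3) s := by
    intro s
    have := charU_add hm s
    obtain ⟨h1, h2, -⟩ := derivs_zero
    rw [e1, e2, h1, h2, deriv_at_zero.1, deriv_at_zero.2] at this
    norm_num at this ⊢
    exact this
  obtain ⟨R, hR, hR2⟩ : ∃ R : ℝ, 0 < R ∧ R ^ 2 = 3 / 5 :=
    ⟨√(3 / 5), by positivity, Real.sq_sqrt (by norm_num)⟩
  have hu := roots_unique hs (t := ![-R, 0, R]) (by
    rw [Fin.strictMono_iff_lt_succ]; intro i; fin_cases i <;> simpa) hr (by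
    intro k
    rw [hch]
    unfold charS
    fin_cases k <;> simp
    · linear_combination -R * hR2
    · linear_combination R * hR2)
  have h1 : speed 1 U = 0 := congrFun hu 1
  have hev := hasEigenvector_of_root hm (hr 1)
  refine h U hU _ hev ?_
  have key := deriv_charU_mul_fderiv_speed hm 1 (r := ![1, speed 1 U, speed 1 U ^ 2])
    (by simp) (by simp)
  have hg : gnlU U (speed 1 U) = 0 := by simp [gnlU, h1, e1]
  rw [hg, mul_zero] at key
  exact (mul_eq_zero.1 key).resolve_left (deriv_charU_ne_zero hm 1)

/-- If the second field were linearly degenerate, then for a fixed small `e = E₁ / E₀ > 0` every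
`E₂` would give a root of the same non-zero quartic, and these roots are different. -/
theorem not_linearlyDegenerateOn_speed_one :
    ¬ LinearlyDegenerateOn flux realizableDomain (speed 1) := by
  intro h
  obtain ⟨e, he0, he1, hb, hc⟩ : ∃ e : ℝ, 0 < e ∧ e < 1 / 6 ∧ 0 < deriv bE e ∧ cE e ≠ 0 := by
    have m0 : (0 : ℝ) ∈ Ioo (-1 : ℝ) 1 := by norm_num
    have k1 : ∀ᶠ e in 𝓝[>] (0 : ℝ), 0 < deriv bE e := by
      refine ((hasDerivAt_bE m0).2.1.continuousAt.eventually_const_lt ?_).filter_mono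
        nhdsWithin_le_nhds
      rw [deriv_at_zero.1]; norm_num
    have k2 : ∀ᶠ e in 𝓝[>] (0 : ℝ), cE e ≠ 0 := by
      have hd : HasDerivAt cE (deriv cE 0) 0 :=
        ((contDiffOn_cE 1).differentiableOn (by norm_num) 0 m0 |>.differentiableAt
          (isOpen_Ioo.mem_nhds m0)).hasDerivAt
      have := hd.eventually_ne (c := 0) (by rw [deriv_at_zero.2]; norm_num)
      exact this.filter_mono (nhdsWithin_mono _ fun x hx => ne_of_gt hx)
    have k3 : ∀ᶠ e in 𝓝[>] (0 : ℝ), e ∈ Ioo (0 : ℝ) (1 / 6) := Ioo_mem_nhdsGT (by norm_num)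
    obtain ⟨e, h1, h2, h3⟩ := (k1.and (k2.and k3)).exists
    exact ⟨e, h3.1, h3.2, h1, h2⟩
  have hU : ∀ b ∈ Ioo (0 : ℝ) 1, ![2, 2 / 3 * (3 * e), 2 / 3 + 8 / 45 * b] ∈ realizableDomain :=
    fun b hb => quadratic_mem_realizableDomain (by rw [abs_of_pos (by linarith)]; linarith)
      hb.1.le hb.2
  let V : ℝ → Fin 3 → ℝ := fun b => ![2, 2 / 3 * (3 * e), 2 / 3 + 8 / 45 * b]
  let a := 3 * e - bE e
  let v : ℝ → ℝ := fun b => 1 / 3 + 4 / 45 * b - e ^ 2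
  have e1 : ∀ b, V b 1 / V b 0 = e := by intro b; simp [V]; ring
  have e2 : ∀ b, V b 2 / V b 0 = 1 / 3 + 4 / 45 * b := by intro b; simp [V]; ring
  have hroot : ∀ b ∈ Ioo (0 : ℝ) 1,
      charS a (cE e) (deriv bE e) (deriv cE e) (v b) (speed 1 (V b) - e) = 0 := by
    intro b hb
    have hm := realizableDomain_subset (hU b hb)
    have := charU_add hm (speed 1 (V b) - e)
    rw [e1, e2, add_sub_cancel, (speed_spec hm).2.1 1] at this
    exact this.symm
  have hne : ∀ b ∈ Ioo (0 : ℝ) 1, speed 1 (V b) - e ≠ 0 := by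
    intro b hb h0
    have := hroot b hb
    rw [h0] at this
    exact hc (by simpa [charS] using this)
  have hq : ∀ b ∈ Ioo (0 : ℝ) 1, quartic a (cE e) (deriv bE e) (deriv cE e) (deriv (deriv bE) e)
      (deriv (deriv cE) e) (speed 1 (V b) - e) = 0 := by
    intro b hb
    have hm := realizableDomain_subset (hU b hb)
    have hev := hasEigenvector_of_root hm ((speed_spec hm).2.1 1)
    have key := deriv_charU_mul_fderiv_speed hm 1
      (r := ![1, speed 1 (V b), speed 1 (V b) ^ 2]) (by simp [V]) (by simp [V])
    have hz : fderiv ℝ (speed 1) (V b) ![1, speed 1 (V b), speed 1 (V b) ^ 2] = 0 :=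
      h _ (hU b hb) _ hev
    change _ * fderiv ℝ (speed 1) (V b) ![1, speed 1 (V b), speed 1 (V b) ^ 2]
      = _ / _ * gnlU (V b) (speed 1 (V b)) at key
    rw [hz, mul_zero] at key
    have hg : gnlU (V b) (speed 1 (V b)) = 0 :=
      (mul_eq_zero.1 key.symm).resolve_left (div_ne_zero one_ne_zero hm.1.ne')
    rw [gnlU, e1, e2] at hg
    have hg' := (mul_eq_zero.1 hg).resolve_left (hne b hb)
    rw [← mul_gnl (hroot b hb)]
    exact mul_eq_zero_of_right _ hg'
  have hinj : InjOn (fun b => speed 1 (V b) - e) (Ioo (0 : ℝ) 1) := by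
    intro b hb' b' hb'' heq
    have k1 := hroot b hb'
    have k2 := hroot b' hb''
    simp only at heq
    rw [← heq] at k2
    have : (v b' - v b) * (deriv bE e * (speed 1 (V b) - e)) = 0 := by
      unfold charS at k1 k2; linear_combination k1 - k2
    have := (mul_eq_zero.1 this).resolve_right (mul_ne_zero hb.ne' (hne b hb'))
    simp only [v] at this
    linarith
  let q : Polynomial ℝ :=
    .C (deriv (deriv bE) e) * .X ^ 4
      + .C (2 * deriv bE e ^ 2 - 2 * deriv bE e + a * deriv (deriv bE) e) * .X ^ 3
      + .C (deriv cE e * deriv (deriv bE) e - deriv (deriv cE) e * deriv bE e) * .X ^ 2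
      + .C (cE e * deriv (deriv bE) e - 2 * deriv bE e * deriv cE e) * .X
      + .C (-2 * deriv bE e * cE e)
  have hqe : ∀ s, q.eval s = quartic a (cE e) (deriv bE e) (deriv cE e) (deriv (deriv bE) e)
      (deriv (deriv cE) e) s := by
    intro s; simp [q, quartic]; ring
  have hq0 : q ≠ 0 := by
    intro h0
    have := hqe 0
    rw [h0] at this
    simp [quartic, hb.ne', hc] at this
  have hinf : {s | q.IsRoot s}.Infinite :=
    Set.infinite_of_injOn_mapsTo hinj (fun b hb => (hqe _).trans (hq b hb))
      (Ioo_infinite zero_lt_one)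
  exact hinf (Polynomial.finite_setOfPred_isRoot hq0)

end M1P

theorem mainTheorem3 :
    ∃ lam : Fin 3 → (Fin 3 → ℝ) → ℝ,
      (∀ U ∈ M1P.realizableDomain,
        DifferentiableAt ℝ M1P.flux U ∧
        lam 0 U < lam 1 U ∧ lam 1 U < lam 2 U ∧
        (∀ k : Fin 3,
          Module.End.HasEigenvalue
            (fderiv ℝ M1P.flux U : (Fin 3 → ℝ) →ₗ[ℝ] (Fin 3 → ℝ)) (lam k U)) ∧
        ∀ k : Fin 3, DifferentiableAt ℝ (lam k) U) ∧
      M1P.GenuinelyNonlinearOn M1P.flux M1P.realizableDomain (lam 0) ∧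
      M1P.GenuinelyNonlinearOn M1P.flux M1P.realizableDomain (lam 2) ∧
      ¬ M1P.GenuinelyNonlinearOn M1P.flux M1P.realizableDomain (lam 1) ∧
      ¬ M1P.LinearlyDegenerateOn M1P.flux M1P.realizableDomain (lam 1) := by
  refine ⟨M1P.speed, fun U hU => ?_, fun U hU r hr => ?_, fun U hU r hr => ?_,
    M1P.not_genuinelyNonlinearOn_speed_one, M1P.not_linearlyDegenerateOn_speed_one⟩
  · have hm := M1P.realizableDomain_subset hU
    obtain ⟨hs, hr, -⟩ := M1P.speed_spec hm
    exact ⟨M1P.differentiableAt_flux hm, hs (by decide : (0 : Fin 3) < 1),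
      hs (by decide : (1 : Fin 3) < 2),
      fun k => Module.End.hasEigenvalue_of_hasEigenvector (M1P.hasEigenvector_of_root hm (hr k)),
      M1P.differentiableAt_speed hm⟩
  · have hm := M1P.realizableDomain_subset hU
    exact M1P.fderiv_speed_ne_zero hm (M1P.speed_spec hm).2.2.1 hr
  · have hm := M1P.realizableDomain_subset hU
    exact M1P.fderiv_speed_ne_zero hm (M1P.speed_spec hm).2.2.2 hr
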